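/- Let $G$ be an additive abelian group. All sets below are subsets of $G$, and every subgroup $K\le G$ may serve as the ambient group; the following notions are relative to $K$. **Trios.** A *trio in $K$* is a triple $(A,B,C)$ of subsets of $K$, each finite or cofinite in $K$, with $0\notin A+B+C$. It is *nontrivial* if $A,B,C$ are all nonempty. It is *critical* if $\ell+m-n>0$ (that is, $n<\ell+m$), where $n$ is the size of the complement in $K$ of a largest of the three sets and $\ell,m$ are the sizes of the other two. It is *maximal* if the only trio $(A^*,B^*,C^*)$ in $K$ with $A\subseteq A^*$, $B\subseteq B^*$, $C\subseteq C^*$ is $(A,B,C)$ itself. Two trios in $K$ are *similar* if one is obtained from the other by a finite sequence of permutations of the three sets and operations $(A,B,C)\mapsto(A+g,B-g,C)$ with $g\in K$. **Conventions.** $\overline{X}=K\setminus X$. $G_X=\{g : g+X=X\}$ is the stabilizer of $X$. $X$ is *$H$-stable* if $X+H=X$. For nonempty $X$ there is a least subgroup one of whose cosets contains $X$; that coset is denoted $[X]$. If $H<K$ is finite and $R\in K/H$ generates $K/H$, an *$R$-sequence* is a union $\bigcup_{i=0}^{k}(S+iR)$ with $S\in K/H$, $k\ge 0$; it is *basic*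 if $S=H$ and *nontrivial* if $k\ge 1$. **Beats and chords.** Let $\Upsilon$ be a trio in $K$ and let $H<K$ be a proper subgroup. * $\Upsilon$ is a *pure beat relative to $H$* if $H$ is finite and $\Upsilon$ is similar to a trio $(A,B,C)$ with $A=H$, $G_B=H$ and $C=\overline{-(A+B)}\neq\emptyset$. * $\Upsilon$ is a *pure chord relative to $H$* if $H$ is finite, $K/H$ is cyclic, and there are a generator $R$ of $K/H$ and a trio $(A,B,C)$ similar to $\Upsilon$ such that $A,B$ are nontrivial $R$-sequences and $C=\overline{-(A+B)}$ is not contained in a single $H$-coset. * $\Upsilon$ is an *impure beat relative to $H$* ($H$ possibly infinite) if it is similar to a trio $(A,B,C)$ such that $[A]=H$, $B\setminus H$ is $H$-stable, $C\setminus H=\overline{-(A+B)}\setminus H$, $B\cap H\ne\emptyset$ and $C\cap H\neq\emptyset$. Then $(A,B\cap H,C\cap H)$, a trio in $H$, is called a *continuation* of $\Upsilon$. * $\Upsilon$ is an *impure chord relative to $H$* if $H$ is finite, $K/H$ is cyclic, and there are a generator $R$ of $K/H$ and a trio $(A,B,C)$ similar to $\Upsilon$ such that $H\cup A$ and $H\cup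 B$ are nontrivial basic $R$-sequences, $C\setminus H=\overline{-(A+B)}\setminus H\ne\emptyset$, and $A\cap H$, $B\cap H$, $C\cap H$ are all nonempty. Then $(A\cap H,B\cap H,C\cap H)$, a trio in $H$, is called a *continuation* of $\Upsilon$. **Theorem (Kemperman).** Let $\Upsilon_1$ be a maximal nontrivial critical trio in an abelian group $G_1$. Then there exist $m\ge 1$, subgroups $G_1>G_2>\dots>G_m$ and trios $\Upsilon_1,\Upsilon_2,\dots,\Upsilon_m$, with $\Upsilon_i$ a trio in $G_i$, such that 1. for $1\le i\le m-1$, $\Upsilon_i$ is (in $G_i$) an impure beat or an impure chord relative to $G_{i+1}$, with continuation $\Upsilon_{i+1}$; 2. $\Upsilon_m$ is (in $G_m$) a pure beat or a pure chord relative to some proper subgroup of $G_m$. -/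

import Mathlib

open scoped Pointwise

namespace Kemperman

/-- An ordered triple of subsets of an abelian group. -/
@[ext]
structure Triple (G : Type*) where
  A : Set G
  B : Set G
  C : Set G

variable {G : Type*} [AddCommGroup G]

/-! All notions below are relative to an ambient subgroup `K` of `G`, so that the trios of a
descending chain of subgroups can be compared as triples of subsets of one group. For `K = ⊤`
they are the notions for the group `G` itself. -/

/-- `T` is a trio in the group `K`: its members are subsets of `K`, each of them finite or cofinite
in `K`, and `0 ∉ A + B + C`. -/
structure IsTrio (K : AddSubgroup G) (T : Triple G) : Prop where
  subset_A : T.A ⊆ K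
  subset_B : T.B ⊆ K
  subset_C : T.C ⊆ K
  finite_or_cofinite_A : T.A.Finite ∨ ((K : Set G) \ T.A).Finite
  finite_or_cofinite_B : T.B.Finite ∨ ((K : Set G) \ T.B).Finite
  finite_or_cofinite_C : T.C.Finite ∨ ((K : Set G) \ T.C).Finite
  zero_notMem : (0 : G) ∉ T.A + T.B + T.C

/-- No member of the triple is empty. -/
def IsNontrivial (T : Triple G) : Prop :=
  T.A.Nonempty ∧ T.B.Nonempty ∧ T.C.Nonempty

/-- The deficiency `ℓ + m - n` is positive, where `n` is the size of the complement in `K` of a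
largest of the three sets and `ℓ`, `m` are the sizes of the other two. The three cases say which
set is taken as the largest one. Sizes are in `ℕ∞`. -/
def IsCritical (K : AddSubgroup G) (T : Triple G) : Prop :=
  (T.B.encard ≤ T.A.encard ∧ T.C.encard ≤ T.A.encard ∧
    ((K : Set G) \ T.A).encard < T.B.encard + T.C.encard) ∨
  (T.A.encard ≤ T.B.encard ∧ T.C.encard ≤ T.B.encard ∧
    ((K : Set G) \ T.B).encard < T.A.encard + T.C.encard) ∨
  (T.A.encard ≤ T.C.encard ∧ T.B.encard ≤ T.C.encard ∧
    ((K : Set G) \ T.C).encard < T.A.encard + T.B.encard)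

/-- The only trio in `K` which contains `T` memberwise is `T` itself. -/
def IsMaximal (K : AddSubgroup G) (T : Triple G) : Prop :=
  ∀ T' : Triple G, IsTrio K T' → T.A ⊆ T'.A → T.B ⊆ T'.B → T.C ⊆ T'.C → T' = T

/-- The elementary operations on trios in `K`: two transpositions, which generate all permutations
of the three sets, and the opposite translation of two of the sets by an element of `K`. -/
inductive SimilarStep (K : AddSubgroup G) : Triple G → Triple G → Prop
  | swapAB (A B C : Set G) : SimilarStep K ⟨A, B, C⟩ ⟨B, A, C⟩
  | swapBC (A B C : Set G) : SimilarStep K ⟨A, B, C⟩ ⟨A, C, B⟩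
  | translate (A B C : Set G) (g : G) (hg : g ∈ K) :
      SimilarStep K ⟨A, B, C⟩ ⟨g +ᵥ A, (-g) +ᵥ B, C⟩

/-- Two triples are similar if a finite sequence of elementary operations takes one to the other
(each operation is undone by a sequence of such operations). -/
def Similar (K : AddSubgroup G) : Triple G → Triple G → Prop :=
  Relation.ReflTransGen (SimilarStep K)

/-- The complement in `K` of `-(A + B)`. -/
def third (K : AddSubgroup G) (A B : Set G) : Set G :=
  (K : Set G) \ (-(A + B))

/-- `A` is a union of `H`-cosets. -/
def IsStable (H : AddSubgroup G) (A : Set G) : Prop :=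
  A + (H : Set G) = A

/-- For nonempty `A`: the closure `[A]` is the subgroup `H` itself, that is, `H` is the least
subgroup one of whose cosets contains `A`, and this coset is `H`. -/
def HasClosure (A : Set G) (H : AddSubgroup G) : Prop :=
  A.Nonempty ∧ A ⊆ H ∧ IsLeast {L : AddSubgroup G | ∃ g : G, A ⊆ g +ᵥ (L : Set G)} H

/-- The coset `r + H` of an element `r` of `K` generates the quotient group `K / H`. -/
def GeneratesQuotient (K H : AddSubgroup G) (r : G) : Prop :=
  r ∈ K ∧ H ⊔ AddSubgroup.zmultiples r = K

/-- The union of the `H`-cosets `a + i r + H` for `0 ≤ i ≤ k`; with `R = r + H` this is the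
`R`-sequence of length `k + 1` with head `a + H`. -/
def cosetSequence (H : AddSubgroup G) (r a : G) (k : ℕ) : Set G :=
  ⋃ i ∈ Set.Iic k, ((a + i • r) +ᵥ (H : Set G))

/-- `S ⊆ K` is an `(r + H)`-sequence of length at least `2`. -/
def IsNontrivialSequence (K H : AddSubgroup G) (r : G) (S : Set G) : Prop :=
  ∃ a ∈ K, ∃ k : ℕ, 1 ≤ k ∧ S = cosetSequence H r a k

/-- `S` is an `(r + H)`-sequence of length at least `2` with head `H`. -/
def IsNontrivialBasicSequence (H : AddSubgroup G) (r : G) (S : Set G) : Prop :=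
  ∃ k : ℕ, 1 ≤ k ∧ S = cosetSequence H r 0 k

/-- `T` is a pure beat in `K` relative to `H`. -/
def IsPureBeat (K H : AddSubgroup G) (T : Triple G) : Prop :=
  H < K ∧ (H : Set G).Finite ∧
  ∃ T' : Triple G, Similar K T T' ∧
    T'.A = H ∧
    AddAction.stabilizer G T'.B = H ∧
    T'.C = third K T'.A T'.B ∧ T'.C.Nonempty

/-- `T` is a pure chord in `K` relative to `H`. -/
def IsPureChord (K H : AddSubgroup G) (T : Triple G) : Prop :=
  H < K ∧ (H : Set G).Finite ∧
  ∃ r : G, GeneratesQuotient K H r ∧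
  ∃ T' : Triple G, Similar K T T' ∧
    IsNontrivialSequence K H r T'.A ∧ IsNontrivialSequence K H r T'.B ∧
    T'.C = third K T'.A T'.B ∧ ¬ ∃ g ∈ K, T'.C ⊆ g +ᵥ (H : Set G)

/-- `T` is an impure beat in `K` relative to `H` (which may be infinite), with continuation `T₂`,
a triple of subsets of `H`. -/
def IsImpureBeat (K H : AddSubgroup G) (T T₂ : Triple G) : Prop :=
  H < K ∧
  ∃ T' : Triple G, Similar K T T' ∧
    HasClosure T'.A H ∧
    IsStable H (T'.B \ H) ∧
    T'.C \ H = third K T'.A T'.B \ H ∧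
    (T'.B ∩ H).Nonempty ∧ (T'.C ∩ H).Nonempty ∧
    T₂ = ⟨T'.A, T'.B ∩ H, T'.C ∩ H⟩

/-- `T` is an impure chord in `K` relative to `H`, with continuation `T₂`, a triple of subsets
of `H`. -/
def IsImpureChord (K H : AddSubgroup G) (T T₂ : Triple G) : Prop :=
  H < K ∧ (H : Set G).Finite ∧
  ∃ r : G, GeneratesQuotient K H r ∧
  ∃ T' : Triple G, Similar K T T' ∧
    IsNontrivialBasicSequence H r ((H : Set G) ∪ T'.A) ∧
    IsNontrivialBasicSequence H r ((H : Set G) ∪ T'.B) ∧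
    T'.C \ H = third K T'.A T'.B \ H ∧ (T'.C \ H).Nonempty ∧
    (T'.A ∩ H).Nonempty ∧ (T'.B ∩ H).Nonempty ∧ (T'.C ∩ H).Nonempty ∧
    T₂ = ⟨T'.A ∩ H, T'.B ∩ H, T'.C ∩ H⟩

end Kemperman

open scoped Pointwise

namespace Kemperman
open Finset

set_option linter.unusedSectionVars false

/-! ### Submodularity and Mann's inequality -/

section Mann

variable {G : Type*} [AddCommGroup G]

/-! A maximal nontrivial critical trio is, up to similarity, given by two finite sets `A`, `B` with
`|A + B| < |A| + |B|` and `A + B ≠ G`, neither of which can grow without enlarging `A + B`; the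
third member `C` is the complement of `-(A + B)`. The tool throughout is the submodularity of `X ↦
|A + X|`. It yields `mann`: among the nonempty `X` with `A + X ≠ G`, the excess `|A + X| - |X|` is
smallest at some finite subgroup.

Beats. If `A` contains 0 and generates a proper subgroup `H`, each `H`-coset met by `B` but not
filled by `A + B` has excess at least `|A| / 2`. Criticality allows at most one such coset
(`MaxPair.periodic_off_coset`), and maximality makes `B` periodic on the others.

Chords. Let `A` be a smallest of the three sets, contained in no proper coset. Choose a finite
subgroup `M` of minimal excess and, among these, of maximal order (`Good`). Critical pairs with `A`
stay critical modulo `M`, and the image of `A` has no subgroup obstruction left. Vosper's theorem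
applies to it: a smallest critical partner is a Sidon set, hence has two elements, so the image of
`A` is a progression (`eq_ap_of_frag`, `Good.exists_proj_eq_ap`). A partner whose sum with `A`
misses an `M`-coset then also lies over a progression with the same difference, and counting missing
elements coset by coset shows that the sum fills all its cosets except possibly one at an end
(`Good.full_off_end`). If `A + B` meets every `M`-coset, then `A + C` does not
(`Good.exists_notMem_proj_add`), and `C` takes the place of `B`.

Induction. An impure beat or chord leaves a maximal critical pair in the subgroup. The group order
decreases in the finite case; before that, `pairSize` decreases, because a set which generates `H`
spans `H` but not `G`. -/

theorem exists_forall_le_nat {α : Type*} (P : α → Prop) (f : α → ℕ) (h : ∃ x, P x) :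
    ∃ x, P x ∧ ∀ y, P y → f x ≤ f y := by
  obtain ⟨x, hx, hmin⟩ := (measure f).wf.has_min {x | P x} h
  exact ⟨x, hx, fun y hy => not_lt.1 (hmin y hy)⟩

/-- The elements of a finite subgroup, as a finset. -/
noncomputable def elems (N : AddSubgroup G) [Finite N] : Finset G :=
  (Set.toFinite (N : Set G)).toFinset

@[simp]
theorem mem_elems {N : AddSubgroup G} [Finite N] {x : G} : x ∈ elems N ↔ x ∈ N := by
  simp [elems]

theorem elems_nonempty (N : AddSubgroup G) [Finite N] : (elems N).Nonempty :=
  ⟨0, by simp [N.zero_mem]⟩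

theorem card_elems_pos (N : AddSubgroup G) [Finite N] : 0 < #(elems N) :=
  (elems_nonempty N).card_pos

variable [DecidableEq G]

theorem card_add_inter_add_card_add_union_le (A X Y : Finset G) :
    #(A + X ∩ Y) + #(A + (X ∪ Y)) ≤ #(A + X) + #(A + Y) := by
  have h1 : A + X ∩ Y ⊆ (A + X) ∩ (A + Y) := add_inter_subset
  have h2 : A + (X ∪ Y) = (A + X) ∪ (A + Y) := add_union
  have := card_inter_add_card_union (A + X) (A + Y)
  have := card_le_card h1
  rw [h2]
  omega

theorem add_vadd_finset (A X : Finset G) (g : G) : A + (g +ᵥ X) = g +ᵥ (A + X) :=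
  add_vadd_comm g A X

/-- Mann's inequality inside a subgroup `L`. -/
theorem mann (L : AddSubgroup G) {A X : Finset G} (hA : A.Nonempty) (hAL : ∀ a ∈ A, a ∈ L)
    (hX : X.Nonempty) (hXL : ∀ x ∈ X, x ∈ L) (hAX : ∃ z ∈ L, z ∉ A + X) :
    ∃ N : AddSubgroup G, ∃ _ : Finite N, N ≤ L ∧ (∃ z ∈ L, z ∉ A + elems N) ∧
      #X + #(A + elems N) ≤ #(A + X) + #(elems N) := by
  let P : Finset G → Prop := fun X => X.Nonempty ∧ (∀ x ∈ X, x ∈ L) ∧ ∃ z ∈ L, z ∉ A + X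
  have hle : ∀ X : Finset G, #X ≤ #(A + X) := fun X => card_le_card_add_left hA
  -- `X₀` will have the least excess `|A + X| - |X|` and, among such sets, the least size.
  obtain ⟨X₁, hX₁, hmin₁⟩ := exists_forall_le_nat P (fun X => #(A + X) - #X) ⟨X, hX, hXL, hAX⟩
  obtain ⟨X₀, ⟨hP, hd⟩, hcard⟩ := exists_forall_le_nat
    (fun X => P X ∧ #(A + X) - #X = #(A + X₁) - #X₁) (fun X => #X) ⟨X₁, hX₁, rfl⟩
  have hmin : ∀ Y, P Y → #(A + X₀) - #X₀ ≤ #(A + Y) - #Y := fun Y hY => by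
    rw [hd]; exact hmin₁ Y hY
  have hcard' : ∀ Y, P Y → #(A + Y) - #Y ≤ #(A + X₀) - #X₀ → #X₀ ≤ #Y := fun Y hY h =>
    hcard Y ⟨hY, by rw [← hd]; exact le_antisymm h (hmin Y hY)⟩
  obtain ⟨hX₀, hX₀L, z₀, hz₀L, hz₀⟩ := hP
  -- Translates of `X₀` are equal or disjoint: by submodularity a nonempty intersection again has
  -- minimal excess, so it cannot be smaller than `X₀`.
  have key : ∀ g : G, (X₀ ∩ (g +ᵥ X₀)).Nonempty → g +ᵥ X₀ = X₀ := by
    intro g hI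
    have hgL : g ∈ L := by
      obtain ⟨x, hx⟩ := hI
      obtain ⟨hx1, hx2⟩ := mem_inter.1 hx
      obtain ⟨y, hy, rfl⟩ := mem_vadd_finset.1 hx2
      have := L.sub_mem (hX₀L _ hx1) (hX₀L _ hy)
      simpa [vadd_eq_add] using this
    have hUL : ∀ x ∈ X₀ ∪ (g +ᵥ X₀), x ∈ L := by
      intro x hx
      rcases mem_union.1 hx with hx | hx
      · exact hX₀L x hx
      · obtain ⟨y, hy, rfl⟩ := mem_vadd_finset.1 hx
        exact L.add_mem hgL (hX₀L y hy)
    have hsub := card_add_inter_add_card_add_union_le A X₀ (g +ᵥ X₀)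
    rw [add_vadd_finset, card_vadd_finset] at hsub
    have hIU := card_inter_add_card_union X₀ (g +ᵥ X₀)
    rw [card_vadd_finset] at hIU
    have hPI : P (X₀ ∩ (g +ᵥ X₀)) := ⟨hI, fun x hx => hX₀L x (mem_inter.1 hx).1, z₀, hz₀L,
      fun h => hz₀ (add_subset_add_left inter_subset_left h)⟩
    have hmI := hmin _ hPI
    have hIcard : #(X₀ ∩ (g +ᵥ X₀)) ≤ #X₀ := card_le_card inter_subset_left
    have l1 := hle X₀
    have l2 := hle (X₀ ∩ (g +ᵥ X₀))
    have l3 := hle (X₀ ∪ (g +ᵥ X₀))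
    by_cases hU : ∃ z ∈ L, z ∉ A + (X₀ ∪ (g +ᵥ X₀))
    · have hmU := hmin _ ⟨hX₀.mono subset_union_left, hUL, hU⟩
      have := hcard' _ hPI (by omega)
      have hEq : X₀ ∩ (g +ᵥ X₀) = X₀ := eq_of_subset_of_card_le inter_subset_left this
      have hs : X₀ ⊆ g +ᵥ X₀ := inter_eq_left.1 hEq
      exact (eq_of_subset_of_card_le hs (by rw [card_vadd_finset])).symm
    · exfalso
      push Not at hU
      set U := A + (X₀ ∪ (g +ᵥ X₀)) with hUdef
      have hUL' : ∀ x ∈ U, x ∈ L := by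
        intro x hx
        obtain ⟨a, ha, y, hy, rfl⟩ := mem_add.1 hx
        exact L.add_mem (hAL a ha) (hUL y hy)
      have hsubU : A + X₀ ⊆ U := add_subset_add_left subset_union_left
      -- If the union fills `L`, nothing bounds its excess from below. Instead, the negated
      -- complement `Y` of `A + X₀` has excess at most that of `X₀`, so `|X₀| ≤ |Y|`; submodularity
      -- then leaves no room for the intersection.
      set Y := (U \ (A + X₀)).image (fun z => -z) with hY
      have hYcard : #Y + #(A + X₀) = #U := by
        rw [hY, card_image_of_injective _ neg_injective, card_sdiff_add_card_eq_card hsubU]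
      have hYL : ∀ y ∈ Y, y ∈ L := by
        intro y hy
        obtain ⟨z, hz, rfl⟩ := mem_image.1 hy
        exact L.neg_mem (hUL' z (mem_sdiff.1 hz).1)
      have hYne : Y.Nonempty := ⟨-z₀, mem_image_of_mem _ (mem_sdiff.2 ⟨hU z₀ hz₀L, hz₀⟩)⟩
      have hmiss : ∀ x ∈ X₀, -x ∉ A + Y := by
        intro x hx hmem
        obtain ⟨a, ha, y, hy, hay⟩ := mem_add.1 hmem
        obtain ⟨z, hz, rfl⟩ := mem_image.1 hy
        refine (mem_sdiff.1 hz).2 (mem_add.2 ⟨a, ha, x, hx, ?_⟩)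
        have : a - z = -x := by rw [← hay]; abel
        rw [← neg_neg x, ← this]; abel
      have hAYcard : #(A + Y) + #X₀ ≤ #U := by
        have hd : Disjoint (A + Y) (X₀.image (fun z => -z)) := by
          rw [disjoint_right]
          intro w hw
          obtain ⟨x, hx, rfl⟩ := mem_image.1 hw
          exact hmiss x hx
        rw [← card_image_of_injective X₀ neg_injective, ← card_union_of_disjoint hd]
        apply card_le_card
        apply union_subset
        · intro w hw
          obtain ⟨a, ha, y, hy, rfl⟩ := mem_add.1 hw
          exact hU _ (L.add_mem (hAL a ha) (hYL y hy))
        · intro w hw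
          obtain ⟨x, hx, rfl⟩ := mem_image.1 hw
          exact hU _ (L.neg_mem (hX₀L x hx))
      obtain ⟨x₁, hx₁⟩ := hX₀
      have hPY : P Y := ⟨hYne, hYL, -x₁, L.neg_mem (hX₀L _ hx₁), hmiss x₁ hx₁⟩
      have l4 := hle Y
      have := hcard' Y hPY (by omega)
      have := hI.card_pos
      omega
  obtain ⟨x₀, hx₀⟩ := hX₀
  -- By `key`, `X₀` is a single coset of its stabilizer.
  let N : AddSubgroup G := AddAction.stabilizer G X₀
  have hNX : ∀ g, g ∈ N ↔ x₀ + g ∈ X₀ := by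
    intro g
    constructor
    · intro hg
      have hg' : g +ᵥ X₀ = X₀ := hg
      rw [← hg', add_comm]
      exact vadd_mem_vadd_finset hx₀
    · intro hg
      refine key g ⟨x₀ + g, mem_inter.2 ⟨hg, ?_⟩⟩
      rw [add_comm]
      exact vadd_mem_vadd_finset hx₀
  have hfin : Finite N := by
    have : (N : Set G) ⊆ (((-x₀) +ᵥ X₀ : Finset G) : Set G) := by
      intro g hg
      rw [mem_coe, mem_vadd_finset]
      exact ⟨x₀ + g, (hNX g).1 hg, by simp [vadd_eq_add]⟩
    exact (Finset.finite_toSet _).subset this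
  have hXN : x₀ +ᵥ elems N = X₀ := by
    ext x
    rw [mem_vadd_finset]
    constructor
    · rintro ⟨g, hg, rfl⟩
      exact (hNX g).1 (mem_elems.1 hg)
    · intro hx
      exact ⟨x - x₀, mem_elems.2 ((hNX _).2 (by simpa using hx)), by simp [vadd_eq_add]⟩
  refine ⟨N, hfin, ?_, ⟨-x₀ + z₀, L.add_mem (L.neg_mem (hX₀L _ hx₀)) hz₀L, ?_⟩, ?_⟩
  · intro g hg
    have := L.sub_mem (hX₀L _ ((hNX g).1 hg)) (hX₀L _ hx₀)
    simpa using this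
  · intro h
    apply hz₀
    rw [← hXN, add_vadd_finset, mem_vadd_finset]
    exact ⟨_, h, by simp [vadd_eq_add]⟩
  · have h1 := hmin X ⟨hX, hXL, hAX⟩
    have l1 := hle X
    have l2 := hle X₀
    have e1 : #(A + X₀) = #(A + elems N) := by
      rw [← hXN, add_vadd_finset, card_vadd_finset]
    have e2 : #X₀ = #(elems N) := by rw [← hXN, card_vadd_finset]
    omega

end Mann

/-! ### Periodicity when one set generates a subgroup -/

section Beat

variable {G : Type*} [AddCommGroup G]

/-- The part of `X` in the coset of `b` modulo `H`. -/
noncomputable def piece (H : AddSubgroup G) (b : G) (X : Finset G) : Finset G :=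
  open Classical in X.filter fun x => x - b ∈ H

@[simp]
theorem mem_piece {H : AddSubgroup G} {b x : G} {X : Finset G} :
    x ∈ piece H b X ↔ x ∈ X ∧ x - b ∈ H := by
  simp [piece]

theorem piece_subset (H : AddSubgroup G) (b : G) (X : Finset G) : piece H b X ⊆ X :=
  fun _ hx => (mem_piece.1 hx).1

theorem self_mem_piece {H : AddSubgroup G} {b : G} {X : Finset G} (hb : b ∈ X) :
    b ∈ piece H b X := by
  simp [hb, H.zero_mem]

variable [DecidableEq G]

/-- A pair of finite sets which forms a maximal nontrivial critical trio together with the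
complement of `-(A + B)`. -/
structure MaxPair (A B : Finset G) : Prop where
  nonempty_left : A.Nonempty
  nonempty_right : B.Nonempty
  exists_notMem : ∃ z, z ∉ A + B
  card_lt : #(A + B) < #A + #B
  max_left : ∀ x, (∀ b ∈ B, x + b ∈ A + B) → x ∈ A
  max_right : ∀ y, (∀ a ∈ A, a + y ∈ A + B) → y ∈ B

theorem two_mul_card_le_of_mem_add_elems {N : AddSubgroup G} [Finite N] {A : Finset G} {a b : G}
    (ha : a ∈ A) (hb : b ∈ A) (hab : a - b ∉ N) : 2 * #(elems N) ≤ #(A + elems N) := by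
  have hd : Disjoint (a +ᵥ elems N) (b +ᵥ elems N) := by
    rw [disjoint_left]
    intro x hx hx'
    obtain ⟨n, hn, rfl⟩ := mem_vadd_finset.1 hx
    obtain ⟨n', hn', h⟩ := mem_vadd_finset.1 hx'
    apply hab
    have h' : b + n' = a + n := h
    have : a - b = n' - n := by
      rw [sub_eq_sub_iff_add_eq_add, ← h', add_comm]
    rw [this]
    exact N.sub_mem (mem_elems.1 hn') (mem_elems.1 hn)
  have hs : (a +ᵥ elems N) ∪ (b +ᵥ elems N) ⊆ A + elems N :=
    union_subset (vadd_finset_subset_add ha) (vadd_finset_subset_add hb)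
  have := card_le_card hs
  rw [card_union_of_disjoint hd, card_vadd_finset, card_vadd_finset] at this
  omega

/-- Mann's inequality bounds the excess of `X` below by `|A + N| - |N|`, where `A + N` misses part
of the subgroup generated by `A`. Hence `A` is not contained in `N`, so `A + N` has at least two
`N`-cosets and `|A + N| - |N| ≥ |A + N| / 2 ≥ |A| / 2`. -/
theorem two_mul_card_add_card_le {A X : Finset G} {x₀ : G} (h0 : (0 : G) ∈ A) (hX : X.Nonempty)
    (hXH : ∀ x ∈ X, x - x₀ ∈ AddSubgroup.closure (A : Set G))
    (hne : ∃ z, z - x₀ ∈ AddSubgroup.closure (A : Set G) ∧ z ∉ A + X) :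
    2 * #X + #A ≤ 2 * #(A + X) := by
  obtain ⟨z, hzH, hz⟩ := hne
  obtain ⟨N, _, hNH, ⟨w, hw, hwN⟩, hle⟩ := mann (AddSubgroup.closure (A : Set G)) (A := A)
    (X := (-x₀) +ᵥ X) ⟨0, h0⟩ (fun a ha => AddSubgroup.subset_closure ha) hX.vadd_finset
    (by
      intro x hx
      obtain ⟨y, hy, rfl⟩ := mem_vadd_finset.1 hx
      have := hXH y hy
      rwa [vadd_eq_add, neg_add_eq_sub])
    ⟨z - x₀, hzH, by
      rw [add_vadd_finset, mem_vadd_finset]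
      rintro ⟨y, hy, h⟩
      apply hz
      rw [vadd_eq_add, neg_add_eq_sub, sub_left_inj] at h
      rwa [← h]⟩
  rw [add_vadd_finset, card_vadd_finset, card_vadd_finset] at hle
  have : ∃ a ∈ A, a ∉ N := by
    by_contra! hcon
    have : AddSubgroup.closure (A : Set G) ≤ N := (AddSubgroup.closure_le N).2 hcon
    exact hwN (mem_add.2 ⟨0, h0, w, mem_elems.2 (this hw), zero_add w⟩)
  obtain ⟨a, ha, haN⟩ := this
  have h2 := two_mul_card_le_of_mem_add_elems (N := N) ha h0 (by simpa using haN)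
  have h3 : #A ≤ #(A + elems N) := card_le_card_add_right (elems_nonempty N)
  omega

/-- If `A` generates `H`, then a maximal critical pair `(A, B)` is `H`-periodic off one coset. -/
theorem MaxPair.periodic_off_coset {A B : Finset G} (h : MaxPair A B) (h0 : (0 : G) ∈ A)
    {H : AddSubgroup G} (hH : H = AddSubgroup.closure (A : Set G)) :
    ((∀ x, x ∈ A ↔ x ∈ H) ∧ ∀ b ∈ B, ∀ x ∈ H, b + x ∈ B) ∨
    ∃ b₀ ∈ B, (∃ z, z - b₀ ∈ H ∧ z ∉ A + B) ∧ ∀ b ∈ B, b - b₀ ∉ H → ∀ x ∈ H, b + x ∈ B := by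
  have hAH : ∀ a ∈ A, a ∈ H := fun a ha => hH ▸ AddSubgroup.subset_closure ha
  have hfull : ∀ b, (∀ z, z - b ∈ H → z ∈ A + B) → ∀ x ∈ H, b + x ∈ B := by
    intro b hb x hx
    refine h.max_right _ fun a ha => hb _ ?_
    have : a + (b + x) - b = a + x := by abel
    rw [this]
    exact H.add_mem (hAH a ha) hx
  by_cases hall : ∀ b ∈ B, ∀ z, z - b ∈ H → z ∈ A + B
  · left
    refine ⟨fun x => ⟨hAH x, fun hx => h.max_left x fun b hb => hall b hb _ (by simpa using hx)⟩,
      fun b hb => hfull b (hall b hb)⟩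
  · right
    push Not at hall
    obtain ⟨b₀, hb₀, z₀, hz₀, hz₀'⟩ := hall
    refine ⟨b₀, hb₀, ⟨z₀, hz₀, hz₀'⟩, fun b hb hbb => hfull b ?_⟩
    by_contra! hcon
    obtain ⟨z₁, hz₁, hz₁'⟩ := hcon
    -- Each unfilled coset gains at least `|A| / 2`; two of them would give `|A + B| ≥ |A| + |B|`.
    have bound : ∀ c ∈ B, (∃ z, z - c ∈ H ∧ z ∉ A + B) →
        2 * #(piece H c B) + #A ≤ 2 * #(A + piece H c B) := by
      rintro c hc ⟨z, hz, hz'⟩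
      subst hH
      exact two_mul_card_add_card_le h0 ⟨c, self_mem_piece hc⟩ (fun x hx => (mem_piece.1 hx).2)
        ⟨z, hz, fun hmem => hz' (add_subset_add_left (piece_subset _ _ _) hmem)⟩
    have e0 := bound b₀ hb₀ ⟨z₀, hz₀, hz₀'⟩
    have e1 := bound b hb ⟨z₁, hz₁, hz₁'⟩
    set P := piece H b₀ B
    set Q := piece H b B
    set R := B \ (P ∪ Q) with hR
    have hmemP : ∀ x ∈ A + P, x - b₀ ∈ H := by
      intro x hx
      obtain ⟨a, ha, p, hp, rfl⟩ := mem_add.1 hx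
      rw [add_sub_assoc]
      exact H.add_mem (hAH a ha) (mem_piece.1 hp).2
    have hmemQ : ∀ x ∈ A + Q, x - b ∈ H := by
      intro x hx
      obtain ⟨a, ha, p, hp, rfl⟩ := mem_add.1 hx
      rw [add_sub_assoc]
      exact H.add_mem (hAH a ha) (mem_piece.1 hp).2
    have hPQ : ∀ x, x - b₀ ∈ H → x - b ∈ H → False := by
      intro x h1 h2
      apply hbb
      have := H.sub_mem h1 h2
      simpa using this
    have d1 : Disjoint (A + P) (A + Q) :=
      disjoint_left.2 fun x h1 h2 => hPQ x (hmemP x h1) (hmemQ x h2)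
    have d2 : Disjoint (A + P ∪ (A + Q)) R := by
      rw [disjoint_left]
      intro x hx hxR
      have hxR' := mem_sdiff.1 hxR
      apply hxR'.2
      rcases mem_union.1 hx with hx | hx
      · exact mem_union_left _ (mem_piece.2 ⟨hxR'.1, hmemP x hx⟩)
      · exact mem_union_right _ (mem_piece.2 ⟨hxR'.1, hmemQ x hx⟩)
    have dPQ : Disjoint P Q :=
      disjoint_left.2 fun x h1 h2 => hPQ x (mem_piece.1 h1).2 (mem_piece.1 h2).2
    have hsub : A + P ∪ (A + Q) ∪ R ⊆ A + B := by
      refine union_subset (union_subset (add_subset_add_left (piece_subset _ _ _))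
        (add_subset_add_left (piece_subset _ _ _))) fun x hx => ?_
      exact mem_add.2 ⟨0, h0, x, (mem_sdiff.1 hx).1, zero_add x⟩
    have hc := card_le_card hsub
    rw [card_union_of_disjoint d2, card_union_of_disjoint d1] at hc
    have hB : #R + (#P + #Q) = #B := by
      rw [← card_union_of_disjoint dPQ, hR]
      exact card_sdiff_add_card_eq_card
        (union_subset (piece_subset _ _ _) (piece_subset _ _ _))
    have := h.card_lt
    omega

end Beat

/-! ### Optimal subgroups and reduction modulo them -/

section Good

variable {G : Type*} [AddCommGroup G]

/-- `S` lies in no coset of a proper subgroup. -/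
def Spans (S : Set G) : Prop :=
  ∀ (L : AddSubgroup G) (g : G), (∀ x ∈ S, x - g ∈ L) → L = ⊤

theorem elems_ssubset {M N : AddSubgroup G} [Finite M] [Finite N] (h : M < N) :
    elems M ⊂ elems N := by
  obtain ⟨hle, x, hxN, hxM⟩ := SetLike.lt_iff_le_and_exists.1 h
  exact (ssubset_iff_of_subset fun x hx => mem_elems.2 (hle (mem_elems.1 hx))).2
    ⟨x, mem_elems.2 hxN, fun h => hxM (mem_elems.1 h)⟩

theorem Spans.exists_sub_notMem {A : Finset G} (hA : Spans (A : Set G)) (hne : A.Nonempty)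
    {N : AddSubgroup G} (hN : N ≠ ⊤) : ∃ a ∈ A, ∃ b ∈ A, a - b ∉ N := by
  obtain ⟨b, hb⟩ := hne
  by_contra! hcon
  exact hN (hA N b fun a ha => hcon a ha b hb)

variable [DecidableEq G]

/-- `M` minimises `|A + M| - |M|` among the finite subgroups with `A + M ≠ G`, and it is as large
as possible with this property. -/
structure Good (A : Finset G) (M : AddSubgroup G) [Finite M] : Prop where
  nonempty : A.Nonempty
  exists_notMem : ∃ z, z ∉ A + elems M
  card_lt : #(A + elems M) < #A + #(elems M)
  card_le : ∀ X : Finset G, X.Nonempty → (∃ z, z ∉ A + X) →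
    #X + #(A + elems M) ≤ #(A + X) + #(elems M)
  lt_of_lt : ∀ (N : AddSubgroup G) [Finite N], M < N → (∃ z, z ∉ A + elems N) →
    #(A + elems M) + #(elems N) < #(A + elems N) + #(elems M)

theorem ne_top_of_notMem_add {A : Finset G} (hA : A.Nonempty) {N : AddSubgroup G} [Finite N]
    (h : ∃ z, z ∉ A + elems N) : N ≠ ⊤ := by
  rintro rfl
  obtain ⟨z, hz⟩ := h
  obtain ⟨a, ha⟩ := hA
  exact hz (mem_add.2 ⟨a, ha, z - a, by simp, by abel⟩)

theorem exists_good {A : Finset G} (hne : A.Nonempty) (hA : Spans (A : Set G))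
    (hz : ∃ z, z ∉ A) : ∃ (M : AddSubgroup G) (_ : Finite M), Good A M := by
  let P : {N : AddSubgroup G // Finite N} → Prop := fun N =>
    haveI := N.2; ∃ z, z ∉ A + elems N.1
  let e : {N : AddSubgroup G // Finite N} → ℕ := fun N =>
    haveI := N.2; #(A + elems N.1) - #(elems N.1)
  have hbot : elems (⊥ : AddSubgroup G) = 0 := by
    ext x; simp
  have hP0 : P ⟨⊥, inferInstance⟩ := by
    change ∃ z, z ∉ A + elems (⊥ : AddSubgroup G)
    rwa [hbot, add_zero]
  have hle : ∀ (N : AddSubgroup G) [Finite N], #(elems N) ≤ #(A + elems N) := fun N _ =>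
    card_le_card_add_left hne
  obtain ⟨M₁, hM₁, hmin₁⟩ := exists_forall_le_nat P e ⟨_, hP0⟩
  -- Minimising `|A| - |N|` maximises `|N|`. Truncation is harmless: since `A` spans, an optimal `N`
  -- has `|N| ≤ |A + N| - |N| ≤ |A| - 1`, the last bound being the excess of the trivial subgroup.
  obtain ⟨⟨M, hMfin⟩, ⟨hPM, hMe⟩, hmax⟩ := exists_forall_le_nat (fun N => P N ∧ e N = e M₁)
    (fun N => haveI := N.2; #A - #(elems N.1)) ⟨M₁, hM₁, rfl⟩
  have hmin : ∀ (N : AddSubgroup G) [hN : Finite N], (∃ z, z ∉ A + elems N) →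
      #(A + elems M) - #(elems M) ≤ #(A + elems N) - #(elems N) := by
    intro N hN h
    change e ⟨M, hMfin⟩ ≤ e ⟨N, hN⟩
    rw [hMe]
    exact hmin₁ _ h
  have hbd : ∀ (N : AddSubgroup G) [hN : Finite N], (∃ z, z ∉ A + elems N) →
      2 * #(elems N) ≤ #(A + elems N) := by
    intro N hN h
    obtain ⟨a, ha, b, hb, hab⟩ := hA.exists_sub_notMem hne (ne_top_of_notMem_add hne h)
    exact two_mul_card_le_of_mem_add_elems ha hb hab
  have h0 := hmin ⊥ hP0
  rw [hbot, add_zero, card_zero] at h0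
  have hMle := hle M
  have hApos := hne.card_pos
  refine ⟨M, hMfin, hne, hPM, ?_, ?_, ?_⟩
  · have := card_elems_pos M
    omega
  · intro X hX hAX
    obtain ⟨N, _, -, ⟨w, -, hw⟩, hN⟩ := mann ⊤ hne (fun _ _ => trivial) hX (fun _ _ => trivial)
      (by obtain ⟨z, hz⟩ := hAX; exact ⟨z, trivial, hz⟩)
    have := hmin N ⟨w, hw⟩
    have := hle N
    omega
  · intro N hN hMN hAN
    by_contra! hcon
    have h1 := hmin N hAN
    have h2 := hle N
    have h3 := hbd N hAN
    have h4 := hmax ⟨N, hN⟩ ⟨hAN, by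
      rw [← hMe]
      change #(A + elems N) - #(elems N) = #(A + elems M) - #(elems M)
      omega⟩
    change #A - #(elems M) ≤ #A - #(elems N) at h4
    have h5 := card_lt_card (elems_ssubset hMN)
    omega

theorem exists_notMem_add_of_subset_coset {A Z : Finset G} {M : AddSubgroup G} [Finite M]
    (h : Good A M) {b : G} (hZ : ∀ x ∈ Z, x - b ∈ M) : ∃ z, z ∉ A + Z := by
  obtain ⟨z, hz⟩ := h.exists_notMem
  refine ⟨b + z, fun hmem => hz ?_⟩
  obtain ⟨a, ha, x, hx, hax⟩ := mem_add.1 hmem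
  refine mem_add.2 ⟨a, ha, x - b, mem_elems.2 (hZ x hx), ?_⟩
  rw [← add_sub_assoc, hax, add_sub_cancel_left]

/-- Completing `M`-cosets never increases the excess. For one coset `b + M` whose part in the
current set is `I`, submodularity bounds the change by the excess of `M` minus that of `I`, which is
at most 0 by `Good.card_le`. -/
theorem Good.card_fill {A : Finset G} {M : AddSubgroup G} [Finite M] (h : Good A M)
    (B : Finset G) {S : Finset G} (hS : S ⊆ B) :
    #(A + (B ∪ (S + elems M))) + #B ≤ #(A + B) + #(B ∪ (S + elems M)) := by
  induction S using Finset.induction_on with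
  | empty => simp
  | insert b S hb ih =>
    have ih' := ih ((subset_insert _ _).trans hS)
    set X := B ∪ (S + elems M) with hX
    have e : B ∪ (insert b S + elems M) = X ∪ (b +ᵥ elems M) := by
      rw [insert_eq, union_add, singleton_add, hX, union_assoc, union_comm (S + elems M)]
    rw [e]
    have hbX : b ∈ X := mem_union_left _ (hS (mem_insert_self _ _))
    have hsub := card_add_inter_add_card_add_union_le A X (b +ᵥ elems M)
    have hIU := card_inter_add_card_union X (b +ᵥ elems M)
    have hI := h.card_le (X ∩ (b +ᵥ elems M))
      ⟨b, mem_inter.2 ⟨hbX, mem_vadd_finset.2 ⟨0, by simp, by simp⟩⟩⟩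
      (exists_notMem_add_of_subset_coset h (b := b) (by
        intro x hx
        obtain ⟨y, hy, rfl⟩ := mem_vadd_finset.1 (mem_inter.1 hx).2
        simpa using hy))
    rw [add_vadd_finset, card_vadd_finset] at hsub
    rw [card_vadd_finset] at hIU
    omega

/-! ### Images in the quotient by a finite subgroup -/

section Quotient

variable (M : AddSubgroup G) [DecidableEq (G ⧸ M)]

/-- The image of a finite set in the quotient by `M`. -/
def proj (X : Finset G) : Finset (G ⧸ M) :=
  X.image (QuotientAddGroup.mk' M)

variable {M}

theorem mem_proj {X : Finset G} {c : G ⧸ M} : c ∈ proj M X ↔ ∃ x ∈ X, (x : G ⧸ M) = c := by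
  simp [proj]

theorem mk_mem_proj {X : Finset G} {x : G} (hx : x ∈ X) : (x : G ⧸ M) ∈ proj M X :=
  mem_proj.2 ⟨x, hx, rfl⟩

theorem proj_add (X Y : Finset G) : proj M (X + Y) = proj M X + proj M Y :=
  image_add (QuotientAddGroup.mk' M)

theorem mk_eq_mk_iff {x y : G} : (x : G ⧸ M) = y ↔ x - y ∈ M := by
  rw [eq_comm, QuotientAddGroup.eq, neg_add_eq_sub]

variable [Finite M]

theorem mem_add_elems {X : Finset G} {x : G} : x ∈ X + elems M ↔ (x : G ⧸ M) ∈ proj M X := by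
  rw [mem_proj, mem_add]
  constructor
  · rintro ⟨y, hy, n, hn, rfl⟩
    exact ⟨y, hy, mk_eq_mk_iff.2 (by simpa using mem_elems.1 hn)⟩
  · rintro ⟨y, hy, h⟩
    refine ⟨y, hy, x - y, mem_elems.2 ?_, by abel⟩
    exact mk_eq_mk_iff.1 h.symm

theorem card_filter_mk_eq (b : G) {X : Finset G} (hX : ∀ x, x - b ∈ M → x ∈ X) :
    #(X.filter fun x : G => (x : G ⧸ M) = b) = #(elems M) := by
  rw [← card_vadd_finset b (elems M)]
  congr 1
  ext x
  rw [mem_filter, mem_vadd_finset]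
  constructor
  · rintro ⟨_, h⟩
    exact ⟨x - b, mem_elems.2 (mk_eq_mk_iff.1 h), by simp⟩
  · rintro ⟨n, hn, rfl⟩
    have : b + n - b ∈ M := by simpa using hn
    exact ⟨hX _ this, mk_eq_mk_iff.2 this⟩

theorem card_add_elems (X : Finset G) : #(X + elems M) = #(proj M X) * #(elems M) := by
  rw [card_eq_sum_card_fiberwise (f := fun x : G => (x : G ⧸ M)) (s := X + elems M)
    (t := proj M X) (fun x hx => mem_add_elems.1 hx)]
  rw [sum_const_nat]
  intro c hc
  obtain ⟨b, hb, rfl⟩ := mem_proj.1 hc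
  exact card_filter_mk_eq b fun x hx => mem_add_elems.2 (mem_proj.2 ⟨b, hb, (mk_eq_mk_iff.2 hx).symm⟩)

theorem card_le_card_proj_mul (X : Finset G) : #X ≤ #(proj M X) * #(elems M) := by
  rw [← card_add_elems]
  exact card_le_card_add_right (elems_nonempty M)

theorem exists_notMem_proj {X : Finset G} :
    (∃ z, z ∉ proj M X) ↔ ∃ z, z ∉ X + elems M := by
  constructor
  · rintro ⟨z, hz⟩
    induction z using QuotientAddGroup.induction_on with
    | H z => exact ⟨z, fun h => hz (mem_add_elems.1 h)⟩
  · rintro ⟨z, hz⟩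
    exact ⟨z, fun h => hz (mem_add_elems.2 h)⟩

/-- Once all cosets of `B` are completed, the excess is a multiple of `|M|`. It is still less than
`|A| ≤ |proj M A| * |M|`, and `|M|` can be divided out. -/
theorem Good.card_proj_add_lt {A : Finset G} (h : Good A M) {B : Finset G}
    (hAB : #(A + B) < #A + #B) : #(proj M A + proj M B) < #(proj M A) + #(proj M B) := by
  have h1 := h.card_fill B Subset.rfl
  have h2 : B ∪ (B + elems M) = B + elems M :=
    union_eq_right.2 fun x hx => mem_add.2 ⟨x, hx, 0, by simp, add_zero x⟩
  have h3 : A + (B + elems M) = (A + B) + elems M := (add_assoc _ _ _).symm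
  rw [h2, h3, card_add_elems, card_add_elems, proj_add] at h1
  have h4 := card_le_card_proj_mul (M := M) A
  have h5 := card_elems_pos M
  by_contra! hcon
  have := Nat.mul_le_mul_right #(elems M) hcon
  rw [add_mul] at this
  omega

end Quotient

end Good

/-! ### Vosper's theorem by minimal critical partners -/

section Vosper

variable {G : Type*} [AddCommGroup G]

theorem elems_bot : elems (⊥ : AddSubgroup G) = 0 := by
  ext x; simp

variable [DecidableEq G]

/-- Every nontrivial finite subgroup `N` with `A + N ≠ G` has at least `|A|` elements of `A + N`
beyond its own. -/
def NType (A : Finset G) : Prop :=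
  ∀ (N : AddSubgroup G) [Finite N], N ≠ ⊥ → (∃ z, z ∉ A + elems N) →
    #A + #(elems N) ≤ #(A + elems N)

theorem NType.card_le {A : Finset G} (hN : NType A) (hA : A.Nonempty) {X : Finset G}
    (hX : X.Nonempty) (hz : ∃ z, z ∉ A + X) : #A + #X ≤ #(A + X) + 1 := by
  obtain ⟨z, hz⟩ := hz
  obtain ⟨N, _, -, ⟨w, -, hw⟩, h⟩ := mann ⊤ hA (fun _ _ => trivial) hX (fun _ _ => trivial)
    ⟨z, trivial, hz⟩
  rcases eq_or_ne N ⊥ with rfl | hne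
  · rw [elems_bot, add_zero, card_zero] at h
    omega
  · have := hN N hne ⟨w, hw⟩
    omega

theorem finite_sup (P N : AddSubgroup G) [Finite P] [Finite N] :
    Finite (P ⊔ N : AddSubgroup G) := by
  refine ((elems P + elems N).finite_toSet).subset fun x hx => ?_
  obtain ⟨y, hy, z, hz, rfl⟩ := AddSubgroup.mem_sup.1 hx
  exact mem_coe.2 (add_mem_add (mem_elems.2 hy) (mem_elems.2 hz))

theorem elems_sup (P N : AddSubgroup G) [Finite P] [Finite N] [Finite (P ⊔ N : AddSubgroup G)] :
    elems (P ⊔ N) = elems P + elems N := by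
  ext x
  simp only [mem_elems, AddSubgroup.mem_sup, mem_add]

/-- Replacing `A` by `A + P` does not change `A + X`. Mann's inequality then involves the subgroup
`P ⊔ N`, which is nontrivial even for `N = ⊥`, so the weaker bound of `NType.card_le` does not
arise. -/
theorem NType.card_le_of_periodic {A : Finset G} (hN : NType A) (hA : A.Nonempty) {X : Finset G}
    (hX : X.Nonempty) (hz : ∃ z, z ∉ A + X) (P : AddSubgroup G) [Finite P] (hP : P ≠ ⊥)
    (hper : ∀ x ∈ A + X, ∀ p ∈ P, x + p ∈ A + X) : #A + #X ≤ #(A + X) := by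
  have e : A + elems P + X = A + X := by
    rw [add_right_comm]
    ext x
    constructor
    · intro hx
      obtain ⟨y, hy, p, hp, rfl⟩ := mem_add.1 hx
      exact hper y hy p (mem_elems.1 hp)
    · exact fun hx => mem_add.2 ⟨x, hx, 0, by simp, add_zero x⟩
  obtain ⟨z, hz⟩ := hz
  obtain ⟨N, _, -, ⟨w, -, hw⟩, h⟩ := mann ⊤ (A := A + elems P) (hA.add (elems_nonempty P))
    (fun _ _ => trivial) hX (fun _ _ => trivial) ⟨z, trivial, by rwa [e]⟩
  have := finite_sup P N
  rw [e, add_assoc, ← elems_sup] at h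
  rw [add_assoc, ← elems_sup] at hw
  have h1 := hN (P ⊔ N) (fun h => hP (le_bot_iff.1 (h ▸ le_sup_left))) ⟨w, hw⟩
  have h2 : #(elems N) ≤ #(elems (P ⊔ N)) := card_le_card fun x hx =>
    mem_elems.2 ((le_sup_right : N ≤ P ⊔ N) (mem_elems.1 hx))
  omega

/-- The negative of the complement of `A + X` in a finite set `W`. -/
def codiff (W A X : Finset G) : Finset G :=
  (W \ (A + X)).image fun z => -z

theorem mem_codiff {W A X : Finset G} (hW : ∀ z, z ∈ W) {y : G} :
    y ∈ codiff W A X ↔ -y ∉ A + X := by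
  rw [codiff, mem_image]
  constructor
  · rintro ⟨z, hz, rfl⟩
    rw [neg_neg]
    exact (mem_sdiff.1 hz).2
  · intro h
    exact ⟨-y, mem_sdiff.2 ⟨hW _, h⟩, neg_neg y⟩

theorem card_codiff {W A X : Finset G} (hW : ∀ z, z ∈ W) :
    #(codiff W A X) + #(A + X) = #W := by
  rw [codiff, card_image_of_injective _ neg_injective,
    card_sdiff_add_card_eq_card fun x _ => hW x]

theorem neg_notMem_add_codiff {W A X : Finset G} (hW : ∀ z, z ∈ W) {x : G} (hx : x ∈ X) :
    -x ∉ A + codiff W A X := by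
  intro hmem
  obtain ⟨a, ha, y, hy, hay⟩ := mem_add.1 hmem
  refine (mem_codiff hW).1 hy (mem_add.2 ⟨a, ha, x, hx, ?_⟩)
  rw [← neg_inj, neg_neg, neg_add, ← hay]
  abel

theorem card_add_codiff {W A X : Finset G} (hW : ∀ z, z ∈ W) :
    #(A + codiff W A X) + #X ≤ #W := by
  rw [← card_image_of_injective X neg_injective, ← card_union_of_disjoint]
  · exact card_le_card fun x _ => hW x
  · rw [disjoint_right]
    intro w hw
    obtain ⟨x, hx, rfl⟩ := mem_image.1 hw
    exact neg_notMem_add_codiff hW hx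

/-- `(A, X)` is critical, `|X| ≥ 2`, and `A + X` misses two elements. -/
structure Frag (A X : Finset G) : Prop where
  two_le : 2 ≤ #X
  missing : ∃ z₁ z₂, z₁ ≠ z₂ ∧ z₁ ∉ A + X ∧ z₂ ∉ A + X
  card_lt : #(A + X) < #A + #X

/-- Distinct translates of `X` have at most one common element. -/
def IsSidon (X : Finset G) : Prop :=
  ∀ g : G, g ≠ 0 → #(X ∩ (g +ᵥ X)) ≤ 1

/-- A smallest `Frag` is Sidon. If it shares two or more elements with a distinct translate, the
smaller intersection is not critical with `A`, and submodularity pushes the union below the bound of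
`NType.card_le`. -/
theorem exists_sidon {A : Finset G} (hN : NType A) (hA : A.Nonempty) (h : ∃ X, Frag A X) :
    ∃ X, Frag A X ∧ IsSidon X := by
  obtain ⟨X, hX, hmin⟩ := exists_forall_le_nat (Frag A) (fun X => #X) h
  refine ⟨X, hX, fun g hg => ?_⟩
  by_contra! hI
  obtain ⟨h2, ⟨z₁, z₂, hzz, hz₁, hz₂⟩, hlt⟩ := hX
  have hXne : X.Nonempty := card_pos.1 (by omega)
  have hge := hN.card_le hA hXne ⟨z₁, hz₁⟩
  by_cases hXg : g +ᵥ X = X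
  · let P : AddSubgroup G := AddAction.stabilizer G (X : Set G)
    have : Finite P := AddAction.stabilizer_finite (by simpa using hXne) X.finite_toSet
    have hgP : g ∈ P := by
      change g +ᵥ (X : Set G) = X
      rw [← coe_vadd_finset, hXg]
    have := hN.card_le_of_periodic hA hXne ⟨z₁, hz₁⟩ P
      (fun h => hg ((AddSubgroup.mem_bot).1 (h ▸ hgP))) (by
        intro w hw p hp
        obtain ⟨a, ha, x, hx, rfl⟩ := mem_add.1 hw
        refine mem_add.2 ⟨a, ha, p + x, ?_, by abel⟩
        have hp' : p +ᵥ (X : Set G) = X := hp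
        rw [← mem_coe, ← hp']
        exact Set.vadd_mem_vadd_set hx)
    omega
  · have hIne : #(X ∩ (g +ᵥ X)) < #X := by
      refine lt_of_le_of_ne (card_le_card inter_subset_left) fun hc => hXg ?_
      have := inter_eq_left.1 (eq_of_subset_of_card_le inter_subset_left hc.ge)
      exact (eq_of_subset_of_card_le this (by rw [card_vadd_finset])).symm
    have hIA : #A + #(X ∩ (g +ᵥ X)) ≤ #(A + X ∩ (g +ᵥ X)) := by
      by_contra! hcon
      have := hmin _ ⟨hI, ⟨z₁, z₂, hzz,
        fun h => hz₁ (add_subset_add_left inter_subset_left h),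
        fun h => hz₂ (add_subset_add_left inter_subset_left h)⟩, hcon⟩
      omega
    have hsub := card_add_inter_add_card_add_union_le A X (g +ᵥ X)
    have hIU := card_inter_add_card_union X (g +ᵥ X)
    rw [add_vadd_finset, card_vadd_finset] at hsub
    rw [card_vadd_finset] at hIU
    by_cases hU : ∃ z, z ∉ A + (X ∪ (g +ᵥ X))
    · have := hN.card_le hA (hXne.mono subset_union_left) hU
      omega
    · push Not at hU
      -- The bound for the union needs a missing element. Without one the group is finite, and the
      -- complementary set `codiff W A X` is also a `Frag`, hence at least as large as `X`; this
      -- replaces the bound.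
      set W := A + (X ∪ (g +ᵥ X))
      have c1 := card_codiff (A := A) (X := X) hU
      have c2 := card_add_codiff (A := A) (X := X) hU
      have hsub2 : ({-z₁, -z₂} : Finset G) ⊆ codiff W A X := by
        intro y hy
        rw [mem_codiff hU]
        rcases mem_insert.1 hy with rfl | hy
        · rwa [neg_neg]
        · rw [mem_singleton.1 hy, neg_neg]; exact hz₂
      have c3 := card_le_card hsub2
      rw [card_pair (fun h => hzz (neg_injective h))] at c3
      obtain ⟨x, hx, y, hy, hxy⟩ := one_lt_card.1 (show 1 < #X by omega)
      have := hmin _ ⟨c3, ⟨-x, -y, fun h => hxy (neg_injective h), neg_notMem_add_codiff hU hx,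
        neg_notMem_add_codiff hU hy⟩, by omega⟩
      omega

theorem IsSidon.vadd {X : Finset G} (h : IsSidon X) (c : G) : IsSidon (c +ᵥ X) := by
  intro g hg
  rw [vadd_comm, ← vadd_finset_inter, card_vadd_finset]
  exact h g hg

theorem IsSidon.card_inter_le {X : Finset G} (h : IsSidon X) {x y : G} (hxy : x ≠ y) :
    #((x +ᵥ X) ∩ (y +ᵥ X)) ≤ 1 := by
  have e : y +ᵥ X = x +ᵥ ((y - x) +ᵥ X) := by
    rw [vadd_vadd, add_sub_cancel]
  rw [e, ← vadd_finset_inter, card_vadd_finset]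
  exact h _ (sub_ne_zero.2 hxy.symm)

theorem vadd_subset_add {X Z : Finset G} {z : G} (hz : z ∈ Z) : z +ᵥ X ⊆ X + Z := by
  intro w hw
  obtain ⟨x, hx, rfl⟩ := mem_vadd_finset.1 hw
  exact mem_add.2 ⟨x, hx, z, hz, add_comm _ _⟩

theorem IsSidon.two_mul_card_le {X Z : Finset G} (h : IsSidon X) (hZ : 2 ≤ #Z) :
    2 * #X ≤ #(X + Z) + 1 := by
  obtain ⟨x, hx, y, hy, hxy⟩ := one_lt_card.1 (show 1 < #Z by omega)
  have h1 := h.card_inter_le hxy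
  have h2 := card_inter_add_card_union (x +ᵥ X) (y +ᵥ X)
  have h3 := card_le_card (union_subset (vadd_subset_add (X := X) hx) (vadd_subset_add hy))
  rw [card_vadd_finset, card_vadd_finset] at h2
  omega

theorem IsSidon.three_mul_card_le {X Z : Finset G} (h : IsSidon X) (hZ : 3 ≤ #Z) :
    3 * #X ≤ #(X + Z) + 3 := by
  obtain ⟨x, y, z, hx, hy, hz, hxy, hxz, hyz⟩ := two_lt_card_iff.1 (show 2 < #Z by omega)
  have h1 := h.card_inter_le hxy
  have h1' := h.card_inter_le hxz
  have h1'' := h.card_inter_le hyz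
  have h2 := card_inter_add_card_union (x +ᵥ X) (y +ᵥ X)
  have h3 := card_inter_add_card_union ((x +ᵥ X) ∪ (y +ᵥ X)) (z +ᵥ X)
  have h4 := card_le_card (union_subset (union_subset (vadd_subset_add (X := X) hx)
    (vadd_subset_add hy)) (vadd_subset_add hz))
  rw [union_inter_distrib_right] at h3
  have h5 := card_union_le ((x +ᵥ X) ∩ (z +ᵥ X)) ((y +ᵥ X) ∩ (z +ᵥ X))
  simp only [card_vadd_finset] at h2 h3
  omega

/-- Suppose `|X + N| < |X| + |N|`. Two `N`-cosets in `X + N` force `|N| < |X|`, while `X` and its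
translate by a nonzero element of `N` overlap in at most one element, which forces `|N| ≥ |X|`. -/
theorem IsSidon.card_add_le {X : Finset G} (h : IsSidon X) {N : AddSubgroup G} [Finite N]
    (hN : N ≠ ⊥) {a b : G} (ha : a ∈ X) (hb : b ∈ X) (hab : a - b ∉ N) :
    #X + #(elems N) ≤ #(X + elems N) := by
  by_contra! hcon
  have h1 := two_mul_card_le_of_mem_add_elems ha hb hab
  obtain ⟨g, hgN, hg⟩ := N.bot_or_exists_ne_zero.resolve_left hN
  have h2 := h g hg
  have h3 := card_inter_add_card_union X ((g : G) +ᵥ X)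
  rw [card_vadd_finset] at h3
  have h4 := card_le_card (union_subset (s := X) (t := (g : G) +ᵥ X) (u := X + elems N)
    (fun x hx => mem_add.2 ⟨x, hx, 0, by simp, add_zero x⟩)
    (vadd_subset_add (mem_elems.2 hgN)))
  omega

/-- Here `|A + P| ≤ |F| + |P| < |A| + |P|`, so `NType` leaves only `A + P = G`. Then `|G| ≤ |F| +
|P| ≤ 2|F| < 2|A|`, against `hhalf`. -/
theorem NType.false_of_stable_part {A : Finset G} (hN : NType A)
    (hhalf : Finite G → 2 * #A ≤ Nat.card G) (P : AddSubgroup G) [Finite P] (hP : P ≠ ⊥)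
    {F : Finset G} (hF : F.Nonempty) (hFA : F ⊂ A) (hst : ∀ x ∈ F, ∀ p ∈ P, x + p ∈ F) {x₀ : G}
    (hx₀ : ∀ a ∈ A, a ∈ F ∨ a - x₀ ∈ P) : False := by
  have hsub : A + elems P ⊆ F ∪ (x₀ +ᵥ elems P) := by
    intro w hw
    obtain ⟨a, ha, p, hp, rfl⟩ := mem_add.1 hw
    rw [mem_elems] at hp
    rcases hx₀ a ha with h | h
    · exact mem_union_left _ (hst a h p hp)
    · exact mem_union_right _ (mem_vadd_finset.2 ⟨a - x₀ + p, mem_elems.2 (P.add_mem h hp), by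
        rw [vadd_eq_add]; abel⟩)
  have h1 := (card_le_card hsub).trans (card_union_le _ _)
  rw [card_vadd_finset] at h1
  have h2 := card_lt_card hFA
  by_cases hz : ∃ z, z ∉ A + elems P
  · have := hN P hP hz
    omega
  · push Not at hz
    have hfin : Finite G := Set.finite_univ_iff.1 ((A + elems P).finite_toSet.subset
      fun x _ => hz x)
    have h3 := hhalf hfin
    have h4 : Nat.card G ≤ #(A + elems P) := by
      have : Fintype G := Fintype.ofFinite G
      rw [Nat.card_eq_fintype_card, ← card_univ]
      exact card_le_card fun x _ => hz x
    obtain ⟨f, hf⟩ := hF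
    have h5 : #(elems P) ≤ #F := by
      rw [← card_vadd_finset f]
      apply card_le_card
      intro w hw
      obtain ⟨p, hp, rfl⟩ := mem_vadd_finset.1 hw
      exact hst f hf p (mem_elems.1 hp)
    omega

/-- A Sidon set in a critical pair with `A` generates the whole group. -/
theorem closure_eq_top_of_sidon {A X : Finset G} (hN : NType A) (hA : A.Nonempty)
    (hspan : Spans (A : Set G)) (hhalf : Finite G → 2 * #A ≤ Nat.card G) (hfrag : Frag A X)
    (hX : IsSidon X) (h0 : (0 : G) ∈ X) : AddSubgroup.closure (X : Set G) = ⊤ := by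
  obtain ⟨h2, ⟨z₁, -, -, hz₁, -⟩, hlt⟩ := hfrag
  set L := AddSubgroup.closure (X : Set G) with hL
  have hXL : ∀ x ∈ X, x ∈ L := fun x hx => AddSubgroup.subset_closure hx
  have hLne : L ≠ ⊥ := by
    intro h
    have hs : X ⊆ {0} := fun x hx => by
      have := hXL x hx
      rw [h, AddSubgroup.mem_bot] at this
      simp [this]
    have := card_le_card hs
    simp at this
    omega
  -- Mann's inequality with `X` as the fixed set: `X` generates `L`, so it leaves the subgroup `N`,
  -- and `IsSidon.card_add_le` applies to it.
  have bound : ∀ a ∈ A, (∃ z, z - a ∈ L ∧ z ∉ A + X) →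
      #(piece L a A) + #X ≤ #(piece L a A + X) + 1 := by
    rintro a ha ⟨z, hzL, hz⟩
    have hdec : ∀ Y : Finset G, X + ((-a) +ᵥ Y) = (-a) +ᵥ (Y + X) := fun Y => by
      rw [add_vadd_finset, add_comm X Y]
    obtain ⟨N, _, hNL, ⟨w, hwL, hw⟩, h⟩ := mann L (A := X) (X := (-a) +ᵥ piece L a A) ⟨0, h0⟩ hXL
      (Nonempty.vadd_finset ⟨a, self_mem_piece ha⟩)
      (by
        intro x hx
        obtain ⟨y, hy, rfl⟩ := mem_vadd_finset.1 hx
        rw [vadd_eq_add, neg_add_eq_sub]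
        exact (mem_piece.1 hy).2)
      ⟨z - a, hzL, by
        rw [hdec, mem_vadd_finset]
        rintro ⟨y, hy, h⟩
        apply hz
        rw [vadd_eq_add, neg_add_eq_sub, sub_left_inj] at h
        rw [← h]
        exact add_subset_add_right (piece_subset _ _ _) hy⟩
    rw [hdec, card_vadd_finset, card_vadd_finset] at h
    rcases eq_or_ne N ⊥ with rfl | hNb
    · rw [elems_bot, add_zero, card_zero] at h
      omega
    · have : ∃ x ∈ X, x ∉ N := by
        by_contra! hcon
        have : L ≤ N := (AddSubgroup.closure_le N).2 hcon
        exact hw (mem_add.2 ⟨0, h0, w, mem_elems.2 (this hwL), zero_add w⟩)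
      obtain ⟨x, hx, hxN⟩ := this
      have := hX.card_add_le hNb hx h0 (by simpa using hxN)
      omega
  have hLfin : ∀ a, (∀ z, z - a ∈ L → z ∈ A + X) → Finite L := by
    intro a ha
    refine (((-a) +ᵥ (A + X) : Finset G).finite_toSet).subset fun x hx => ?_
    rw [mem_coe, mem_vadd_finset]
    exact ⟨a + x, ha _ (by simpa using hx), by simp⟩
  have hnot : ∃ a ∈ A, ∃ z, z - a ∈ L ∧ z ∉ A + X := by
    by_contra! hcon
    obtain ⟨a, ha⟩ := hA
    have := hLfin a (hcon a ha)
    have := hN.card_le_of_periodic ⟨a, ha⟩ ⟨0, h0⟩ ⟨z₁, hz₁⟩ L hLne (by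
      intro w hw p hp
      obtain ⟨a, ha, x, hx, rfl⟩ := mem_add.1 hw
      refine hcon a ha _ ?_
      have : a + x + p - a = x + p := by abel
      rw [this]
      exact L.add_mem (hXL x hx) hp)
    omega
  obtain ⟨a₀, ha₀, hnon⟩ := hnot
  have b0 := bound a₀ ha₀ hnon
  have hmem : ∀ a, ∀ x ∈ piece L a A + X, x - a ∈ L := by
    intro a x hx
    obtain ⟨p, hp, y, hy, rfl⟩ := mem_add.1 hx
    have : p + y - a = (p - a) + y := by abel
    rw [this]
    exact L.add_mem (mem_piece.1 hp).2 (hXL y hy)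
  have three : ∀ a ∈ A, a - a₀ ∉ L → #(piece L a₀ A + X) + #(piece L a A + X) + #A ≤
      #(A + X) + #(piece L a₀ A) + #(piece L a A) := by
    intro a ha haa
    have hPQ : ∀ x, x - a₀ ∈ L → x - a ∈ L → False := by
      intro x h1 h2
      apply haa
      have := L.sub_mem h1 h2
      simpa using this
    have d1 : Disjoint (piece L a₀ A + X) (piece L a A + X) :=
      disjoint_left.2 fun x h1 h2 => hPQ x (hmem _ x h1) (hmem _ x h2)
    have d2 : Disjoint (piece L a₀ A + X ∪ (piece L a A + X))
        (A \ (piece L a₀ A ∪ piece L a A)) := by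
      rw [disjoint_left]
      intro x hx hxR
      have hxR' := mem_sdiff.1 hxR
      apply hxR'.2
      rcases mem_union.1 hx with hx | hx
      · exact mem_union_left _ (mem_piece.2 ⟨hxR'.1, hmem _ x hx⟩)
      · exact mem_union_right _ (mem_piece.2 ⟨hxR'.1, hmem _ x hx⟩)
    have dPQ : Disjoint (piece L a₀ A) (piece L a A) :=
      disjoint_left.2 fun x h1 h2 => hPQ x (mem_piece.1 h1).2 (mem_piece.1 h2).2
    have hsub : piece L a₀ A + X ∪ (piece L a A + X) ∪ (A \ (piece L a₀ A ∪ piece L a A)) ⊆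
        A + X := by
      refine union_subset (union_subset (add_subset_add_right (piece_subset _ _ _))
        (add_subset_add_right (piece_subset _ _ _))) fun x hx => ?_
      exact mem_add.2 ⟨x, (mem_sdiff.1 hx).1, 0, h0, add_zero x⟩
    have hc := card_le_card hsub
    rw [card_union_of_disjoint d2, card_union_of_disjoint d1] at hc
    have hB := card_sdiff_add_card_eq_card
      (union_subset (piece_subset L a₀ A) (piece_subset L a A))
    rw [card_union_of_disjoint dPQ] at hB
    omega
  -- Two unfilled cosets would each gain `|X| - 1`, and `2(|X| - 1) ≥ |X|`.
  have full : ∀ a ∈ A, a - a₀ ∉ L → ∀ z, z - a ∈ L → z ∈ A + X := by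
    intro a ha haa
    by_contra! hcon
    have := bound a ha hcon
    have := three a ha haa
    omega
  have hcoset : ∀ a ∈ A, a - a₀ ∈ L := by
    by_contra! hcon
    obtain ⟨a₁, ha₁, haa₁⟩ := hcon
    have := hLfin a₁ (full a₁ ha₁ haa₁)
    -- The coset of `a₀` already uses the whole allowed gain `|X| - 1`. Over every other coset the
    -- sum is full and gains nothing, so `A` itself is full there.
    refine hN.false_of_stable_part hhalf L hLne (F := A \ piece L a₀ A)
      ⟨a₁, mem_sdiff.2 ⟨ha₁, fun h => haa₁ (mem_piece.1 h).2⟩⟩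
      ⟨sdiff_subset, fun h => (mem_sdiff.1 (h ha₀)).2 (self_mem_piece ha₀)⟩ ?_ (x₀ := a₀) ?_
    · intro a ha p hp
      obtain ⟨haA, hap⟩ := mem_sdiff.1 ha
      have haa : a - a₀ ∉ L := fun h => hap (mem_piece.2 ⟨haA, h⟩)
      have h3 := three a haA haa
      have hs1 : a +ᵥ elems L ⊆ piece L a A + X := by
        intro w hw
        obtain ⟨q, hq, rfl⟩ := mem_vadd_finset.1 hw
        rw [mem_elems] at hq
        have hw' := full a haA haa (a + q) (by simpa using hq)
        obtain ⟨b, hb, x, hx, hbx⟩ := mem_add.1 hw'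
        refine mem_add.2 ⟨b, mem_piece.2 ⟨hb, ?_⟩, x, hx, hbx⟩
        have : b - a = q - x := by
          rw [sub_eq_sub_iff_add_eq_add, hbx, add_comm]
        rw [this]
        exact L.sub_mem hq (hXL x hx)
      have h4 := card_le_card hs1
      rw [card_vadd_finset] at h4
      have hs2 : piece L a A ⊆ a +ᵥ elems L := by
        intro b hb
        exact mem_vadd_finset.2 ⟨b - a, mem_elems.2 (mem_piece.1 hb).2, by simp⟩
      have hEq := eq_of_subset_of_card_le hs2 (by rw [card_vadd_finset]; omega)
      have hmem' : a + p ∈ piece L a A := by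
        rw [hEq]
        exact mem_vadd_finset.2 ⟨p, mem_elems.2 hp, rfl⟩
      refine mem_sdiff.2 ⟨(mem_piece.1 hmem').1, fun h => haa ?_⟩
      have h5 := L.sub_mem (mem_piece.1 h).2 hp
      have : a + p - a₀ - p = a - a₀ := by abel
      rwa [this] at h5
    · intro a ha
      by_cases h : a - a₀ ∈ L
      · exact Or.inr h
      · exact Or.inl (mem_sdiff.2 ⟨ha, fun h' => h (mem_piece.1 h').2⟩)
  exact hspan L a₀ hcoset

/-- A Sidon set that generates the group satisfies `NType`, so the roles can be exchanged: `A` is a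
critical partner of `X`, and `X` has a Sidon partner `Z`. Two mutually critical Sidon sets are tiny:
if both have at least 3 elements, `3|X| - 3` and `3|Z| - 3` are at most `|X| + |Z| - 1`, which is
impossible; and `|Z| = 2` gives `|X| ≤ 2`. -/
theorem card_eq_two_of_sidon {A X : Finset G} (hN : NType A) (hA : 2 ≤ #A)
    (hspan : Spans (A : Set G)) (hhalf : Finite G → 2 * #A ≤ Nat.card G) (hfrag : Frag A X)
    (hX : IsSidon X) : #X = 2 := by
  have hAne : A.Nonempty := card_pos.1 (by omega)
  by_contra hne
  have h3 : 3 ≤ #X := by have := hfrag.two_le; omega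
  obtain ⟨x₁, hx₁⟩ := card_pos.1 (show 0 < #X by omega)
  set X' := (-x₁) +ᵥ X with hX'
  have hc' : #X' = #X := card_vadd_finset _ _
  have h0 : (0 : G) ∈ X' := mem_vadd_finset.2 ⟨x₁, hx₁, by simp⟩
  have hS' : IsSidon X' := hX.vadd _
  have hAX' : A + X' = (-x₁) +ᵥ (A + X) := add_vadd_finset _ _ _
  have hfrag' : Frag A X' := by
    obtain ⟨h2, ⟨z₁, z₂, hzz, hz₁, hz₂⟩, hlt⟩ := hfrag
    refine ⟨by omega, ⟨(-x₁) +ᵥ z₁, (-x₁) +ᵥ z₂, fun h => hzz (by simpa using h), ?_, ?_⟩, ?_⟩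
    · rwa [hAX', vadd_mem_vadd_finset_iff]
    · rwa [hAX', vadd_mem_vadd_finset_iff]
    · rwa [hAX', card_vadd_finset, hc']
  have hcl := closure_eq_top_of_sidon hN hAne hspan hhalf hfrag' hS' h0
  have hN' : NType X' := by
    intro N _ hNb hz
    have hNt := ne_top_of_notMem_add ⟨0, h0⟩ hz
    have : ∃ x ∈ X', x ∉ N := by
      by_contra! hcon
      exact hNt (top_le_iff.1 (hcl ▸ (AddSubgroup.closure_le N).2 hcon))
    obtain ⟨x, hx, hxN⟩ := this
    exact hS'.card_add_le hNb hx h0 (by simpa using hxN)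
  obtain ⟨Z, hZ, hZS⟩ := exists_sidon hN' ⟨0, h0⟩ ⟨A, hA, by
    rw [add_comm]; exact hfrag'.missing, by rw [add_comm X' A, add_comm #X']; exact hfrag'.card_lt⟩
  have hZ2 := hZ.two_le
  have hlt := hZ.card_lt
  have h6 := hS'.two_mul_card_le hZ2
  by_cases hZ3 : 3 ≤ #Z
  · have h7 := hS'.three_mul_card_le hZ3
    have h8 := hZS.three_mul_card_le (Z := X') (by omega)
    rw [add_comm Z X'] at h8
    omega
  · omega

/-- The set `{x₀, x₀ + r, …, x₀ + (l - 1) r}`. -/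
def ap (x₀ r : G) (l : ℕ) : Finset G :=
  (range l).image fun j => x₀ + j • r

theorem mem_ap {x₀ r : G} {l : ℕ} {x : G} : x ∈ ap x₀ r l ↔ ∃ j < l, x₀ + j • r = x := by
  simp [ap]

theorem stable_zmultiples {F : Finset G} {r : G} (hF : ∀ x ∈ F, x - r ∈ F) :
    ∀ x ∈ F, ∀ p ∈ AddSubgroup.zmultiples r, x + p ∈ F := by
  have h1 : (-r) +ᵥ F ⊆ F := by
    intro w hw
    obtain ⟨x, hx, rfl⟩ := mem_vadd_finset.1 hw
    rw [vadd_eq_add, neg_add_eq_sub]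
    exact hF x hx
  have h2 : (-r) +ᵥ F = F := eq_of_subset_of_card_le h1 (by rw [card_vadd_finset])
  have h3 : AddSubgroup.zmultiples r ≤ AddAction.stabilizer G F := by
    rw [AddSubgroup.zmultiples_le]
    have : -r ∈ AddAction.stabilizer G F := h2
    simpa using neg_mem this
  intro x hx p hp
  have h4 : p +ᵥ F = F := h3 hp
  rw [← h4, add_comm]
  exact vadd_mem_vadd_finset hx

/-- A set which gains one element under adding `{0, r}` is a progression and a union of
`⟨r⟩`-cosets. -/
theorem exists_run {X : Finset G} {r : G} (h : #(X ∪ (r +ᵥ X)) = #X + 1) :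
    ∃ x₀ l, 1 ≤ l ∧ ap x₀ r l ⊆ X ∧ #(ap x₀ r l) = l ∧
      ∀ x ∈ X \ ap x₀ r l, x - r ∈ X \ ap x₀ r l := by
  -- Exactly one element of `X` has no predecessor in `X`; the progression is the run that starts
  -- from it.
  have h1 : #(X \ (r +ᵥ X)) = 1 := by
    have := card_sdiff_add_card X (r +ᵥ X)
    rw [card_vadd_finset] at this
    omega
  obtain ⟨x₀, hx₀⟩ := card_eq_one.1 h1
  have hx₀X : x₀ ∈ X ∧ x₀ ∉ r +ᵥ X := mem_sdiff.1 (hx₀ ▸ mem_singleton_self x₀)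
  have hx₀r : x₀ - r ∉ X := fun h => hx₀X.2 (mem_vadd_finset.2 ⟨x₀ - r, h, by simp⟩)
  have hpred : ∀ x ∈ X, x ≠ x₀ → x - r ∈ X := by
    intro x hx hne
    by_contra hcon
    apply hne
    rw [← mem_singleton, ← hx₀]
    refine mem_sdiff.2 ⟨hx, fun h => hcon ?_⟩
    obtain ⟨y, hy, rfl⟩ := mem_vadd_finset.1 h
    simpa using hy
  -- A repetition in the run would pass through `x₀ - r`, which is not in `X`; so the terms before
  -- the first exit from `X` are distinct.
  have hwrap : ∀ i j : ℕ, i < j → x₀ + i • r = x₀ + j • r → x₀ + (j - i - 1) • r ∉ X := by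
    intro i j hij he hmem
    apply hx₀r
    have : x₀ + (j - i - 1) • r = x₀ - r := by
      have e1 : j • r = (j - i - 1) • r + r + i • r := by
        rw [← succ_nsmul, ← add_nsmul]
        congr 1
        omega
      rw [e1] at he
      have e2 : (j - i - 1) • r + r = 0 := by
        have := add_left_cancel he
        rwa [eq_comm, add_eq_right] at this
      rw [sub_eq_add_neg, eq_neg_of_add_eq_zero_left e2]
    rwa [← this]
  have hex : ∃ l : ℕ, x₀ + l • r ∉ X := by
    by_contra! hcon
    refine not_injective_infinite_finite (fun l : ℕ => (⟨x₀ + l • r, hcon l⟩ : X)) ?_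
    intro i j hij
    have hij' : x₀ + i • r = x₀ + j • r := congrArg Subtype.val hij
    rcases lt_trichotomy i j with hlt | heq | hlt
    · exact absurd (hcon _) (hwrap i j hlt hij')
    · exact heq
    · exact absurd (hcon _) (hwrap j i hlt hij'.symm)
  classical
  let l := Nat.find hex
  have hl : x₀ + l • r ∉ X := Nat.find_spec hex
  have hlt : ∀ j < l, x₀ + j • r ∈ X := fun j hj => not_not.1 (Nat.find_min hex hj)
  have hl1 : 1 ≤ l := by
    by_contra! hcon
    have : l = 0 := by omega
    rw [this, zero_nsmul, add_zero] at hl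
    exact hl hx₀X.1
  refine ⟨x₀, l, hl1, ?_, ?_, ?_⟩
  · intro x hx
    obtain ⟨j, hj, rfl⟩ := mem_ap.1 hx
    exact hlt j hj
  · rw [ap, card_image_of_injOn, card_range]
    intro i hi j hj hij
    have hi' : i < l := by simpa using hi
    have hj' : j < l := by simpa using hj
    rcases lt_trichotomy i j with h' | h' | h'
    · exact absurd (hlt _ (by omega)) (hwrap i j h' hij)
    · exact h'
    · exact absurd (hlt _ (by omega)) (hwrap j i h' hij.symm)
  · intro x hx
    obtain ⟨hxX, hxR⟩ := mem_sdiff.1 hx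
    refine mem_sdiff.2 ⟨hpred x hxX ?_, ?_⟩
    · rintro rfl
      exact hxR (mem_ap.2 ⟨0, hl1, by simp⟩)
    · intro h
      obtain ⟨j, hj, hjx⟩ := mem_ap.1 h
      have hx' : x = x₀ + (j + 1) • r := by
        rw [succ_nsmul, ← add_assoc, hjx, sub_add_cancel]
      rcases (show j + 1 < l ∨ j + 1 = l by omega) with h' | h'
      · exact hxR (mem_ap.2 ⟨j + 1, h', hx'.symm⟩)
      · rw [h'] at hx'
        exact hl (hx' ▸ hxX)

theorem Spans.zmultiples_eq_top {x₀ r : G} {l : ℕ} (h : Spans (ap x₀ r l : Set G)) :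
    AddSubgroup.zmultiples r = ⊤ := by
  refine h _ x₀ fun x hx => ?_
  obtain ⟨j, -, rfl⟩ := mem_ap.1 (mem_coe.1 hx)
  rw [add_sub_cancel_left]
  exact AddSubgroup.nsmul_mem _ (AddSubgroup.mem_zmultiples r) j

/-- Vosper's theorem for sets without subgroup obstructions. -/
theorem eq_ap_of_frag {A : Finset G} (hN : NType A) (hA : 2 ≤ #A)
    (hspan : Spans (A : Set G)) (hhalf : Finite G → 2 * #A ≤ Nat.card G) (hfrag : ∃ X, Frag A X) :
    ∃ x₀ r, A = ap x₀ r #A := by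
  have hAne : A.Nonempty := card_pos.1 (by omega)
  obtain ⟨X, hX, hS⟩ := exists_sidon hN hAne hfrag
  have hX2 := card_eq_two_of_sidon hN hA hspan hhalf hX hS
  obtain ⟨x, y, hxy, rfl⟩ := card_eq_two.1 hX2
  obtain ⟨z, -, -, hz, -⟩ := hX.missing
  have hge := hN.card_le hAne ⟨x, by simp⟩ ⟨z, hz⟩
  have hlt := hX.card_lt
  have e : A + {x, y} = x +ᵥ (A ∪ ((y - x) +ᵥ A)) := by
    have hs : ∀ c : G, A + {c} = c +ᵥ A := by
      intro c
      ext w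
      simp only [mem_add, mem_singleton, mem_vadd_finset, vadd_eq_add]
      constructor
      · rintro ⟨a, ha, b, rfl, rfl⟩
        exact ⟨a, ha, add_comm _ _⟩
      · rintro ⟨a, ha, rfl⟩
        exact ⟨a, ha, c, rfl, add_comm _ _⟩
    rw [insert_eq, add_union, hs, hs, vadd_finset_union, vadd_vadd, add_sub_cancel]
  rw [e, card_vadd_finset, hX2] at hge hlt
  obtain ⟨x₀, l, hl, hsub, hcard, hst⟩ := exists_run (X := A) (r := y - x) (by omega)
  set F := A \ ap x₀ (y - x) l with hF
  have hFe : F = ∅ := by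
    by_contra hne
    have hFne : F.Nonempty := nonempty_iff_ne_empty.2 hne
    have hst' := stable_zmultiples hst
    obtain ⟨f, hf⟩ := hFne
    have : Finite (AddSubgroup.zmultiples (y - x)) := by
      refine (((-f) +ᵥ F : Finset G).finite_toSet).subset fun p hp => ?_
      rw [mem_coe, mem_vadd_finset]
      exact ⟨f + p, hst' f hf p hp, by simp⟩
    have hx₀ : x₀ ∈ ap x₀ (y - x) l := mem_ap.2 ⟨0, hl, by simp⟩
    refine hN.false_of_stable_part hhalf (AddSubgroup.zmultiples (y - x))
      (by rw [Ne, AddSubgroup.zmultiples_eq_bot, sub_eq_zero]; exact hxy.symm) ⟨f, hf⟩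
      ⟨sdiff_subset, fun h => (mem_sdiff.1 (h (hsub hx₀))).2 hx₀⟩ hst' (x₀ := x₀) ?_
    intro a ha
    by_cases h : a ∈ ap x₀ (y - x) l
    · right
      obtain ⟨j, -, rfl⟩ := mem_ap.1 h
      rw [add_sub_cancel_left]
      exact AddSubgroup.nsmul_mem _ (AddSubgroup.mem_zmultiples _) j
    · exact Or.inl (mem_sdiff.2 ⟨ha, h⟩)
  have hAe : A = ap x₀ (y - x) l := subset_antisymm (sdiff_eq_empty_iff_subset.1 hFe) hsub
  refine ⟨x₀, y - x, ?_⟩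
  have : #A = l := by rw [hAe, hcard]
  rw [this]
  exact hAe

/-- A proper subset which is in a critical pair with a progression whose difference generates
the group is itself a progression. -/
theorem eq_ap_of_card_ap_add_lt {x₀ r : G} {a : ℕ} (ha : 2 ≤ a)
    (hr : AddSubgroup.zmultiples r = ⊤) {X : Finset G} (hX : X.Nonempty)
    (hz : ∃ z, z ∉ ap x₀ r a + X) (hlt : #(ap x₀ r a + X) < a + #X) :
    ∃ y₀, X = ap y₀ r #X := by
  have hgrow : ∀ S : Finset G, S.Nonempty → (∃ z, z ∉ S) → #S + 1 ≤ #(S ∪ (r +ᵥ S)) := by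
    intro S hS hzS
    by_contra! hcon
    have h1 : S ∪ (r +ᵥ S) = S :=
      (eq_of_subset_of_card_le subset_union_left (by omega)).symm
    have h2 : r +ᵥ S ⊆ S := union_eq_left.1 h1
    have h3 : r +ᵥ S = S := eq_of_subset_of_card_le h2 (by rw [card_vadd_finset])
    have h4 := stable_zmultiples (F := S) (r := r) (by
      intro x hx
      rw [← h3] at hx
      obtain ⟨y, hy, rfl⟩ := mem_vadd_finset.1 hx
      simpa using hy)
    obtain ⟨z, hz⟩ := hzS
    obtain ⟨s, hs⟩ := hS
    apply hz
    have := h4 s hs (z - s) (by rw [hr]; trivial)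
    rwa [add_sub_cancel] at this
  have hsucc : ∀ k, ap x₀ r (k + 2) + X =
      (ap x₀ r (k + 1) + X) ∪ (r +ᵥ (ap x₀ r (k + 1) + X)) := by
    intro k
    ext w
    simp only [mem_union, mem_add, mem_vadd_finset, mem_ap, vadd_eq_add]
    constructor
    · rintro ⟨_, ⟨j, hj, rfl⟩, x, hx, rfl⟩
      rcases Nat.lt_or_ge j (k + 1) with h | h
      · exact Or.inl ⟨_, ⟨j, h, rfl⟩, x, hx, rfl⟩
      · refine Or.inr ⟨x₀ + k • r + x, ⟨_, ⟨k, by omega, rfl⟩, x, hx, rfl⟩, ?_⟩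
        have : j = k + 1 := by omega
        rw [this, succ_nsmul]
        abel
    · rintro (⟨_, ⟨j, hj, rfl⟩, x, hx, rfl⟩ | ⟨_, ⟨_, ⟨j, hj, rfl⟩, x, hx, rfl⟩, rfl⟩)
      · exact ⟨_, ⟨j, by omega, rfl⟩, x, hx, rfl⟩
      · refine ⟨_, ⟨j + 1, by omega, rfl⟩, x, hx, ?_⟩
        rw [succ_nsmul]
        abel
  have hmono : ∀ k ≤ a, ap x₀ r k ⊆ ap x₀ r a := by
    intro k hk x hx
    obtain ⟨j, hj, rfl⟩ := mem_ap.1 hx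
    exact mem_ap.2 ⟨j, by omega, rfl⟩
  obtain ⟨z, hz⟩ := hz
  have hone : ap x₀ r 1 + X = x₀ +ᵥ X := by
    ext w
    simp [mem_add, mem_ap, mem_vadd_finset]
  have hne : ∀ k, (ap x₀ r (k + 1) + X).Nonempty := fun k =>
    Nonempty.add ⟨x₀, mem_ap.2 ⟨0, by omega, by simp⟩⟩ hX
  -- Each further term of the progression adds at least one element while the sum is proper, so
  -- criticality lets the step from one term to two add only one.
  have hge : ∀ k, k + 2 ≤ a → #(ap x₀ r 2 + X) + k ≤ #(ap x₀ r (k + 2) + X) := by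
    intro k
    induction k with
    | zero => intro _; simp
    | succ k ih =>
      intro hk
      have h1 : #(ap x₀ r 2 + X) + k ≤ #(ap x₀ r (k + 1 + 1) + X) := ih (by omega)
      have h2 := hgrow _ (hne (k + 1))
        ⟨z, fun h => hz (add_subset_add_right (hmono _ (by omega)) h)⟩
      rw [hsucc (k + 1)]
      omega
  have h2 := hge (a - 2) (by omega)
  rw [Nat.sub_add_cancel ha] at h2
  have hXz : ∃ z, z ∉ X := by
    refine ⟨-x₀ + z, fun h => hz ?_⟩
    refine mem_add.2 ⟨x₀, mem_ap.2 ⟨0, by omega, by simp⟩, _, h, by simp⟩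
  have h3 := hgrow X hX hXz
  have h4 : #(ap x₀ r 2 + X) = #(X ∪ (r +ᵥ X)) := by
    rw [hsucc 0, zero_add, hone, vadd_comm r x₀, ← vadd_finset_union, card_vadd_finset]
  obtain ⟨y₀, l, hl, hsub, hcard, hst⟩ := exists_run (X := X) (r := r) (by omega)
  have hFe : X \ ap y₀ r l = ∅ := by
    by_contra hcon
    obtain ⟨f, hf⟩ := nonempty_iff_ne_empty.2 hcon
    obtain ⟨w, hw⟩ := hXz
    have := stable_zmultiples hst f hf (w - f) (by rw [hr]; trivial)
    rw [add_sub_cancel] at this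
    exact hw (mem_sdiff.1 this).1
  have hXe : X = ap y₀ r l := subset_antisymm (sdiff_eq_empty_iff_subset.1 hFe) hsub
  refine ⟨y₀, ?_⟩
  have : #X = l := by rw [hXe, hcard]
  rw [this]
  exact hXe

end Vosper

/-! ### The counting argument behind chords -/

section Numeric

/-- Each `x` in `S` is charged to one window `[f x, f x + p]` with `f x` in `T`; summing the window
bounds counts each charged `γ x` at least once. -/
theorem sum_add_sum_le_card_mul {p m : ℕ} {β γ : ℕ → ℕ} (T S : Finset ℕ) (f : ℕ → ℕ)
    (hF : ∀ j ∈ T, β j + ∑ i ∈ range (p + 1), γ (j + i) ≤ m) (hf : ∀ x ∈ S, f x ∈ T)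
    (hw : ∀ x ∈ S, f x ≤ x ∧ x ≤ f x + p) :
    ∑ j ∈ T, β j + ∑ x ∈ S, γ x ≤ #T * m := by
  rw [← sum_fiberwise_of_maps_to hf, ← sum_add_distrib, ← smul_eq_mul]
  refine sum_le_card_nsmul _ _ _ fun j hj => le_trans ?_ (hF j hj)
  refine Nat.add_le_add_left ?_ _
  rw [← sum_image (f := γ) (s := range (p + 1)) (g := fun i => j + i) (by
    intro x _ y _ h
    exact Nat.add_left_cancel h)]
  refine sum_le_sum_of_subset fun x hx => ?_
  obtain ⟨hxS, rfl⟩ := mem_filter.1 hx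
  have := hw x hxS
  exact mem_image.2 ⟨x - f x, by simp; omega, by omega⟩

/-- In the application two sets lie over progressions of `p + 1` and `q + 1` cosets of a subgroup of
order `m`. `hole i` counts what the first set misses in its `i`-th coset, `β j` is the size of the
`j`-th part of the second, and `γ x` counts what the sum misses in its `x`-th coset. `hcount`
expresses criticality and `hF` the optimality of the subgroup. -/
theorem eq_zero_of_top_eq_zero {p q m h : ℕ} {hole β γ : ℕ → ℕ} (hp : 1 ≤ p) (hq : 1 ≤ q)
    (hh : ∑ i ∈ range (p + 1), hole i ≤ h)
    (hcount : q * m + h + 1 ≤ ∑ j ∈ range (q + 1), β j + ∑ x ∈ range (p + q + 1), γ x)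
    (hF : ∀ j < q + 1, β j + ∑ i ∈ range (p + 1), γ (j + i) ≤ m)
    (hpair : ∀ i < p + 1, ∀ j < q + 1, γ (i + j) ≠ 0 → β j ≤ hole i)
    (htop : γ (p + q) = 0) : ∀ x < p + q + 1, 1 ≤ x → γ x = 0 := by
  by_contra! hcon
  let S := (range (p + q + 1)).filter fun x => 1 ≤ x ∧ γ x ≠ 0
  have hS : S.Nonempty := by
    obtain ⟨x, hx, hx1, hx0⟩ := hcon
    exact ⟨x, mem_filter.2 ⟨mem_range.2 hx, hx1, hx0⟩⟩
  obtain ⟨hx₁r, hx₁1, hx₁0⟩ := mem_filter.1 (S.max'_mem hS)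
  set x₁ := S.max' hS with hx₁
  rw [mem_range] at hx₁r
  have hx₁t : x₁ ≠ p + q := fun h => hx₁0 (h ▸ htop)
  have hbig : ∀ x < p + q + 1, x₁ < x → γ x = 0 := by
    intro x hx hxx
    by_contra h0
    have := S.le_max' x (mem_filter.2 ⟨mem_range.2 hx, by omega, h0⟩)
    omega
  -- The window at `b` can be omitted: as `x₁ < p + q` and `1 ≤ p`, the `q` others still cover `0,
  -- …, x₁`. Then `hcount` forces `β b > h`, against `hpair` at `x₁ = (x₁ - b) + b`.
  set b := min x₁ q with hb
  have hT := sum_add_sum_le_card_mul (p := p) (m := m) (β := β) (γ := γ)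
    ((range (q + 1)).erase b) (range (x₁ + 1)) (fun x => min x (b - 1))
    (fun j hj => hF j (mem_range.1 (mem_erase.1 hj).2))
    (by
      intro x hx
      rw [mem_range] at hx
      rw [mem_erase, mem_range]
      omega)
    (by
      intro x hx
      rw [mem_range] at hx
      omega)
  rw [card_erase_of_mem (by rw [mem_range]; omega), card_range, Nat.add_sub_cancel] at hT
  have h1 : ∑ x ∈ range (x₁ + 1), γ x = ∑ x ∈ range (p + q + 1), γ x := by
    refine sum_subset (fun x hx => ?_) fun x hx hx' => ?_
    · rw [mem_range] at *; omega
    · rw [mem_range] at *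
      exact hbig x hx (by omega)
  have h2 := add_sum_erase (range (q + 1)) β (a := b) (by rw [mem_range]; omega)
  have h3 : β b ≤ hole (x₁ - b) :=
    hpair (x₁ - b) (by omega) b (by omega) (by rwa [Nat.sub_add_cancel (by omega)])
  have h4 : hole (x₁ - b) ≤ ∑ i ∈ range (p + 1), hole i :=
    single_le_sum (f := hole) (fun _ _ => Nat.zero_le _) (mem_range.2 (by omega))
  omega

theorem eq_zero_off_end {p q m h : ℕ} {hole β γ : ℕ → ℕ} (hp : 1 ≤ p) (hq : 1 ≤ q)
    (hh : ∑ i ∈ range (p + 1), hole i ≤ h)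
    (hcount : q * m + h + 1 ≤ ∑ j ∈ range (q + 1), β j + ∑ x ∈ range (p + q + 1), γ x)
    (hF : ∀ j < q + 1, β j + ∑ i ∈ range (p + 1), γ (j + i) ≤ m)
    (hpair : ∀ i < p + 1, ∀ j < q + 1, γ (i + j) ≠ 0 → β j ≤ hole i)
    (hpair' : ∀ i < p + 1, ∀ j < q + 1, γ (i + j) ≠ 0 → γ (i + j) ≤ hole i) :
    (∀ x < p + q + 1, x ≠ 0 → γ x = 0) ∨ (∀ x < p + q + 1, x ≠ p + q → γ x = 0) := by
  by_cases htop : γ (p + q) = 0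
  · left
    intro x hx hx0
    exact eq_zero_of_top_eq_zero hp hq hh hcount hF hpair htop x hx (by omega)
  by_cases h0 : γ 0 = 0
  · right
    -- Reversing the indices exchanges the two ends.
    have key := eq_zero_of_top_eq_zero (p := p) (q := q) (m := m) (h := h)
      (hole := fun i => hole (p - i)) (β := fun j => β (q - j)) (γ := fun x => γ (p + q - x)) hp hq
      (by
        have := sum_range_reflect hole (p + 1)
        simp only [Nat.add_sub_cancel_right] at this
        rwa [this])
      (by
        have e1 := sum_range_reflect β (q + 1)
        have e2 := sum_range_reflect γ (p + q + 1)
        simp only [Nat.add_sub_cancel_right] at e1 e2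
        rwa [e1, e2])
      (by
        intro j hj
        have e1 := sum_range_reflect (fun i => γ (q - j + i)) (p + 1)
        have e2 := hF (q - j) (by omega)
        rw [← e1] at e2
        convert e2 using 2
        refine sum_congr rfl fun i hi => ?_
        rw [mem_range] at hi
        congr 1
        omega)
      (by
        intro i hi j hj hne
        refine hpair (p - i) (by omega) (q - j) (by omega) ?_
        have : p - i + (q - j) = p + q - (i + j) := by omega
        rwa [this])
      (by simpa using h0)
    intro x hx hxt
    have := key (p + q - x) (by omega) (by omega)
    have e : p + q - (p + q - x) = x := by omega
    simp only [e] at this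
    exact this
  · exfalso
    -- With both ends nonzero, dropping the last window together with the last `γ` gives `β q + γ (p
    -- + q) > h`; dropping the first ones gives `β 0 + γ 0 > h`. The pairing bounds these by `2 *
    -- hole p` and `2 * hole 0`, and `hole 0 + hole p ≤ h` because `p ≠ 0`.
    have hT₁ := sum_add_sum_le_card_mul (p := p) (m := m) (β := β) (γ := γ)
      (range q) (range (p + q)) (fun x => min x (q - 1))
      (fun j hj => hF j (by rw [mem_range] at hj; omega))
      (by intro x hx; rw [mem_range]; omega)
      (by intro x hx; rw [mem_range] at hx; omega)
    have hT₂ := sum_add_sum_le_card_mul (p := p) (m := m) (β := β) (γ := γ)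
      ((range (q + 1)).erase 0) ((range (p + q + 1)).erase 0) (fun x => min x q)
      (fun j hj => hF j (mem_range.1 (mem_erase.1 hj).2))
      (by
        intro x hx
        rw [mem_erase, mem_range] at *
        omega)
      (by
        intro x hx
        rw [mem_erase, mem_range] at hx
        omega)
    rw [card_erase_of_mem (by simp), card_range, Nat.add_sub_cancel] at hT₂
    have e1 := add_sum_erase (range (q + 1)) β (a := 0) (by simp)
    have e2 := add_sum_erase (range (p + q + 1)) γ (a := 0) (by simp)
    have e3 := sum_range_succ β q
    have e4 := sum_range_succ γ (p + q)
    rw [card_range] at hT₁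
    have a1 := hpair p (by omega) q (by omega) htop
    have a2 := hpair' p (by omega) q (by omega) htop
    have a3 := hpair 0 (by omega) 0 (by omega) h0
    have a4 := hpair' 0 (by omega) 0 (by omega) h0
    have a5 : hole 0 + hole p ≤ ∑ i ∈ range (p + 1), hole i := by
      rw [sum_range_succ]
      have : hole 0 ≤ ∑ i ∈ range p, hole i :=
        single_le_sum (f := hole) (fun _ _ => Nat.zero_le _) (mem_range.2 (by omega))
      omega
    simp only [add_zero] at a4
    omega

end Numeric

/-! ### Sums of sets lying over progressions of cosets -/

section Chord

variable {G : Type*} [AddCommGroup G]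

/-- A repetition gives `d • r = 0` for some `0 < d < k`. Since `r` generates the group, reduction of
multiples modulo `d` shows that the progression is already everything. -/
theorem injOn_of_notMem_ap [DecidableEq G] {w r : G} {k : ℕ} (hr : AddSubgroup.zmultiples r = ⊤)
    (hz : ∃ z, z ∉ ap w r k) : ∀ i < k, ∀ j < k, w + i • r = w + j • r → i = j := by
  have key : ∀ i j, i < j → j < k → w + i • r ≠ w + j • r := by
    intro i j hij hjk he
    obtain ⟨z, hz⟩ := hz
    have hd : ((j - i : ℕ) : ℤ) • r = 0 := by
      have e1 : j • r = (j - i) • r + i • r := by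
        rw [← add_nsmul]; congr 1; omega
      rw [add_left_cancel_iff, e1, eq_comm, add_eq_right] at he
      rwa [natCast_zsmul]
    obtain ⟨n, hn⟩ := AddSubgroup.mem_zmultiples_iff.1
      (show z - w ∈ AddSubgroup.zmultiples r by rw [hr]; trivial)
    apply hz
    have hpos : (0 : ℤ) < ((j - i : ℕ) : ℤ) := by omega
    have h1 := Int.emod_nonneg n hpos.ne'
    have h2 := Int.emod_lt_of_pos n hpos
    refine mem_ap.2 ⟨(n % ((j - i : ℕ) : ℤ)).toNat, by omega, ?_⟩
    rw [← natCast_zsmul, Int.toNat_of_nonneg h1]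
    have h3 := Int.emod_add_mul_ediv n ((j - i : ℕ) : ℤ)
    have h4 : n • r = (n % ((j - i : ℕ) : ℤ)) • r := by
      conv_lhs => rw [← h3, add_zsmul, mul_comm, mul_zsmul, hd, smul_zero, add_zero]
    rw [← h4, hn, add_sub_cancel]
  intro i hi j hj he
  rcases lt_trichotomy i j with h | h | h
  · exact absurd he (key i j h hj)
  · exact h
  · exact absurd he.symm (key j i h hi)

theorem ap_add_ap [DecidableEq G] (x y r : G) (p q : ℕ) :
    ap x r (p + 1) + ap y r (q + 1) = ap (x + y) r (p + q + 1) := by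
  ext w
  simp only [mem_add, mem_ap]
  constructor
  · rintro ⟨_, ⟨i, hi, rfl⟩, _, ⟨j, hj, rfl⟩, rfl⟩
    exact ⟨i + j, by omega, by rw [add_nsmul]; abel⟩
  · rintro ⟨k, hk, rfl⟩
    refine ⟨_, ⟨min k p, by omega, rfl⟩, _, ⟨k - min k p, by omega, rfl⟩, ?_⟩
    have : k • r = (min k p) • r + (k - min k p) • r := by
      rw [← add_nsmul]; congr 1; omega
    rw [this]
    abel

variable [DecidableEq G] {M : AddSubgroup G} [DecidableEq (G ⧸ M)]

/-- The part of `X` over the element `c` of the quotient. -/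
def fib (X : Finset G) (c : G ⧸ M) : Finset G :=
  X.filter fun x : G => (x : G ⧸ M) = c

theorem mem_fib {X : Finset G} {c : G ⧸ M} {x : G} : x ∈ fib X c ↔ x ∈ X ∧ (x : G ⧸ M) = c :=
  mem_filter

theorem fib_mono {X Y : Finset G} (h : X ⊆ Y) (c : G ⧸ M) : fib X c ⊆ fib Y c :=
  filter_subset_filter _ h

theorem card_eq_sum_fib {X : Finset G} {w r : G ⧸ M} {k : ℕ} (hX : proj M X = ap w r k)
    (hinj : ∀ i < k, ∀ j < k, w + i • r = w + j • r → i = j) :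
    #X = ∑ i ∈ range k, #(fib X (w + i • r)) := by
  rw [card_eq_sum_card_fiberwise (f := fun x : G => (x : G ⧸ M)) (s := X) (t := ap w r k)
    (fun x hx => by rw [← hX]; exact mk_mem_proj hx), ap, sum_image]
  · rfl
  · intro i hi j hj h
    exact hinj i (by simpa using hi) j (by simpa using hj) h

variable [Finite M]

theorem fib_subset_vadd {X : Finset G} {b : G} : fib (M := M) X b ⊆ b +ᵥ elems M := by
  intro x hx
  exact mem_vadd_finset.2 ⟨x - b, mem_elems.2 (mk_eq_mk_iff.1 (mem_fib.1 hx).2), by simp⟩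

theorem card_fib_le (X : Finset G) (c : G ⧸ M) : #(fib X c) ≤ #(elems M) := by
  induction c using QuotientAddGroup.induction_on with
  | H b =>
    rw [← card_vadd_finset b (elems M)]
    exact card_le_card fib_subset_vadd

theorem mem_of_card_fib_eq {X : Finset G} {c : G ⧸ M} (h : #(elems M) ≤ #(fib X c)) {w : G}
    (hw : (w : G ⧸ M) = c) : w ∈ X := by
  subst hw
  have := eq_of_subset_of_card_le (fib_subset_vadd (X := X) (b := w))
    (by rw [card_vadd_finset]; exact h)
  have hw : w ∈ w +ᵥ elems M := mem_vadd_finset.2 ⟨0, by simp, by simp⟩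
  rw [← this] at hw
  exact (mem_fib.1 hw).1

theorem exists_notMem_of_card_fib_lt {X : Finset G} {c : G ⧸ M} (h : #(fib X c) < #(elems M)) :
    ∃ w : G, (w : G ⧸ M) = c ∧ w ∉ X := by
  by_contra! hcon
  induction c using QuotientAddGroup.induction_on with
  | H b =>
    have : b +ᵥ elems M ⊆ fib X (b : G ⧸ M) := by
      intro x hx
      obtain ⟨n, hn, rfl⟩ := mem_vadd_finset.1 hx
      have : ((b + n : G) : G ⧸ M) = b := mk_eq_mk_iff.2 (by simpa using hn)
      exact mem_fib.2 ⟨hcon _ this, this⟩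
    have := card_le_card this
    rw [card_vadd_finset] at this
    omega

/-- Pigeonhole in one coset: since `w` is not a sum, the part of `A` over `c` is disjoint from `w`
minus the part of `Y` over `d`. -/
theorem card_fib_add_card_fib_le {A Y : Finset G} {c d : G ⧸ M} {w : G}
    (hw : (w : G ⧸ M) = c + d) (hwn : w ∉ A + Y) : #(fib A c) + #(fib Y d) ≤ #(elems M) := by
  have hinj : Function.Injective fun y : G => w - y := fun _ _ h => sub_right_injective h
  rw [← card_image_of_injective (fib Y d) hinj, ← card_union_of_disjoint]
  · induction c using QuotientAddGroup.induction_on with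
    | H b =>
      rw [← card_vadd_finset b (elems M)]
      refine card_le_card (union_subset fib_subset_vadd fun x hx => ?_)
      obtain ⟨y, hy, rfl⟩ := mem_image.1 hx
      refine fib_subset_vadd (X := {w - y}) (mem_fib.2 ⟨mem_singleton_self _, ?_⟩)
      rw [QuotientAddGroup.mk_sub, hw, (mem_fib.1 hy).2, add_sub_cancel_right]
  · rw [disjoint_right]
    intro x hx hxA
    obtain ⟨y, hy, rfl⟩ := mem_image.1 hx
    exact hwn (mem_add.2 ⟨w - y, (mem_fib.1 hxA).1, y, (mem_fib.1 hy).1, sub_add_cancel _ _⟩)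

theorem card_fib_le_card_fib_add {A Y : Finset G} {c d : G ⧸ M} (hd : d ∈ proj M Y) :
    #(fib A c) ≤ #(fib (A + Y) (c + d)) := by
  obtain ⟨y, hy, rfl⟩ := mem_proj.1 hd
  rw [← card_vadd_finset y]
  refine card_le_card fun x hx => ?_
  obtain ⟨a, ha, rfl⟩ := mem_vadd_finset.1 hx
  obtain ⟨haA, hac⟩ := mem_fib.1 ha
  refine mem_fib.2 ⟨mem_add.2 ⟨a, haA, y, hy, add_comm _ _⟩, ?_⟩
  rw [vadd_eq_add, QuotientAddGroup.mk_add, hac, add_comm]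

/-- In a critical pair of near-progressions, the sum is full off one end. -/
theorem Good.full_off_end {A Y : Finset G} (h : Good A M) {x₀ y₀ r : G ⧸ M} {p q : ℕ} (hp : 1 ≤ p)
    (hq : 1 ≤ q) (hr : AddSubgroup.zmultiples r = ⊤) (hA : proj M A = ap x₀ r (p + 1))
    (hY : proj M Y = ap y₀ r (q + 1)) (hz : ∃ z, z ∉ proj M A + proj M Y)
    (hlt : #(A + Y) < #A + #Y) :
    (∀ w : G, (w : G ⧸ M) ∈ proj M A + proj M Y → (w : G ⧸ M) ≠ x₀ + y₀ → w ∈ A + Y) ∨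
    (∀ w : G, (w : G ⧸ M) ∈ proj M A + proj M Y → (w : G ⧸ M) ≠ x₀ + y₀ + (p + q) • r →
      w ∈ A + Y) := by
  have hAY : proj M (A + Y) = ap (x₀ + y₀) r (p + q + 1) := by
    rw [proj_add, hA, hY, ap_add_ap]
  rw [← proj_add, hAY] at hz ⊢
  have hinj := injOn_of_notMem_ap hr hz
  have hrinj : ∀ i < p + q + 1, ∀ j < p + q + 1, i • r = j • r → i = j := by
    intro i hi j hj hij
    exact hinj i hi j hj (by rw [hij])
  have hinjw : ∀ (w : G ⧸ M) (k : ℕ), k ≤ p + q + 1 →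
      ∀ i < k, ∀ j < k, w + i • r = w + j • r → i = j := fun w k hk i hi j hj hij =>
    hrinj i (by omega) j (by omega) (add_left_cancel hij)
  set m := #(elems M) with hm
  set α : ℕ → ℕ := fun i => #(fib A (x₀ + i • r)) with hα
  set β : ℕ → ℕ := fun j => #(fib Y (y₀ + j • r)) with hβ
  set σ : ℕ → ℕ := fun x => #(fib (A + Y) (x₀ + y₀ + x • r)) with hσ
  have cA : #A = ∑ i ∈ range (p + 1), α i := card_eq_sum_fib hA (hinjw _ _ (by omega))
  have cY : #Y = ∑ i ∈ range (q + 1), β i := card_eq_sum_fib hY (hinjw _ _ (by omega))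
  have cAY : #(A + Y) = ∑ i ∈ range (p + q + 1), σ i := card_eq_sum_fib hAY (hinjw _ _ le_rfl)
  have compl : ∀ (k : ℕ) (f : ℕ → ℕ), (∀ i, f i ≤ m) →
      ∑ i ∈ range k, (m - f i) + ∑ i ∈ range k, f i = k * m := by
    intro k f hf
    rw [← sum_add_distrib, sum_congr rfl (fun i _ => Nat.sub_add_cancel (hf i)), sum_const,
      card_range, smul_eq_mul]
  have k1 := compl (p + 1) α fun i => card_fib_le _ _
  have k2 := compl (p + q + 1) σ fun i => card_fib_le _ _
  have hAM : #(A + elems M) = (p + 1) * m := by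
    rw [card_add_elems, hA, ap, card_image_of_injOn, card_range]
    intro i hi j hj hij
    exact hinjw x₀ (p + 1) (by omega) i (by simpa using hi) j (by simpa using hj) hij
  have hex : ∀ i j : ℕ, x₀ + y₀ + (i + j) • r = (x₀ + i • r) + (y₀ + j • r) := by
    intro i j
    rw [add_nsmul]
    abel
  have hYmem : ∀ j < q + 1, y₀ + j • r ∈ proj M Y := fun j hj => by
    rw [hY]; exact mem_ap.2 ⟨j, hj, rfl⟩
  -- The side conditions are, in order: criticality of `(A, Y)`, optimality of `M` tested on one
  -- part of `Y`, the pigeonhole bound at a missing element, and the fact that a translate of each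
  -- part of `A` lies in the sum.
  have main := eq_zero_off_end (m := m) (h := ∑ i ∈ range (p + 1), (m - α i))
    (hole := fun i => m - α i) (β := β) (γ := fun x => m - σ x) hp hq le_rfl ?_ ?_ ?_ ?_
  · have fin : ∀ x, m - σ x = 0 → ∀ w : G, (w : G ⧸ M) = x₀ + y₀ + x • r → w ∈ A + Y := by
      intro x hx w hw
      exact mem_of_card_fib_eq (Nat.sub_eq_zero_iff_le.1 hx) hw
    refine main.imp ?_ ?_
    · intro hmain w hw hne
      obtain ⟨x, hx, hxw⟩ := mem_ap.1 hw
      refine fin x (hmain x hx ?_) w hxw.symm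
      rintro rfl
      exact hne (by rw [← hxw, zero_nsmul, add_zero])
    · intro hmain w hw hne
      obtain ⟨x, hx, hxw⟩ := mem_ap.1 hw
      refine fin x (hmain x hx ?_) w hxw.symm
      rintro rfl
      exact hne hxw.symm
  · have e : (p + q + 1) * m = (p + 1) * m + q * m := by ring
    omega
  · intro j hj
    obtain ⟨y, hy, hyj⟩ := mem_proj.1 (hYmem j hj)
    have hZ := h.card_le (fib Y (y₀ + j • r)) ⟨y, mem_fib.2 ⟨hy, hyj⟩⟩
      (exists_notMem_add_of_subset_coset h (b := y) fun x hx =>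
        mk_eq_mk_iff.1 ((mem_fib.1 hx).2.trans hyj.symm))
    have hpZ : proj M (A + fib Y (y₀ + j • r)) = ap (x₀ + (y₀ + j • r)) r (p + 1) := by
      have : proj M (fib Y (y₀ + j • r)) = ap (y₀ + j • r) r (0 + 1) := by
        ext c
        rw [mem_proj, mem_ap]
        constructor
        · rintro ⟨x, hx, rfl⟩
          exact ⟨0, by omega, by rw [(mem_fib.1 hx).2, zero_nsmul, add_zero]⟩
        · rintro ⟨i, hi, rfl⟩
          have : i = 0 := by omega
          subst this
          exact ⟨y, mem_fib.2 ⟨hy, hyj⟩, by rw [hyj, zero_nsmul, add_zero]⟩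
      rw [proj_add, hA, this, ap_add_ap, add_zero]
    have cZ := card_eq_sum_fib hpZ (hinjw _ _ (by omega))
    have hle : #(A + fib Y (y₀ + j • r)) ≤ ∑ i ∈ range (p + 1), σ (j + i) := by
      rw [cZ]
      refine sum_le_sum fun i _ => ?_
      have e : x₀ + (y₀ + j • r) + i • r = x₀ + y₀ + (j + i) • r := by
        rw [add_nsmul]; abel
      rw [e]
      exact card_le_card (fib_mono (add_subset_add_left (filter_subset _ _)) _)
    have k3 := compl (p + 1) (fun i => σ (j + i)) fun i => card_fib_le _ _
    change β j + _ ≤ _ at hZ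
    change β j + ∑ i ∈ range (p + 1), (m - σ (j + i)) ≤ m
    omega
  · intro i hi j hj hne
    obtain ⟨w, hw, hwn⟩ := exists_notMem_of_card_fib_lt (show σ (i + j) < m by
      change m - σ (i + j) ≠ 0 at hne
      omega)
    rw [hex] at hw
    have := card_fib_add_card_fib_le hw hwn
    change β j ≤ m - α i
    change α i + β j ≤ m at this
    omega
  · intro i hi j hj hne
    have := card_fib_le_card_fib_add (A := A) (c := x₀ + i • r) (hYmem j hj)
    rw [← hex] at this
    change α i ≤ σ (i + j) at this
    change m - σ (i + j) ≤ m - α i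
    omega

end Chord

/-! ### The smallest set projects to a progression -/

section Progression

variable {G : Type*} [AddCommGroup G] [DecidableEq G] {M : AddSubgroup G} [DecidableEq (G ⧸ M)]

theorem Spans.proj {A : Finset G} (hA : Spans (A : Set G)) : Spans (proj M A : Set (G ⧸ M)) := by
  intro L g hL
  induction g using QuotientAddGroup.induction_on with
  | H g =>
    have := hA (L.comap (QuotientAddGroup.mk' M)) g fun x hx => by
      simpa using hL _ (mem_coe.2 (mk_mem_proj hx))
    rw [eq_top_iff]
    rintro c -
    induction c using QuotientAddGroup.induction_on with
    | H c =>
      have hc : c ∈ L.comap (QuotientAddGroup.mk' M) := this ▸ AddSubgroup.mem_top c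
      exact hc

variable [Finite M]

theorem finite_comap_mk (N : AddSubgroup (G ⧸ M)) [Finite N] :
    Finite (N.comap (QuotientAddGroup.mk' M)) := by
  refine Set.Finite.preimage' (f := QuotientAddGroup.mk' M) (Set.toFinite (N : Set (G ⧸ M)))
    fun c _ => ?_
  induction c using QuotientAddGroup.induction_on with
  | H b =>
    refine (finite_toSet (b +ᵥ elems M)).subset fun x hx => ?_
    exact mem_coe.2 (mem_vadd_finset.2 ⟨x - b, mem_elems.2 (mk_eq_mk_iff.1 hx), by simp⟩)

/-- A nontrivial subgroup of the quotient pulls back to one strictly larger than `M`, whose excess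
is strictly larger by maximality of `M`. Both excesses are multiples of `|M|`, so they differ by at
least `|M|`, which is one unit in the quotient. -/
theorem Good.nType {A : Finset G} (h : Good A M) : NType (proj M A) := by
  intro N _ hN hz
  have := finite_comap_mk N
  set N' := N.comap (QuotientAddGroup.mk' M) with hN'
  have hMN : M ≤ N' := fun x hx => by
    have : ((x : G) : G ⧸ M) = 0 := (QuotientAddGroup.eq_zero_iff x).2 hx
    change ((x : G) : G ⧸ M) ∈ N
    rw [this]
    exact N.zero_mem
  have hp : Kemperman.proj M (elems N') = elems N := by
    ext c
    rw [mem_proj, mem_elems]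
    constructor
    · rintro ⟨x, hx, rfl⟩
      exact (mem_elems.1 hx : x ∈ N')
    · intro hc
      induction c using QuotientAddGroup.induction_on with
      | H b => exact ⟨b, mem_elems.2 hc, rfl⟩
  have hlt : M < N' := by
    refine lt_of_le_of_ne hMN fun he => hN ?_
    rw [eq_bot_iff]
    intro c hc
    induction c using QuotientAddGroup.induction_on with
    | H b =>
      have hb : b ∈ M := by rw [he]; exact hc
      exact (QuotientAddGroup.eq_zero_iff b).2 hb
  have hsum : elems N' + elems M = elems N' := by
    ext x
    rw [mem_add_elems, hp, mem_elems, mem_elems]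
    rfl
  have hz' : ∃ z, z ∉ A + elems N' := by
    rw [← hp, ← proj_add, exists_notMem_proj, add_assoc, hsum] at hz
    exact hz
  have key := h.lt_of_lt N' hlt hz'
  have e1 := card_add_elems (M := M) A
  have e2 := card_add_elems (M := M) (elems N')
  have e3 := card_add_elems (M := M) (A + elems N')
  rw [hsum, hp] at e2
  rw [add_assoc, hsum, proj_add, hp] at e3
  rw [e1, e2, e3] at key
  have hm := card_elems_pos M
  by_contra! hcon
  have := Nat.mul_le_mul_right #(elems M) (show #(Kemperman.proj M A + elems N) + 1 ≤ _ from hcon)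
  rw [add_mul, add_mul] at this
  omega

theorem Good.two_le_card_proj {A : Finset G} (h : Good A M) (hA : Spans (A : Set G)) :
    2 ≤ #(proj M A) := by
  obtain ⟨a, ha, b, hb, hab⟩ :=
    hA.exists_sub_notMem h.nonempty (ne_top_of_notMem_add h.nonempty h.exists_notMem)
  have := two_mul_card_le_of_mem_add_elems ha hb hab
  rw [card_add_elems] at this
  exact Nat.le_of_mul_le_mul_right this (card_elems_pos M)

/-- With `a = |proj M A|` and `C` the complementary set, optimality gives `(a - 1)|M| ≤ |A + B| -
|B| = |G| - |B| - |C| ≤ |G| - 2|A|`, and `|A| > (a - 1)|M|`. This uses that `A` is a smallest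
member, and it supplies the half-size condition in Vosper's theorem. -/
theorem Good.three_mul_card_proj_le {A B W : Finset G} (h : Good A M) (hW : ∀ z, z ∈ W)
    (hB : B.Nonempty) (hz : ∃ z, z ∉ A + B) (hAB : #A ≤ #B) (hAC : #A ≤ #(codiff W A B)) :
    3 * #(proj M A) ≤ #(proj M W) + 2 := by
  have h1 := h.card_le B hB hz
  have h2 := card_codiff (A := A) (X := B) hW
  have h3 := card_le_card_proj_mul (M := M) W
  have h4 := h.card_lt
  rw [card_add_elems] at h1 h4
  by_contra! hcon
  have h5 := Nat.mul_le_mul_right #(elems M) (show #(proj M W) + 3 ≤ _ from hcon)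
  rw [add_mul, mul_assoc] at h5
  omega

theorem mem_codiff_fill {W A B S : Finset G} (hW : ∀ z, z ∈ W) {y : G} :
    y ∈ codiff W A (B ∪ (S + elems M)) ↔
      -y ∉ A + B ∧ -(y : G ⧸ M) ∉ proj M A + proj M S := by
  rw [mem_codiff hW, add_union, mem_union, not_or, ← add_assoc, mem_add_elems, proj_add,
    QuotientAddGroup.mk_neg]

/-- Completing cosets keeps the excess below `|A|`, and so does passing to the complementary set.
These sets replace `B` when `proj M A + proj M B` is too large. -/
theorem Good.card_add_codiff_fill_lt {W A B S : Finset G} (h : Good A M) (hW : ∀ z, z ∈ W)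
    (hS : S ⊆ B) (hlt : #(A + B) < #A + #B) :
    #(A + codiff W A (B ∪ (S + elems M))) < #A + #(codiff W A (B ∪ (S + elems M))) := by
  have h1 := h.card_fill B hS
  have h2 := card_add_codiff (A := A) (X := B ∪ (S + elems M)) hW
  have h3 := card_codiff (A := A) (X := B ∪ (S + elems M)) hW
  omega

theorem neg_notMem_proj_add_codiff_fill {W A B S : Finset G} (hW : ∀ z, z ∈ W) {s : G ⧸ M}
    (hs : s ∈ proj M S) : -s ∉ proj M A + proj M (codiff W A (B ∪ (S + elems M))) := by
  intro hmem
  obtain ⟨a, ha, y, hy, hay⟩ := mem_add.1 hmem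
  obtain ⟨z, hz, rfl⟩ := mem_proj.1 hy
  refine ((mem_codiff_fill hW).1 hz).2 (mem_add.2 ⟨a, ha, s, hs, ?_⟩)
  rw [← neg_inj, neg_neg, neg_add, ← hay]
  abel

/-- `A + B` already contains `b + A`, so completing the coset of `b` adds at most `|A + M| - |A|`
sums. -/
theorem card_codiff_le_card_codiff_fill {W A B : Finset G} (hW : ∀ z, z ∈ W) {b : G}
    (hb : b ∈ B) : #(codiff W A B) + #A ≤
      #(codiff W A (B ∪ ({b} + elems M))) + #(A + elems M) := by
  have h1 := card_codiff (A := A) (X := B) hW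
  have h2 := card_codiff (A := A) (X := B ∪ ({b} + elems M)) hW
  have h3 := card_inter_add_card_union (A + B) (b +ᵥ (A + elems M))
  have h4 : A + (B ∪ ({b} + elems M)) = (A + B) ∪ (b +ᵥ (A + elems M)) := by
    rw [singleton_add, add_union, ← add_vadd_finset]
  have h5 : b +ᵥ A ⊆ (A + B) ∩ (b +ᵥ (A + elems M)) := by
    refine subset_inter (vadd_subset_add hb) (vadd_finset_subset_vadd_finset fun x hx => ?_)
    exact mem_add.2 ⟨x, hx, 0, by simp, add_zero x⟩
  have h6 := card_le_card h5
  rw [card_vadd_finset] at h3 h6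
  rw [h4] at h2
  omega

theorem mem_proj_univ {W : Finset G} (hW : ∀ z, z ∈ W) (c : G ⧸ M) : c ∈ proj M W := by
  induction c using QuotientAddGroup.induction_on with
  | H b => exact mk_mem_proj (hW b)

theorem exists_univ_of_proj {V : Finset (G ⧸ M)} (hV : ∀ c, c ∈ V) : ∃ W : Finset G, ∀ z, z ∈ W :=
  ⟨V.image Quotient.out + elems M, fun z => mem_add.2 ⟨Quotient.out (z : G ⧸ M),
    mem_image_of_mem _ (hV _), z - Quotient.out (z : G ⧸ M), mem_elems.2
      (mk_eq_mk_iff.1 (QuotientAddGroup.out_eq' (z : G ⧸ M)).symm), by abel⟩⟩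

theorem card_le_card_add_one_of_unique {α : Type*} [DecidableEq α] {V X : Finset α}
    (hu : ∀ z₁ ∈ V, ∀ z₂ ∈ V, z₁ ∉ X → z₂ ∉ X → z₁ = z₂) : #V ≤ #X + 1 := by
  have : #(V \ X) ≤ 1 := card_le_one.2 fun a ha b hb =>
    hu a (mem_sdiff.1 ha).1 b (mem_sdiff.1 hb).1 (mem_sdiff.1 ha).2 (mem_sdiff.1 hb).2
  have := le_card_sdiff X V
  omega

/-- `proj M B` serves if its sum misses two cosets. Otherwise the group is finite, and the
complementary set is taken after completing one or two cosets of `B`: each completed coset `b + M`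
makes its sum with `A` avoid `-b + M`. -/
theorem Good.exists_frag {A B : Finset G} (h : Good A M) (ha : 3 ≤ #(proj M A))
    (hB : B.Nonempty) (hz : ∃ z, z ∉ A + B) (hlt : #(A + B) < #A + #B) (hAB : #A ≤ #B)
    (hAC : ∀ W : Finset G, (∀ z, z ∈ W) → #A ≤ #(codiff W A B)) :
    ∃ X, Frag (proj M A) X := by
  have hA1 := h.card_lt
  rw [card_add_elems] at hA1
  have two_le : ∀ Y : Finset G, 2 * #A ≤ #Y + #(proj M A) * #(elems M) → 2 ≤ #(proj M Y) := by
    intro Y hY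
    have h1 := card_le_card_proj_mul (M := M) Y
    by_contra! hcon
    have h2 := Nat.mul_le_mul_right #(elems M) (show #(proj M Y) ≤ 1 by omega)
    have h3 := Nat.mul_le_mul_right #(elems M) ha
    omega
  by_cases hmB : ∃ z₁ z₂, z₁ ≠ z₂ ∧ z₁ ∉ proj M A + proj M B ∧ z₂ ∉ proj M A + proj M B
  · refine ⟨proj M B, two_le B ?_, hmB, h.card_proj_add_lt hlt⟩
    have := card_le_card_proj_mul (M := M) A
    omega
  have hu : ∀ X : Finset (G ⧸ M), (¬ ∃ z₁ z₂, z₁ ≠ z₂ ∧ z₁ ∉ X ∧ z₂ ∉ X) →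
      ∀ z₁ z₂, z₁ ∉ X → z₂ ∉ X → z₁ = z₂ := by
    intro X hX z₁ z₂ h₁ h₂
    by_contra hne
    exact hX ⟨z₁, z₂, hne, h₁, h₂⟩
  have huB := hu _ hmB
  obtain ⟨W, hW⟩ : ∃ W : Finset G, ∀ z, z ∈ W := by
    by_cases hc : ∃ c, c ∉ proj M A + proj M B
    · obtain ⟨c, hc⟩ := hc
      refine exists_univ_of_proj (V := insert c (proj M A + proj M B)) fun d => ?_
      by_cases hd : d ∈ proj M A + proj M B
      · exact mem_insert_of_mem hd
      · rw [huB d c hd hc]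
        exact mem_insert_self _ _
    · push Not at hc
      exact exists_univ_of_proj hc
  have hn := h.three_mul_card_proj_le hW hB hz hAB (hAC W hW)
  have hnB := card_le_card_add_one_of_unique (V := proj M W) fun z₁ _ z₂ _ => huB z₁ z₂
  have hltB := h.card_proj_add_lt hlt
  -- The cosets `b`, `b'` are chosen with overlapping translates of `proj M A`, so that completing
  -- the second removes at most `a - 1` further cosets, `a = |proj M A|`. They exist because `proj M
  -- B` covers more than half of the quotient. In the last case at least `n - 2a + 1 ≥ a - 1 ≥ 2` of
  -- the `n` cosets remain.
  obtain ⟨b, hb, b', hb', hne, x, hx, hx'⟩ : ∃ b ∈ B, ∃ b' ∈ B, (b : G ⧸ M) ≠ b' ∧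
      ∃ x, x ∈ proj M A + {(b : G ⧸ M)} ∧ x ∈ proj M A + {(b' : G ⧸ M)} := by
    obtain ⟨a, ha, a', ha', haa⟩ := one_lt_card.1 (show 1 < #(proj M A) by omega)
    obtain ⟨c, hc⟩ : (proj M B ∩ ((a - a') +ᵥ proj M B)).Nonempty := by
      rw [nonempty_iff_ne_empty]
      intro he
      have h1 := card_inter_add_card_union (proj M B) ((a - a') +ᵥ proj M B)
      have h2 := card_le_card (fun x _ => mem_proj_univ hW x :
        proj M B ∪ ((a - a') +ᵥ proj M B) ⊆ proj M W)
      rw [he, card_vadd_finset, card_empty] at h1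
      omega
    obtain ⟨hc1, hc2⟩ := mem_inter.1 hc
    obtain ⟨d, hd, rfl⟩ := mem_vadd_finset.1 hc2
    obtain ⟨b, hb, hbc⟩ := mem_proj.1 hc1
    obtain ⟨b', hb', rfl⟩ := mem_proj.1 hd
    have e : (b : G ⧸ M) = a - a' + b' := hbc
    refine ⟨b, hb, b', hb', ?_, a + b', ?_, ?_⟩
    · rw [e]
      intro h0
      rw [add_eq_right, sub_eq_zero] at h0
      exact haa h0
    · exact mem_add.2 ⟨a', ha', _, mem_singleton_self _, by rw [e]; abel⟩
    · exact mem_add.2 ⟨a, ha, _, mem_singleton_self _, rfl⟩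
  have hpb : proj M {b} = {(b : G ⧸ M)} := image_singleton _ _
  set Y := codiff W A (B ∪ ({b} + elems M)) with hY
  have hY2 : 2 ≤ #(proj M Y) := by
    apply two_le
    have h1 := card_codiff_le_card_codiff_fill (A := A) (M := M) hW hb
    have h2 := hAC W hW
    rw [card_add_elems, ← hY] at h1
    omega
  have hYlt := h.card_proj_add_lt
    (h.card_add_codiff_fill_lt hW (singleton_subset_iff.2 hb) hlt)
  rw [← hY] at hYlt
  by_cases hmY : ∃ z₁ z₂, z₁ ≠ z₂ ∧ z₁ ∉ proj M A + proj M Y ∧ z₂ ∉ proj M A + proj M Y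
  · exact ⟨proj M Y, hY2, hmY, hYlt⟩
  have hnY := card_le_card_add_one_of_unique (V := proj M W) fun z₁ _ z₂ _ => hu _ hmY z₁ z₂
  set Z := codiff W A (B ∪ (({b, b'} : Finset G) + elems M)) with hZ
  have hpbb : proj M {b, b'} = {(b : G ⧸ M), (b' : G ⧸ M)} := by
    rw [proj, image_insert, image_singleton]
    rfl
  refine ⟨proj M Z, ?_, ⟨-(b : G ⧸ M), -(b' : G ⧸ M), fun he => hne (neg_inj.1 he), ?_, ?_⟩, ?_⟩
  · have hsub : proj M Y ⊆ proj M Z ∪ ((proj M A + {(b' : G ⧸ M)}).erase x).image fun c => -c := by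
      intro c hc
      obtain ⟨y, hy, rfl⟩ := mem_proj.1 hc
      obtain ⟨hy1, hy2⟩ := (mem_codiff_fill hW).1 hy
      rw [hpb] at hy2
      by_cases hyb : -(y : G ⧸ M) ∈ proj M A + {(b' : G ⧸ M)}
      · refine mem_union_right _ (mem_image.2 ⟨_, mem_erase.2 ⟨?_, hyb⟩, neg_neg _⟩)
        rintro rfl
        exact hy2 hx
      · refine mem_union_left _ (mk_mem_proj ((mem_codiff_fill hW).2 ⟨hy1, ?_⟩))
        rw [hpbb, insert_eq, add_union, mem_union, not_or]
        exact ⟨hy2, hyb⟩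
    have h1 := card_le_card hsub
    have h2 := card_union_le (proj M Z) (((proj M A + {(b' : G ⧸ M)}).erase x).image fun c => -c)
    rw [card_image_of_injective _ neg_injective, card_erase_of_mem hx',
      card_add_singleton] at h2
    omega
  · exact neg_notMem_proj_add_codiff_fill hW (by rw [hpbb]; simp)
  · exact neg_notMem_proj_add_codiff_fill hW (by rw [hpbb]; simp)
  · exact h.card_proj_add_lt (h.card_add_codiff_fill_lt hW
      (insert_subset_iff.2 ⟨hb, singleton_subset_iff.2 hb'⟩) hlt)

theorem Good.exists_proj_eq_ap {A B : Finset G} (h : Good A M) (hA : Spans (A : Set G))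
    (hB : B.Nonempty) (hz : ∃ z, z ∉ A + B) (hlt : #(A + B) < #A + #B) (hAB : #A ≤ #B)
    (hAC : ∀ W : Finset G, (∀ z, z ∈ W) → #A ≤ #(codiff W A B)) :
    ∃ x₀ r, proj M A = ap x₀ r #(proj M A) ∧ AddSubgroup.zmultiples r = ⊤ := by
  have ha := h.two_le_card_proj hA
  suffices ∃ x₀ r, proj M A = ap x₀ r #(proj M A) by
    obtain ⟨x₀, r, he⟩ := this
    have hs := hA.proj (M := M)
    rw [he] at hs
    exact ⟨x₀, r, he, hs.zmultiples_eq_top⟩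
  rcases ha.eq_or_lt with ha2 | ha3
  · obtain ⟨x, y, hxy, he⟩ := card_eq_two.1 ha2.symm
    refine ⟨x, y - x, ?_⟩
    rw [← ha2, he]
    ext c
    rw [mem_ap, mem_insert, mem_singleton]
    constructor
    · rintro (rfl | rfl)
      · exact ⟨0, by omega, by simp⟩
      · exact ⟨1, by omega, by simp⟩
    · rintro ⟨j, hj, rfl⟩
      interval_cases j
      · simp
      · simp
  · refine eq_ap_of_frag h.nType ha hA.proj ?_ (h.exists_frag ha3 hB hz hlt hAB hAC)
    intro hfin
    have := Fintype.ofFinite (G ⧸ M)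
    obtain ⟨W, hW⟩ := exists_univ_of_proj (M := M) (V := univ) fun c => mem_univ c
    have h1 := h.three_mul_card_proj_le hW hB hz hAB (hAC W hW)
    have h2 : proj M W = univ := eq_univ_of_forall fun c => mem_proj_univ hW c
    rw [h2, card_univ, ← Nat.card_eq_fintype_card] at h1
    omega

/-- A set which projects to a progression of length `p + 1`. -/
theorem Good.eq_ap_succ {A X : Finset G} (h : Good A M) {x₀ r : G ⧸ M}
    (ha : 2 ≤ #(proj M A)) (hA : proj M A = ap x₀ r #(proj M A))
    (hr : AddSubgroup.zmultiples r = ⊤) (hX : 2 ≤ #(proj M X))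
    (hz : ∃ z, z ∉ proj M A + proj M X) (hlt : #(A + X) < #A + #X) :
    ∃ p q y₀, 1 ≤ p ∧ 1 ≤ q ∧ #(proj M A) = p + 1 ∧ #(proj M X) = q + 1 ∧
      proj M A = ap x₀ r (p + 1) ∧ proj M X = ap y₀ r (q + 1) := by
  have h1 := h.card_proj_add_lt hlt
  rw [hA] at hz
  have h1' : #(ap x₀ r #(proj M A) + proj M X) < #(proj M A) + #(proj M X) := by
    rw [← hA]; exact h1
  obtain ⟨y₀, hy⟩ := eq_ap_of_card_ap_add_lt ha hr (card_pos.1 (by omega)) hz h1'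
  refine ⟨#(proj M A) - 1, #(proj M X) - 1, y₀, by omega, by omega, by omega, by omega, ?_, ?_⟩
  · rwa [Nat.sub_add_cancel (by omega)]
  · rwa [Nat.sub_add_cancel (by omega)]

/-- One of the sums `A + B`, `A + C` does not meet every coset of `M`. -/
theorem Good.exists_notMem_proj_add {A B W : Finset G} (h : Good A M) (hW : ∀ z, z ∈ W)
    (hA : Spans (A : Set G)) (hB : B.Nonempty) (hz : ∃ z, z ∉ A + B)
    (hlt : #(A + B) < #A + #B) (hAB : #A ≤ #B) (hAC : #A ≤ #(codiff W A B)) :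
    (∃ z, z ∉ proj M A + proj M B) ∨ ∃ z, z ∉ proj M A + proj M (codiff W A B) := by
  by_contra! hcon
  obtain ⟨hQB, hQC⟩ := hcon
  have hAC' : ∀ W : Finset G, (∀ z, z ∈ W) → #A ≤ #(codiff W A B) := by
    intro V hV
    have : V = W := by ext x; simp [hV, hW]
    rwa [this]
  obtain ⟨x₀, r, hAap, hr⟩ := h.exists_proj_eq_ap hA hB hz hlt hAB hAC'
  have ha := h.two_le_card_proj hA
  have hn := h.three_mul_card_proj_le hW hB hz hAB hAC
  have hltB := h.card_proj_add_lt hlt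
  have hltC := h.card_proj_add_lt (B := codiff W A B) (by
    have := card_codiff (A := A) (X := B) hW
    have := card_add_codiff (A := A) (X := B) hW
    omega)
  have huniv : ∀ X : Finset (G ⧸ M), (∀ c, c ∈ X) → X = proj M W := fun X hX => by
    ext c
    exact ⟨fun _ => mem_proj_univ hW c, fun _ => hX c⟩
  rw [huniv _ hQB] at hltB
  rw [huniv _ hQC] at hltC
  -- If the complementary set misses an `M`-coset `y`, then `b` is chosen so that `-y` lies over `A
  -- + b`: one removal is then free, and it is needed when `|proj M A| = 2`.
  obtain ⟨b, hb, hY2⟩ : ∃ b ∈ B, 2 ≤ #(proj M (codiff W A (B ∪ ({b} + elems M)))) := by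
    have hsub : ∀ b : G, proj M (codiff W A B) \ (proj M A + {(b : G ⧸ M)}).image (fun c => -c) ⊆
        proj M (codiff W A (B ∪ ({b} + elems M))) := by
      intro b c hc
      obtain ⟨hc1, hc2⟩ := mem_sdiff.1 hc
      obtain ⟨y, hy, rfl⟩ := mem_proj.1 hc1
      refine mk_mem_proj ((mem_codiff_fill hW).2 ⟨(mem_codiff hW).1 hy, fun hmem => hc2 ?_⟩)
      exact mem_image.2 ⟨_, by simpa [proj] using hmem, neg_neg _⟩
    by_cases hC : ∃ y, y ∉ proj M (codiff W A B)
    · obtain ⟨y, hy⟩ := hC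
      obtain ⟨c, hc, d, hd, hcd⟩ := mem_add.1 (hQB (-y))
      obtain ⟨b, hb, rfl⟩ := mem_proj.1 hd
      refine ⟨b, hb, le_trans ?_ (card_le_card (hsub b))⟩
      have hymem : y ∈ (proj M A + {(b : G ⧸ M)}).image fun c => -c :=
        mem_image.2 ⟨-y, mem_add.2 ⟨c, hc, _, mem_singleton_self _, hcd⟩, neg_neg y⟩
      have e : proj M (codiff W A B) \ (proj M A + {(b : G ⧸ M)}).image (fun c => -c) =
          proj M (codiff W A B) \ ((proj M A + {(b : G ⧸ M)}).image (fun c => -c)).erase y := by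
        ext c
        simp only [mem_sdiff, mem_erase, not_and]
        constructor
        · rintro ⟨h1, h2⟩
          exact ⟨h1, fun _ => h2⟩
        · rintro ⟨h1, h2⟩
          refine ⟨h1, h2 ?_⟩
          rintro rfl
          exact hy h1
      have h1 := le_card_sdiff (((proj M A + {(b : G ⧸ M)}).image fun c => -c).erase y)
        (proj M (codiff W A B))
      rw [card_erase_of_mem hymem, card_image_of_injective _ neg_injective,
        card_add_singleton] at h1
      rw [e]
      omega
    · push Not at hC
      obtain ⟨b, hb⟩ := hB
      refine ⟨b, hb, le_trans ?_ (card_le_card (hsub b))⟩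
      have h1 := le_card_sdiff ((proj M A + {(b : G ⧸ M)}).image fun c => -c)
        (proj M (codiff W A B))
      rw [card_image_of_injective _ neg_injective, card_add_singleton, huniv _ hC] at h1
      rw [huniv _ hC]
      omega
  set Y := codiff W A (B ∪ ({b} + elems M)) with hY
  have hYlt := h.card_add_codiff_fill_lt hW (singleton_subset_iff.2 hb) hlt
  have hYz : ∃ z, z ∉ proj M A + proj M Y :=
    ⟨_, neg_notMem_proj_add_codiff_fill hW (mk_mem_proj (mem_singleton_self b))⟩
  obtain ⟨p, q, y₀, hp, hq, hpa, hqy, hAp, hYq⟩ := h.eq_ap_succ ha hAap hr hY2 hYz hYlt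
  have hYC : Y ⊆ codiff W A B := fun y hy =>
    (mem_codiff hW).2 ((mem_codiff_fill hW).1 hy).1
  have hcard : #(proj M A + proj M Y) = p + q + 1 := by
    have e := ap_add_ap x₀ y₀ r p q
    rw [hAp, hYq, e] at hYz
    rw [hAp, hYq, e, ap, card_image_of_injOn, card_range]
    intro i hi j hj hij
    exact injOn_of_notMem_ap hr hYz i (by simpa using hi) j (by simpa using hj) hij
  obtain ⟨e, he⟩ : ∃ e, ∀ w : G, (w : G ⧸ M) ∈ proj M A + proj M Y → (w : G ⧸ M) ≠ e →
      w ∈ A + Y := by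
    rcases h.full_off_end hp hq hr hAp hYq hYz hYlt with h | h
    · exact ⟨_, h⟩
    · exact ⟨_, h⟩
  -- `-B` avoids `A + Y`, which fills all its cosets but one. So the cosets of `-B` and of `A + Y`
  -- share at most one, and as `|proj M B| > |G/M| - |proj M A|` this leaves `|proj M Y| ≤ 1`.
  have hinter : (proj M A + proj M Y) ∩ (proj M B).image (fun c => -c) ⊆ {e} := by
    intro c hc
    obtain ⟨hc1, hc2⟩ := mem_inter.1 hc
    obtain ⟨d, hd, rfl⟩ := mem_image.1 hc2
    obtain ⟨β, hβ, rfl⟩ := mem_proj.1 hd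
    rw [mem_singleton]
    by_contra hne
    exact neg_notMem_add_codiff hW hβ (add_subset_add_left hYC (he (-β) hc1 hne))
  have h1 := card_le_card hinter
  have h2 := card_inter_add_card_union (proj M A + proj M Y) ((proj M B).image fun c => -c)
  have h3 := card_le_card (fun x _ => mem_proj_univ hW x :
    (proj M A + proj M Y) ∪ (proj M B).image (fun c => -c) ⊆ proj M W)
  rw [card_image_of_injective _ neg_injective] at h2
  rw [card_singleton] at h1
  omega

end Progression

/-! ### One step of the decomposition: a beat or a chord -/

section Step

variable {G : Type*} [AddCommGroup G]

theorem mem_third {K : AddSubgroup G} {A B : Set G} {c : G} :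
    c ∈ third K A B ↔ c ∈ K ∧ -c ∉ A + B := by
  rw [third, Set.mem_sdiff, Set.mem_neg, SetLike.mem_coe]

theorem similar_rotate {K : AddSubgroup G} (A B C : Set G) : Similar K ⟨A, B, C⟩ ⟨B, C, A⟩ :=
  (Relation.ReflTransGen.single (SimilarStep.swapAB A B C)).tail (SimilarStep.swapBC B A C)

theorem similar_vadd {K : AddSubgroup G} {u v : G} (hu : u ∈ K) (hv : v ∈ K) (A B C : Set G) :
    Similar K ⟨A, B, C⟩ ⟨u +ᵥ A, v +ᵥ B, (-(u + v)) +ᵥ C⟩ := by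
  have h1 := SimilarStep.translate A B C u hu
  have h2 := SimilarStep.translate ((-u) +ᵥ B) C (u +ᵥ A) (u + v) (K.add_mem hu hv)
  have h3 := similar_rotate (K := K) (u +ᵥ A) ((-u) +ᵥ B) C
  have h4 : (u + v) +ᵥ ((-u) +ᵥ B) = v +ᵥ B := by
    rw [vadd_vadd]; congr 1; abel
  rw [h4] at h2
  exact ((Relation.ReflTransGen.single h1).trans (h3.tail h2)).trans
    ((similar_rotate _ _ _).trans (similar_rotate _ _ _))

theorem third_vadd {K : AddSubgroup G} {u v : G} (hu : u ∈ K) (hv : v ∈ K) (A B : Set G) :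
    third K (u +ᵥ A) (v +ᵥ B) = (-(u + v)) +ᵥ third K A B := by
  ext c
  rw [Set.mem_vadd_set_iff_neg_vadd_mem, mem_third, mem_third, neg_neg, vadd_add_assoc,
    add_vadd_comm, vadd_vadd, Set.mem_vadd_set_iff_neg_vadd_mem, vadd_eq_add, vadd_eq_add,
    ← neg_add, K.add_mem_cancel_left (K.add_mem hu hv)]

variable [DecidableEq G]

/-- `T` is similar to the trio formed by a maximal critical pair of finite sets. -/
structure Config (T : Triple G) (A B : Finset G) : Prop where
  similar : Similar ⊤ T ⟨A, B, third ⊤ A B⟩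
  maxPair : MaxPair A B

theorem MaxPair.vadd {A B : Finset G} (h : MaxPair A B) (u v : G) :
    MaxPair (u +ᵥ A) (v +ᵥ B) := by
  have e : (u +ᵥ A) + (v +ᵥ B) = (u + v) +ᵥ (A + B) := by
    rw [vadd_add_assoc, add_vadd_comm, vadd_vadd]
  refine ⟨h.nonempty_left.vadd_finset, h.nonempty_right.vadd_finset, ?_, ?_, ?_, ?_⟩
  · obtain ⟨z, hz⟩ := h.exists_notMem
    exact ⟨(u + v) +ᵥ z, by rwa [e, vadd_mem_vadd_finset_iff]⟩
  · rw [e, card_vadd_finset, card_vadd_finset, card_vadd_finset]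
    exact h.card_lt
  · intro x hx
    rw [← neg_vadd_mem_iff]
    refine h.max_left _ fun b hb => ?_
    have := hx (v +ᵥ b) (vadd_mem_vadd_finset_iff _ |>.2 hb)
    rw [e, ← neg_vadd_mem_iff] at this
    convert this using 1
    simp only [vadd_eq_add]
    abel
  · intro x hx
    rw [← neg_vadd_mem_iff]
    refine h.max_right _ fun b hb => ?_
    have := hx (u +ᵥ b) (vadd_mem_vadd_finset_iff _ |>.2 hb)
    rw [e, ← neg_vadd_mem_iff] at this
    convert this using 1
    simp only [vadd_eq_add]
    abel

theorem Config.vadd {T : Triple G} {A B : Finset G} (h : Config T A B) (u v : G) :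
    Config T (u +ᵥ A) (v +ᵥ B) := by
  refine ⟨h.similar.trans ?_, h.maxPair.vadd u v⟩
  rw [coe_vadd_finset, coe_vadd_finset, third_vadd (AddSubgroup.mem_top _) (AddSubgroup.mem_top _)]
  exact similar_vadd (AddSubgroup.mem_top _) (AddSubgroup.mem_top _) _ _ _

theorem coe_codiff {A B W : Finset G} (hW : ∀ z, z ∈ W) :
    (codiff W A B : Set G) = third ⊤ (A : Set G) B := by
  ext c
  rw [mem_coe, mem_codiff hW, mem_third, ← coe_add, mem_coe]
  simp

theorem MaxPair.codiff {A B W : Finset G} (h : MaxPair A B) (hW : ∀ z, z ∈ W) :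
    MaxPair A (codiff W A B) := by
  have hneg : ∀ w, w ∉ A + B → -w ∈ Kemperman.codiff W A B := fun w hw =>
    (mem_codiff hW).2 (by rwa [neg_neg])
  have h1 := card_codiff (A := A) (X := B) hW
  have h2 := card_add_codiff (A := A) (X := B) hW
  have h3 := h.card_lt
  refine ⟨h.nonempty_left, ?_, ?_, by omega, ?_, ?_⟩
  · obtain ⟨z, hz⟩ := h.exists_notMem
    exact ⟨-z, hneg z hz⟩
  · obtain ⟨b, hb⟩ := h.nonempty_right
    exact ⟨-b, neg_notMem_add_codiff hW hb⟩
  · intro x hx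
    refine h.max_left _ fun b hb => ?_
    by_contra hcon
    have := hx _ (hneg _ hcon)
    rw [neg_add, add_neg_cancel_left] at this
    exact neg_notMem_add_codiff hW hb this
  · intro y hy
    rw [mem_codiff hW]
    intro hmem
    obtain ⟨a, ha, b, hb, hab⟩ := mem_add.1 hmem
    have := hy a ha
    have e : a + y = -b := by rw [← neg_neg y, ← hab]; abel
    rw [e] at this
    exact neg_notMem_add_codiff hW hb this

theorem MaxPair.codiff_codiff {A B W : Finset G} (h : MaxPair A B) (hW : ∀ z, z ∈ W) :
    Kemperman.codiff W A (Kemperman.codiff W A B) = B := by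
  ext y
  rw [mem_codiff hW]
  constructor
  · intro hy
    refine h.max_right _ fun a ha => ?_
    by_contra hcon
    apply hy
    refine mem_add.2 ⟨a, ha, -(a + y), (mem_codiff hW).2 (by rwa [neg_neg]), by abel⟩
  · exact fun hy => neg_notMem_add_codiff hW hy

theorem Config.codiff {T : Triple G} {A B W : Finset G} (h : Config T A B) (hW : ∀ z, z ∈ W) :
    Config T A (codiff W A B) := by
  refine ⟨h.similar.trans ?_, h.maxPair.codiff hW⟩
  rw [← coe_codiff hW, ← coe_codiff hW, h.maxPair.codiff_codiff hW]
  exact Relation.ReflTransGen.single (SimilarStep.swapBC _ _ _)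

/-- The image of a triple under a map. -/
def Triple.map {G' : Type*} (f : G → G') (T : Triple G) : Triple G' :=
  ⟨f '' T.A, f '' T.B, f '' T.C⟩

/-- The sizes of two sets, with `1` added for each of them that does not span the group. -/
noncomputable def pairSize (A B : Finset G) : ℕ :=
  open Classical in
  #A + (if Spans (A : Set G) then 0 else 1) + (#B + if Spans (B : Set G) then 0 else 1)

/-- The part of a finite set in a subgroup, as a subset of this subgroup. -/
noncomputable def restrict (H : AddSubgroup G) (A : Finset G) : Finset H :=
  A.preimage Subtype.val Subtype.val_injective.injOn

/-- `T` is a pure beat or a pure chord, or an impure one whose continuation comes from a maximal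
critical pair; this pair is of size less than `n`, unless it lies in a finite group. -/
def IsBeatOrChord (T : Triple G) (n : ℕ) : Prop :=
  (∃ H, IsPureBeat ⊤ H T ∨ IsPureChord ⊤ H T) ∨
    ∃ (H : AddSubgroup G) (A B : Finset H), MaxPair A B ∧ (Finite H ∨ pairSize A B < n) ∧
      (IsImpureBeat ⊤ H T (Triple.map Subtype.val ⟨A, B, third ⊤ (A : Set H) B⟩) ∨
        IsImpureChord ⊤ H T (Triple.map Subtype.val ⟨A, B, third ⊤ (A : Set H) B⟩))

theorem mem_restrict {H : AddSubgroup G} {A : Finset G} {x : H} :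
    x ∈ restrict H A ↔ (x : G) ∈ A := mem_preimage

theorem image_restrict (H : AddSubgroup G) (A : Finset G) :
    Subtype.val '' (restrict H A : Set H) = (A : Set G) ∩ H := by
  rw [restrict, coe_preimage, Set.inter_comm]
  exact Subtype.image_preimage_coe (H : Set G) A

open Classical in
theorem card_restrict_add (H : AddSubgroup G) (A : Finset G) :
    #(restrict H A) + #(A.filter (· ∉ H)) = #A := by
  have : #(restrict H A) = #(A.filter (· ∈ H)) := by
    rw [← card_image_of_injective (restrict H A) Subtype.val_injective]
    congr 1
    ext x
    rw [mem_image, mem_filter]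
    constructor
    · rintro ⟨y, hy, rfl⟩
      exact ⟨mem_restrict.1 hy, y.2⟩
    · exact fun hx => ⟨⟨x, hx.2⟩, mem_restrict.2 hx.1, rfl⟩
  rw [this, card_filter_add_card_filter_not]

section Restrict

variable {H : AddSubgroup G} {A B : Finset G}

theorem restrict_add (hsum : ∀ a ∈ A, ∀ b ∈ B, a + b ∈ H → a ∈ H ∧ b ∈ H) :
    restrict H A + restrict H B = restrict H (A + B) := by
  ext x
  rw [mem_add, mem_restrict, mem_add]
  constructor
  · rintro ⟨a, ha, b, hb, rfl⟩
    exact ⟨a, mem_restrict.1 ha, b, mem_restrict.1 hb, rfl⟩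
  · rintro ⟨a, ha, b, hb, hab⟩
    obtain ⟨haH, hbH⟩ := hsum a ha b hb (hab ▸ x.2)
    exact ⟨⟨a, haH⟩, mem_restrict.2 ha, ⟨b, hbH⟩, mem_restrict.2 hb, Subtype.ext hab⟩

theorem map_restrict (hsum : ∀ a ∈ A, ∀ b ∈ B, a + b ∈ H → a ∈ H ∧ b ∈ H) :
    Triple.map Subtype.val ⟨restrict H A, restrict H B,
      third ⊤ (restrict H A : Set H) (restrict H B)⟩ =
        ⟨(A : Set G) ∩ H, (B : Set G) ∩ H, third ⊤ (A : Set G) B ∩ H⟩ := by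
  refine Triple.ext (image_restrict H A) (image_restrict H B) ?_
  ext c
  change c ∈ Subtype.val '' third ⊤ (restrict H A : Set H) (restrict H B) ↔ _
  have key : ∀ x : H, x ∈ third ⊤ (restrict H A : Set H) (restrict H B) ↔
      (x : G) ∈ third ⊤ (A : Set G) B := fun x => by
    rw [mem_third, mem_third, ← coe_add, ← coe_add, mem_coe, mem_coe, restrict_add hsum,
      mem_restrict, AddSubgroup.coe_neg]
    simp
  constructor
  · rintro ⟨x, hx, rfl⟩
    exact ⟨(key x).1 hx, x.2⟩
  · exact fun hc => ⟨⟨c, hc.2⟩, (key _).2 hc.1, rfl⟩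

open Classical in
-- `hsum` makes the `H`-part of the sum the sum of the `H`-parts, `hcard` keeps it critical, and
-- `hoffA`, `hoffB` say that elements off `H` impose no condition on extensions inside `H`, so
-- maximality is inherited.
theorem MaxPair.restrict (h : MaxPair A B) (hA : ∃ a ∈ A, a ∈ H) (hB : ∃ b ∈ B, b ∈ H)
    (hz : ∃ z ∈ H, z ∉ A + B) (hsum : ∀ a ∈ A, ∀ b ∈ B, a + b ∈ H → a ∈ H ∧ b ∈ H)
    (hcard : #(A.filter (· ∉ H)) + #(B.filter (· ∉ H)) ≤ #((A + B).filter (· ∉ H)))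
    (hoffA : ∀ a ∈ A, a ∉ H → ∀ y ∈ H, a + y ∈ A + B)
    (hoffB : ∀ b ∈ B, b ∉ H → ∀ x ∈ H, x + b ∈ A + B) :
    MaxPair (restrict H A) (restrict H B) := by
  refine ⟨?_, ?_, ?_, ?_, ?_, ?_⟩
  · obtain ⟨a, ha, haH⟩ := hA
    exact ⟨⟨a, haH⟩, mem_restrict.2 ha⟩
  · obtain ⟨b, hb, hbH⟩ := hB
    exact ⟨⟨b, hbH⟩, mem_restrict.2 hb⟩
  · obtain ⟨z, hzH, hz⟩ := hz
    exact ⟨⟨z, hzH⟩, by rwa [restrict_add hsum, mem_restrict]⟩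
  · rw [restrict_add hsum]
    have h1 := card_restrict_add H A
    have h2 := card_restrict_add H B
    have h3 := card_restrict_add H (A + B)
    have h4 := h.card_lt
    omega
  · intro x hx
    rw [restrict_add hsum] at hx
    refine mem_restrict.2 (h.max_left x fun b hb => ?_)
    by_cases hbH : b ∈ H
    · exact mem_restrict.1 (hx ⟨b, hbH⟩ (mem_restrict.2 hb))
    · exact hoffB b hb hbH x x.2
  · intro y hy
    rw [restrict_add hsum] at hy
    refine mem_restrict.2 (h.max_right y fun a ha => ?_)
    by_cases haH : a ∈ H
    · exact mem_restrict.1 (hy ⟨a, haH⟩ (mem_restrict.2 ha))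
    · exact hoffA a ha haH y y.2

end Restrict

theorem Spans.vadd {S : Set G} (h : Spans S) (u : G) : Spans (u +ᵥ S) := by
  intro L g hL
  refine h L (g - u) fun x hx => ?_
  have := hL (u +ᵥ x) (Set.vadd_mem_vadd_set hx)
  rwa [vadd_eq_add, add_comm, ← sub_sub_eq_add_sub] at this

theorem mem_third_coe {A B : Finset G} {c : G} :
    c ∈ third ⊤ (A : Set G) B ↔ -c ∉ A + B := by
  rw [mem_third, ← coe_add, mem_coe]
  simp

/-- The two alternatives of `MaxPair.periodic_off_coset` are the pure and the impure beat. In the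
second one `B` is translated so that the exceptional coset becomes `H`. -/
theorem Config.isBeatOrChord_of_closure_ne_top {T : Triple G} {A B : Finset G}
    (h : Config T A B) (h0 : (0 : G) ∈ A) (hne : AddSubgroup.closure (A : Set G) ≠ ⊤) :
    IsBeatOrChord T (pairSize A B) := by
  classical
  set H := AddSubgroup.closure (A : Set G) with hH
  rcases h.maxPair.periodic_off_coset h0 hH with ⟨hAH, hst⟩ | ⟨b₀, hb₀, ⟨z, hz, hzAB⟩, hst⟩
  · left
    have hcoe : (A : Set G) = H := by
      ext x; exact hAH x
    refine ⟨H, Or.inl ⟨hne.lt_top, hcoe ▸ A.finite_toSet, _, h.similar, hcoe, ?_, rfl, ?_⟩⟩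
    · ext g
      rw [AddAction.mem_stabilizer_iff]
      change g +ᵥ (B : Set G) = B ↔ _
      constructor
      · intro hg
        refine (hAH g).1 (h.maxPair.max_left g fun b hb => ?_)
        refine mem_add.2 ⟨0, h0, g + b, ?_, zero_add _⟩
        have : g +ᵥ b ∈ g +ᵥ (B : Set G) := Set.vadd_mem_vadd_set hb
        rw [hg] at this
        exact this
      · intro hg
        ext x
        rw [Set.mem_vadd_set_iff_neg_vadd_mem, vadd_eq_add]
        constructor
        · intro hx
          have := hst _ hx g hg
          rwa [add_right_comm, neg_add_cancel, zero_add] at this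
        · intro hx
          rw [add_comm]
          exact hst _ hx _ (H.neg_mem hg)
    · obtain ⟨z, hz⟩ := h.maxPair.exists_notMem
      exact ⟨-z, mem_third_coe.2 (by rwa [neg_neg])⟩
  · right
    have h' : Config T A ((-b₀) +ᵥ B) := by simpa using h.vadd 0 (-b₀)
    have hmem : ∀ x, x ∈ (-b₀) +ᵥ B ↔ b₀ + x ∈ B := fun x => by
      rw [mem_vadd_finset, ← neg_neg b₀]
      constructor
      · rintro ⟨y, hy, rfl⟩
        simpa using hy
      · exact fun hx => ⟨_, hx, by simp⟩
    have hAH : ∀ a ∈ A, a ∈ H := fun a ha => AddSubgroup.subset_closure ha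
    have hB0 : (0 : G) ∈ (-b₀) +ᵥ B := by rw [hmem]; simpa using hb₀
    have hzB : z - b₀ ∉ A + ((-b₀) +ᵥ B) := by
      rw [add_vadd_finset, mem_vadd_finset]
      rintro ⟨y, hy, hyz⟩
      rw [vadd_eq_add, neg_add_eq_sub, sub_left_inj] at hyz
      exact hzAB (hyz ▸ hy)
    have hstB : ∀ b ∈ (-b₀) +ᵥ B, b ∉ H → ∀ x ∈ H, b + x ∈ (-b₀) +ᵥ B := by
      intro b hb hbH x hx
      rw [hmem] at hb ⊢
      rw [← add_assoc]
      exact hst _ hb (by simpa using hbH) x hx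
    have hsum : ∀ a ∈ A, ∀ b ∈ (-b₀) +ᵥ B, a + b ∈ H → a ∈ H ∧ b ∈ H := fun a ha b _ hab =>
      ⟨hAH a ha, (H.add_mem_cancel_left (hAH a ha)).1 hab⟩
    have hzero : ∀ b ∈ (-b₀) +ᵥ B, b ∈ A + ((-b₀) +ᵥ B) := fun b hb =>
      mem_add.2 ⟨0, h0, b, hb, zero_add b⟩
    refine ⟨H, restrict H A, restrict H ((-b₀) +ᵥ B), h'.maxPair.restrict ⟨0, h0, H.zero_mem⟩
      ⟨0, hB0, H.zero_mem⟩ ⟨_, hz, hzB⟩ hsum ?_ (fun a ha haH => absurd (hAH a ha) haH)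
      (fun b hb hbH x hx => hzero _ (by rw [add_comm]; exact hstB b hb hbH x hx)), Or.inr ?_,
      Or.inl ?_⟩
    · rw [filter_eq_empty_iff.2 fun a ha => not_not.2 (hAH a ha), card_empty, zero_add]
      exact card_le_card (filter_subset_filter _ hzero)
    -- The size drops: `A` spans `H` but not `G`, so it loses its extra 1. `B` either loses an
    -- element outside `H`, which offsets a possible new 1, or lies in `H` and already carried that
    -- 1.
    · have hA1 : ¬ Spans (A : Set G) := fun hs =>
        hne (hs _ 0 fun x hx => by rw [sub_zero]; exact AddSubgroup.subset_closure hx)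
      have hA2 : Spans (restrict H A : Set H) := by
        intro L g hL
        have hg : g ∈ L := by
          have := hL 0 (mem_coe.2 (mem_restrict.2 h0))
          rwa [zero_sub, L.neg_mem_iff] at this
        have hle : H ≤ L.map H.subtype := by
          refine (AddSubgroup.closure_le _).2 fun x hx => ?_
          have := L.add_mem (hL ⟨x, hAH x hx⟩ (mem_coe.2 (mem_restrict.2 hx))) hg
          rw [sub_add_cancel] at this
          exact ⟨_, this, rfl⟩
        rw [eq_top_iff]
        rintro x -
        obtain ⟨y, hy, hyx⟩ := hle x.2
        rwa [← Subtype.ext hyx]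
      have hcA := card_restrict_add H A
      have hcB := card_restrict_add H ((-b₀) +ᵥ B)
      rw [card_vadd_finset] at hcB
      rw [pairSize, pairSize, if_neg hA1, if_pos hA2]
      by_cases hBH : ∃ b ∈ (-b₀) +ᵥ B, b ∉ H
      · obtain ⟨b, hb, hbH⟩ := hBH
        have : 0 < #(((-b₀) +ᵥ B).filter (· ∉ H)) := card_pos.2 ⟨b, mem_filter.2 ⟨hb, hbH⟩⟩
        split_ifs <;> omega
      · push Not at hBH
        have hB1 : ¬ Spans (B : Set G) := fun hs => hne (hs.vadd (-b₀) H 0 fun x hx => by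
          rw [sub_zero]
          exact hBH x (by rwa [← mem_coe, coe_vadd_finset]))
        rw [if_neg hB1]
        split_ifs <;> omega
    refine ⟨hne.lt_top, _, h'.similar, ⟨⟨0, h0⟩, hAH,
      ⟨0, fun x hx => by rw [zero_vadd]; exact hAH x hx⟩, ?_⟩, ?_, rfl,
      ⟨0, hB0, H.zero_mem⟩, ⟨-(z - b₀), mem_third_coe.2 (by rwa [neg_neg]), H.neg_mem hz⟩, ?_⟩
    · rintro L ⟨g, hg⟩
      rw [hH, AddSubgroup.closure_le]
      have hg0 := hg h0
      rw [Set.mem_vadd_set_iff_neg_vadd_mem, vadd_eq_add, add_zero] at hg0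
      intro x hx
      have := hg hx
      rw [Set.mem_vadd_set_iff_neg_vadd_mem, vadd_eq_add] at this
      exact (L.add_mem_cancel_left hg0).1 this
    · ext x
      constructor
      · rintro ⟨y, ⟨hyB, hyH⟩, k, hk, rfl⟩
        exact ⟨hstB y hyB hyH k hk, fun hyk => hyH ((H.add_mem_cancel_right hk).1 hyk)⟩
      · exact fun hx => ⟨x, hx, 0, H.zero_mem, add_zero x⟩
    · rw [map_restrict hsum, Set.inter_eq_left.2 (fun x hx => hAH x hx : (A : Set G) ⊆ H)]

theorem spans_vadd_iff {S : Set G} {u : G} : Spans (u +ᵥ S) ↔ Spans S :=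
  ⟨fun h => by simpa using h.vadd (-u), fun h => h.vadd u⟩

theorem Config.isBeatOrChord_of_not_spans {T : Triple G} {A B : Finset G}
    (h : Config T A B) (hA : ¬ Spans (A : Set G)) : IsBeatOrChord T (pairSize A B) := by
  obtain ⟨a, ha⟩ := h.maxPair.nonempty_left
  have e : pairSize ((-a) +ᵥ A) B = pairSize A B := by
    rw [pairSize, pairSize, coe_vadd_finset, card_vadd_finset, if_neg hA,
      if_neg (spans_vadd_iff.not.2 hA)]
  have h' : Config T ((-a) +ᵥ A) B := by simpa using h.vadd (-a) 0
  rw [← e]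
  refine h'.isBeatOrChord_of_closure_ne_top
    (mem_vadd_finset.2 ⟨a, ha, neg_add_cancel a⟩) fun he => hA fun L g hL => ?_
  rw [eq_top_iff, ← he, AddSubgroup.closure_le]
  intro x hx
  obtain ⟨y, hy, rfl⟩ := mem_vadd_finset.1 (mem_coe.1 hx)
  have := L.sub_mem (hL y hy) (hL a ha)
  rwa [sub_sub_sub_cancel_right, ← neg_add_eq_sub] at this

section Chord

variable {M : AddSubgroup G} [DecidableEq (G ⧸ M)]

theorem mem_cosetSequence {ρ a x : G} {k : ℕ} :
    x ∈ cosetSequence M ρ a k ↔ (x : G ⧸ M) ∈ ap (a : G ⧸ M) (ρ : G ⧸ M) (k + 1) := by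
  simp only [cosetSequence, Set.mem_iUnion, Set.mem_Iic, mem_ap, Nat.lt_succ_iff, exists_prop,
    Set.mem_vadd_set_iff_neg_vadd_mem, vadd_eq_add, SetLike.mem_coe, ← QuotientAddGroup.eq]
  rfl

theorem generatesQuotient {ρ : G} (hr : AddSubgroup.zmultiples (ρ : G ⧸ M) = ⊤) :
    GeneratesQuotient ⊤ M ρ := by
  refine ⟨trivial, eq_top_iff.2 fun x _ => ?_⟩
  obtain ⟨n, hn⟩ := AddSubgroup.mem_zmultiples_iff.1
    (show (x : G ⧸ M) ∈ AddSubgroup.zmultiples (ρ : G ⧸ M) by rw [hr]; trivial)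
  refine AddSubgroup.mem_sup.2 ⟨x - n • ρ, ?_, n • ρ, ⟨n, rfl⟩, by abel⟩
  exact mk_eq_mk_iff.1 (hn.symm.trans (QuotientAddGroup.mk_zsmul M ρ n).symm)

variable [Finite M]

/-- The sum fills all its cosets except possibly `M`; by maximality the same holds for `A` and for
`B`. The chord is pure or impure according to whether `M` is contained in `A + B`. -/
theorem Config.isBeatOrChord_of_full_off_zero {T : Triple G} {n : ℕ} {A B : Finset G}
    (h : Config T A B) {ρ : G} {p q : ℕ} (hM : M ≠ ⊤) (hp : 1 ≤ p) (hq : 1 ≤ q)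
    (hr : AddSubgroup.zmultiples (ρ : G ⧸ M) = ⊤) (hA : proj M A = ap 0 (ρ : G ⧸ M) (p + 1))
    (hB : proj M B = ap 0 (ρ : G ⧸ M) (q + 1)) (hz : ∃ z, z ∉ proj M A + proj M B)
    (hfull : ∀ w : G, (w : G ⧸ M) ∈ proj M A + proj M B → (w : G ⧸ M) ≠ 0 → w ∈ A + B)
    (hC : ∀ g : G, ∃ c ∈ third ⊤ (A : Set G) B, c - g ∉ M) : IsBeatOrChord T n := by
  classical
  have hAB : proj M A + proj M B = ap 0 (ρ : G ⧸ M) (p + q + 1) := by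
    rw [hA, hB, ap_add_ap, add_zero]
  rw [hAB] at hz hfull
  have hinj := injOn_of_notMem_ap hr hz
  have hpos : ∀ i j : ℕ, i ≤ p → j ≤ q → 1 ≤ i + j → ∀ w : G,
      (w : G ⧸ M) = i • (ρ : G ⧸ M) + j • (ρ : G ⧸ M) → w ∈ A + B := by
    intro i j hi hj hij w hw
    rw [← add_nsmul] at hw
    refine hfull w (mem_ap.2 ⟨i + j, by omega, by rw [zero_add, hw]⟩) fun h0 => ?_
    have := hinj (i + j) (by omega) 0 (by omega) (by rw [← hw, h0, zero_nsmul, add_zero])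
    omega
  have hAmem : ∀ i : ℕ, i ≤ p → 1 ≤ i → ∀ x : G, (x : G ⧸ M) = i • (ρ : G ⧸ M) → x ∈ A := by
    intro i hi hi1 x hx
    refine h.maxPair.max_left x fun b hb => ?_
    have hb' := mk_mem_proj (M := M) hb
    rw [hB] at hb'
    obtain ⟨j, hj, hjb⟩ := mem_ap.1 hb'
    exact hpos i j hi (by omega) (by omega) _ (by
      rw [QuotientAddGroup.mk_add, hx, ← hjb, zero_add])
  have hBmem : ∀ i : ℕ, i ≤ q → 1 ≤ i → ∀ x : G, (x : G ⧸ M) = i • (ρ : G ⧸ M) → x ∈ B := by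
    intro j hj hj1 x hx
    refine h.maxPair.max_right x fun a ha => ?_
    have ha' := mk_mem_proj (M := M) ha
    rw [hA] at ha'
    obtain ⟨i, hi, hia⟩ := mem_ap.1 ha'
    exact hpos i j (by omega) hj (by omega) _ (by
      rw [QuotientAddGroup.mk_add, hx, ← hia, zero_add])
  have hseq : ∀ (S : Finset G) (k : ℕ), proj M S = ap 0 (ρ : G ⧸ M) (k + 1) →
      (∀ i : ℕ, i ≤ k → 1 ≤ i → ∀ x : G, (x : G ⧸ M) = i • (ρ : G ⧸ M) → x ∈ S) →
      ∀ x : G, x ∈ (M : Set G) ∪ S ↔ x ∈ cosetSequence M ρ 0 k := by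
    intro S k hS hmem x
    rw [mem_cosetSequence, QuotientAddGroup.mk_zero]
    constructor
    · rintro (hx | hx)
      · exact mem_ap.2 ⟨0, by omega, by
          rw [zero_nsmul, add_zero, (QuotientAddGroup.eq_zero_iff x).2 hx]⟩
      · rw [← hS]
        exact mk_mem_proj hx
    · intro hx
      obtain ⟨i, hi, hix⟩ := mem_ap.1 hx
      rw [zero_add] at hix
      rcases Nat.eq_zero_or_pos i with rfl | hi0
      · left
        rw [zero_nsmul] at hix
        exact (QuotientAddGroup.eq_zero_iff x).1 hix.symm
      · exact Or.inr (hmem i (by omega) hi0 x hix.symm)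
  have hzero : ∀ (S : Finset G) (k : ℕ), proj M S = ap 0 (ρ : G ⧸ M) (k + 1) →
      ∃ s ∈ S, s ∈ M := by
    intro S k hS
    obtain ⟨s, hs, hs0⟩ := mem_proj.1 (show (0 : G ⧸ M) ∈ proj M S by
      rw [hS]; exact mem_ap.2 ⟨0, by omega, by simp⟩)
    exact ⟨s, hs, (QuotientAddGroup.eq_zero_iff s).1 hs0⟩
  obtain ⟨a, ha, haM⟩ := hzero A p hA
  obtain ⟨b, hb, hbM⟩ := hzero B q hB
  by_cases hM0 : ∀ x ∈ M, x ∈ A + B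
  · left
    have hMA : (M : Set G) ⊆ A := by
      intro x hx
      refine h.maxPair.max_left x fun b hb => ?_
      have hb' := mk_mem_proj (M := M) hb
      rw [hB] at hb'
      obtain ⟨j, hj, hjb⟩ := mem_ap.1 hb'
      have hxb : ((x + b : G) : G ⧸ M) = j • (ρ : G ⧸ M) := by
        rw [QuotientAddGroup.mk_add, (QuotientAddGroup.eq_zero_iff x).2 hx, ← hjb, zero_add,
          zero_add]
      rcases Nat.eq_zero_or_pos j with rfl | hj0
      · rw [zero_nsmul] at hxb
        exact hM0 _ ((QuotientAddGroup.eq_zero_iff _).1 hxb)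
      · exact hpos 0 j (by omega) (by omega) (by omega) _ (by rw [hxb, zero_nsmul, zero_add])
    have hMB : (M : Set G) ⊆ B := by
      intro x hx
      refine h.maxPair.max_right x fun a ha => ?_
      have ha' := mk_mem_proj (M := M) ha
      rw [hA] at ha'
      obtain ⟨i, hi, hia⟩ := mem_ap.1 ha'
      have hax : ((a + x : G) : G ⧸ M) = i • (ρ : G ⧸ M) := by
        rw [QuotientAddGroup.mk_add, (QuotientAddGroup.eq_zero_iff x).2 hx, ← hia, zero_add,
          add_zero]
      rcases Nat.eq_zero_or_pos i with rfl | hi0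
      · rw [zero_nsmul] at hax
        exact hM0 _ ((QuotientAddGroup.eq_zero_iff _).1 hax)
      · exact hpos i 0 (by omega) (by omega) (by omega) _ (by rw [hax, zero_nsmul, add_zero])
    refine ⟨M, Or.inr ⟨hM.lt_top, Set.toFinite _, ρ, generatesQuotient hr, _, h.similar,
      ⟨0, trivial, p, hp, ?_⟩, ⟨0, trivial, q, hq, ?_⟩, rfl, ?_⟩⟩
    · rw [← Set.ext (hseq A p hA hAmem), Set.union_eq_right.2 hMA]
    · rw [← Set.ext (hseq B q hB hBmem), Set.union_eq_right.2 hMB]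
    · rintro ⟨g, -, hg⟩
      obtain ⟨c, hc, hcg⟩ := hC g
      have := hg hc
      rw [Set.mem_vadd_set_iff_neg_vadd_mem, vadd_eq_add, neg_add_eq_sub] at this
      exact hcg this
  · right
    push Not at hM0
    obtain ⟨x, hx, hxAB⟩ := hM0
    obtain ⟨c, hc, hcM⟩ := hC 0
    rw [sub_zero] at hcM
    have hidx : ∀ (S : Finset G) (k : ℕ), proj M S = ap 0 (ρ : G ⧸ M) (k + 1) → ∀ s ∈ S,
        ∃ i : ℕ, i ≤ k ∧ (s : G ⧸ M) = i • (ρ : G ⧸ M) ∧ (s ∉ M → 1 ≤ i) := by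
      intro S k hS s hs
      have hs' := mk_mem_proj (M := M) hs
      rw [hS] at hs'
      obtain ⟨i, hi, his⟩ := mem_ap.1 hs'
      rw [zero_add] at his
      refine ⟨i, by omega, his.symm, fun hsM => Nat.pos_of_ne_zero ?_⟩
      rintro rfl
      rw [zero_nsmul] at his
      exact hsM ((QuotientAddGroup.eq_zero_iff s).1 his.symm)
    have hmem0 : ∀ (x : G) (i : ℕ), i ≤ p + q → (x : G ⧸ M) = i • (ρ : G ⧸ M) →
        (x ∈ M ↔ i = 0) := by
      intro x i hi hx
      rw [← QuotientAddGroup.eq_zero_iff, hx]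
      constructor
      · intro h0
        exact hinj i (by omega) 0 (by omega) (by rw [h0, zero_nsmul])
      · rintro rfl
        exact zero_nsmul _
    have hsum : ∀ a ∈ A, ∀ b ∈ B, a + b ∈ M → a ∈ M ∧ b ∈ M := by
      intro a ha b hb hab
      obtain ⟨i, hi, hia, -⟩ := hidx A p hA a ha
      obtain ⟨j, hj, hjb, -⟩ := hidx B q hB b hb
      have := (hmem0 (a + b) (i + j) (by omega) (by
        rw [QuotientAddGroup.mk_add, hia, hjb, add_nsmul])).1 hab
      exact ⟨(hmem0 a i (by omega) hia).2 (by omega), (hmem0 b j (by omega) hjb).2 (by omega)⟩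
    refine ⟨M, restrict M A, restrict M B, h.maxPair.restrict ⟨a, ha, haM⟩ ⟨b, hb, hbM⟩
      ⟨x, hx, hxAB⟩ hsum ?_ ?_ ?_, Or.inl inferInstance, ?_⟩
    · have hpρ : p • ρ ∈ A := hAmem p le_rfl hp _ rfl
      -- The first translate lies over the multiples `1, …, p` of `ρ`, the second over `p + 1, …, p
      -- + q`.
      have hd : Disjoint (b +ᵥ A.filter (· ∉ M)) (p • ρ +ᵥ B.filter (· ∉ M)) := by
        rw [disjoint_left]
        intro w hw hw'
        obtain ⟨a', ha', rfl⟩ := mem_vadd_finset.1 hw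
        obtain ⟨b', hb', hab⟩ := mem_vadd_finset.1 hw'
        obtain ⟨ha', haM'⟩ := mem_filter.1 ha'
        obtain ⟨hb', hbM'⟩ := mem_filter.1 hb'
        obtain ⟨i, hi, hia, -⟩ := hidx A p hA a' ha'
        obtain ⟨j, hj, hjb, hj1⟩ := hidx B q hB b' hb'
        have hj1 := hj1 hbM'
        have e := congrArg (fun y : G => (y : G ⧸ M)) hab
        change p • (ρ : G ⧸ M) + (b' : G ⧸ M) = (b : G ⧸ M) + (a' : G ⧸ M) at e
        rw [hjb, hia, (QuotientAddGroup.eq_zero_iff b).2 hbM, zero_add, ← add_nsmul] at e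
        have := hinj (p + j) (by omega) i (by omega) (by rw [e])
        omega
      rw [← card_vadd_finset b (A.filter (· ∉ M)), ← card_vadd_finset (p • ρ) (B.filter (· ∉ M)),
        ← card_union_of_disjoint hd]
      refine card_le_card (union_subset ?_ ?_)
      · intro w hw
        obtain ⟨a', ha', rfl⟩ := mem_vadd_finset.1 hw
        obtain ⟨ha', haM'⟩ := mem_filter.1 ha'
        refine mem_filter.2 ⟨mem_add.2 ⟨a', ha', b, hb, add_comm _ _⟩, fun hmem => haM' ?_⟩
        exact (M.add_mem_cancel_left hbM).1 hmem
      · intro w hw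
        obtain ⟨b', hb', rfl⟩ := mem_vadd_finset.1 hw
        obtain ⟨hb', hbM'⟩ := mem_filter.1 hb'
        exact mem_filter.2 ⟨mem_add.2 ⟨_, hpρ, b', hb', rfl⟩, fun hmem =>
          hbM' (hsum _ hpρ b' hb' hmem).2⟩
    · intro a' ha' haM' y hy
      obtain ⟨i, hi, hia, hi1⟩ := hidx A p hA a' ha'
      exact hpos i 0 hi (by omega) (by have := hi1 haM'; omega) _ (by
        rw [QuotientAddGroup.mk_add, hia, (QuotientAddGroup.eq_zero_iff y).2 hy, zero_nsmul])
    · intro b' hb' hbM' y hy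
      obtain ⟨i, hi, hia, hi1⟩ := hidx B q hB b' hb'
      exact hpos 0 i (by omega) hi (by have := hi1 hbM'; omega) _ (by
        rw [QuotientAddGroup.mk_add, hia, (QuotientAddGroup.eq_zero_iff y).2 hy, zero_nsmul])
    rw [map_restrict hsum]
    exact Or.inr ⟨hM.lt_top, Set.toFinite _, ρ, generatesQuotient hr, _, h.similar,
      ⟨p, hp, Set.ext (hseq A p hA hAmem)⟩, ⟨q, hq, Set.ext (hseq B q hB hBmem)⟩, rfl,
      ⟨c, hc, hcM⟩, ⟨a, ha, haM⟩, ⟨b, hb, hbM⟩,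
      ⟨-x, mem_third_coe.2 (by rwa [neg_neg]), M.neg_mem hx⟩, rfl⟩

theorem proj_vadd (u : G) (X : Finset G) : proj M (u +ᵥ X) = (u : G ⧸ M) +ᵥ proj M X := by
  rw [← singleton_add, proj_add, ← singleton_add]
  congr 1

theorem vadd_ap {Q : Type*} [AddCommGroup Q] [DecidableEq Q] (u x r : Q) (k : ℕ) :
    u +ᵥ ap x r k = ap (u + x) r k := by
  ext y
  rw [mem_vadd_finset, mem_ap]
  constructor
  · rintro ⟨z, hz, rfl⟩
    obtain ⟨j, hj, rfl⟩ := mem_ap.1 hz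
    exact ⟨j, hj, add_assoc _ _ _⟩
  · rintro ⟨j, hj, rfl⟩
    exact ⟨_, mem_ap.2 ⟨j, hj, rfl⟩, (add_assoc _ _ _).symm⟩

theorem Config.isBeatOrChord_of_full_off {T : Triple G} {n : ℕ} {A B : Finset G}
    (h : Config T A B) {x₀ y₀ r : G ⧸ M} {p q : ℕ} (hM : M ≠ ⊤) (hp : 1 ≤ p) (hq : 1 ≤ q)
    (hr : AddSubgroup.zmultiples r = ⊤) (hA : proj M A = ap x₀ r (p + 1))
    (hB : proj M B = ap y₀ r (q + 1)) (hz : ∃ z, z ∉ proj M A + proj M B)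
    (hfull : ∀ w : G, (w : G ⧸ M) ∈ proj M A + proj M B → (w : G ⧸ M) ≠ x₀ + y₀ → w ∈ A + B)
    (hC : ∀ g : G, ∃ c ∈ third ⊤ (A : Set G) B, c - g ∉ M) : IsBeatOrChord T n := by
  induction x₀ using QuotientAddGroup.induction_on with
  | H x₀ =>
  induction y₀ using QuotientAddGroup.induction_on with
  | H y₀ =>
  induction r using QuotientAddGroup.induction_on with
  | H ρ =>
  have e : ((-x₀) +ᵥ A) + ((-y₀) +ᵥ B) = (-(x₀ + y₀)) +ᵥ (A + B) := by
    rw [vadd_add_assoc, add_vadd_comm, vadd_vadd, neg_add]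
  have e' : proj M ((-x₀) +ᵥ A) + proj M ((-y₀) +ᵥ B) =
      ((-(x₀ + y₀) : G) : G ⧸ M) +ᵥ (proj M A + proj M B) := by
    rw [← proj_add, ← proj_add, e, proj_vadd]
  refine (h.vadd (-x₀) (-y₀)).isBeatOrChord_of_full_off_zero hM hp hq hr ?_ ?_ ?_ ?_ ?_
  · rw [proj_vadd, hA, vadd_ap, QuotientAddGroup.mk_neg, neg_add_cancel]
  · rw [proj_vadd, hB, vadd_ap, QuotientAddGroup.mk_neg, neg_add_cancel]
  · obtain ⟨z, hz⟩ := hz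
    exact ⟨_, by rw [e']; exact fun hmem => hz ((vadd_mem_vadd_finset_iff _).1 hmem)⟩
  · intro w hw hw0
    rw [e', ← neg_vadd_mem_iff] at hw
    rw [e, ← neg_vadd_mem_iff]
    have e2 : ((-(-(x₀ + y₀)) +ᵥ w : G) : G ⧸ M) =
        -((-(x₀ + y₀) : G) : G ⧸ M) +ᵥ (w : G ⧸ M) := rfl
    refine hfull _ (e2 ▸ hw) fun hcon => hw0 ?_
    rw [neg_neg, vadd_eq_add, QuotientAddGroup.mk_add, QuotientAddGroup.mk_add] at hcon
    exact add_eq_left.1 hcon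
  · intro g
    obtain ⟨c, hc, hcg⟩ := hC (g - (x₀ + y₀))
    have hcoe : third ⊤ (((-x₀) +ᵥ A : Finset G) : Set G) ((-y₀) +ᵥ B : Finset G) =
        (x₀ + y₀) +ᵥ third ⊤ (A : Set G) B := by
      rw [coe_vadd_finset, coe_vadd_finset,
        third_vadd (AddSubgroup.mem_top _) (AddSubgroup.mem_top _), ← neg_add, neg_neg]
    refine ⟨(x₀ + y₀) +ᵥ c, ?_, ?_⟩
    · rw [hcoe]
      exact Set.vadd_mem_vadd_set hc
    · have e3 : ((x₀ + y₀) +ᵥ c) - g = c - (g - (x₀ + y₀)) := by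
        rw [vadd_eq_add]; abel
      rwa [e3]

theorem ap_reverse {Q : Type*} [AddCommGroup Q] [DecidableEq Q] (x r : Q) (p : ℕ) :
    ap x r (p + 1) = ap (x + p • r) (-r) (p + 1) := by
  have : ∀ j ≤ p, x + p • r + (p - j) • (-r) = x + j • r := by
    intro j hj
    obtain ⟨k, rfl⟩ := Nat.exists_eq_add_of_le hj
    rw [Nat.add_sub_cancel_left, add_nsmul, neg_nsmul]
    abel
  ext y
  rw [mem_ap, mem_ap]
  constructor
  · rintro ⟨j, hj, rfl⟩
    exact ⟨p - j, by omega, this j (by omega)⟩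
  · rintro ⟨j, hj, rfl⟩
    refine ⟨p - j, by omega, ?_⟩
    rw [← this (p - j) (by omega), Nat.sub_sub_self (by omega)]

/-- Since `|M| < |A|` and `A` is a smallest member, neither `B` nor the third set fits into one
`M`-coset. This gives both progressions length at least 2 and the nondegeneracy of the third set. -/
theorem Config.isBeatOrChord_of_good {T : Triple G} {n : ℕ} {A B : Finset G} (h : Config T A B)
    (hM : Good A M) (hA : Spans (A : Set G)) (hAB : #A ≤ #B) {x₀ r : G ⧸ M}
    (hap : proj M A = ap x₀ r #(proj M A)) (hr : AddSubgroup.zmultiples r = ⊤)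
    (hz : ∃ z, z ∉ proj M A + proj M B)
    (hAC : ∀ W : Finset G, (∀ z, z ∈ W) → #A ≤ #(Kemperman.codiff W A B)) : IsBeatOrChord T n := by
  have ha := hM.two_le_card_proj hA
  have hlt := hM.card_lt
  rw [card_add_elems] at hlt
  have hmA : #(elems M) < #A := by
    have := Nat.mul_le_mul_right #(elems M) ha
    omega
  have hB : 2 ≤ #(proj M B) := by
    have h1 := card_le_card_proj_mul (M := M) B
    by_contra! hcon
    have := Nat.mul_le_mul_right #(elems M) (show #(proj M B) ≤ 1 by omega)
    omega
  have hC : ∀ g : G, ∃ c ∈ third ⊤ (A : Set G) B, c - g ∉ M := by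
    intro g
    by_contra! hcon
    have hmem : ∀ c, -c ∉ A + B → c ∈ g +ᵥ elems M := fun c hc =>
      mem_vadd_finset.2 ⟨c - g, mem_elems.2 (hcon c (mem_third_coe.2 hc)), by simp⟩
    have hW : ∀ z, z ∈ (A + B).image (fun x => -x) ∪ (g +ᵥ elems M) := by
      intro z
      by_cases hzz : -z ∈ A + B
      · exact mem_union_left _ (mem_image.2 ⟨_, hzz, neg_neg z⟩)
      · exact mem_union_right _ (hmem z hzz)
    have h1 := hAC _ hW
    have h2 := card_le_card fun y hy => hmem y ((mem_codiff hW).1 hy)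
    rw [card_vadd_finset] at h2
    omega
  have hMt := ne_top_of_notMem_add hM.nonempty hM.exists_notMem
  obtain ⟨p, q, y₀, hp, hq, -, -, hAp, hBq⟩ :=
    hM.eq_ap_succ ha hap hr hB hz h.maxPair.card_lt
  rcases hM.full_off_end hp hq hr hAp hBq hz h.maxPair.card_lt with hf | hf
  · exact h.isBeatOrChord_of_full_off hMt hp hq hr hAp hBq hz hf hC
  -- An exceptional coset at the far end becomes the head when both progressions are read backwards.
  · rw [ap_reverse] at hAp hBq
    refine h.isBeatOrChord_of_full_off hMt hp hq (by rwa [AddSubgroup.zmultiples_neg]) hAp hBq hz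
      (fun w hw hne => hf w hw fun he => hne ?_) hC
    rw [he, add_nsmul]
    abel

end Chord

/-- If `A + B` meets every coset of `M`, the group is finite and the pair formed by `A` and the
third set is used; its own third set is `B`. -/
theorem Config.isBeatOrChord {T : Triple G} {A B : Finset G} (h : Config T A B) (hAB : #A ≤ #B)
    (hAC : ∀ W : Finset G, (∀ z, z ∈ W) → #A ≤ #(Kemperman.codiff W A B)) : IsBeatOrChord T (pairSize A B) := by
  classical
  by_cases hA : Spans (A : Set G)
  swap
  · exact h.isBeatOrChord_of_not_spans hA
  have hz := h.maxPair.exists_notMem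
  obtain ⟨M, _, hM⟩ := exists_good h.maxPair.nonempty_left hA (by
    obtain ⟨z, hz⟩ := hz
    obtain ⟨b, hb⟩ := h.maxPair.nonempty_right
    exact ⟨z - b, fun hmem => hz (mem_add.2 ⟨_, hmem, b, hb, sub_add_cancel z b⟩)⟩)
  obtain ⟨x₀, r, hap, hr⟩ :=
    hM.exists_proj_eq_ap hA h.maxPair.nonempty_right hz h.maxPair.card_lt hAB hAC
  by_cases hQB : ∃ z, z ∉ proj M A + proj M B
  · exact h.isBeatOrChord_of_good hM hA hAB hap hr hQB hAC
  push Not at hQB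
  obtain ⟨W, hW⟩ := exists_univ_of_proj hQB
  have hCW := hAC W hW
  refine (h.codiff hW).isBeatOrChord_of_good hM hA hCW hap hr
    ((hM.exists_notMem_proj_add hW hA h.maxPair.nonempty_right hz h.maxPair.card_lt hAB
      hCW).resolve_left fun ⟨z, hz⟩ => hz (hQB z)) fun V hV => ?_
  have : V = W := by ext x; simp [hV, hW]
  rwa [this, h.maxPair.codiff_codiff hW]

end Step

section Step

variable {G : Type*} [AddCommGroup G]

theorem pairSize_comm (A B : Finset G) : pairSize A B = pairSize B A :=
  add_comm _ _

variable [DecidableEq G]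

theorem Config.swap {T : Triple G} {A B : Finset G} (h : Config T A B) : Config T B A := by
  refine ⟨?_, h.maxPair.nonempty_right, h.maxPair.nonempty_left, ?_, ?_, ?_, ?_⟩
  · have := h.similar.tail (SimilarStep.swapAB _ _ _)
    rwa [third, add_comm (A : Set G)] at this
  · rw [add_comm]
    exact h.maxPair.exists_notMem
  · rw [add_comm, add_comm #B]
    exact h.maxPair.card_lt
  · intro x hx
    exact h.maxPair.max_right x fun b hb => by
      rw [add_comm b, add_comm A]
      exact hx b hb
  · intro x hx
    exact h.maxPair.max_left x fun b hb => by
      rw [add_comm x, add_comm A]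
      exact hx b hb

theorem IsBeatOrChord.of_finite [Finite G] {T : Triple G} {n k : ℕ} (h : IsBeatOrChord T n) :
    IsBeatOrChord T k :=
  h.imp_right fun ⟨H, A, B, hm, _, hi⟩ => ⟨H, A, B, hm, Or.inl inferInstance, hi⟩

/-- Reduction to a smallest first set. When the third set is the smallest, the group is finite, so
the size bound on the continuation is irrelevant and the pair may be changed freely. -/
theorem Config.isBeatOrChord_pairSize {T : Triple G} {A B : Finset G} (h : Config T A B) :
    IsBeatOrChord T (pairSize A B) := by
  wlog hAB : #A ≤ #B generalizing A B
  · rw [pairSize_comm]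
    exact this h.swap (by omega)
  by_cases hAC : ∀ W : Finset G, (∀ z, z ∈ W) → #A ≤ #(Kemperman.codiff W A B)
  · exact h.isBeatOrChord hAB hAC
  · push Not at hAC
    obtain ⟨W, hW, hlt⟩ := hAC
    have : Finite G := Set.finite_univ_iff.1 (W.finite_toSet.subset fun x _ => hW x)
    have e : Kemperman.codiff W (Kemperman.codiff W A B) A = B := by
      rw [Kemperman.codiff, add_comm]
      exact h.maxPair.codiff_codiff hW
    refine ((h.codiff hW).swap.isBeatOrChord (by omega) fun V hV => ?_).of_finite
    have : V = W := by ext x; simp [hV, hW]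
    rw [this, e]
    omega

end Step

/-! ### From a maximal critical trio to a pair of finite sets -/

section Initial

variable {G : Type*} [AddCommGroup G]

theorem IsTrio.swapAB {K : AddSubgroup G} {T : Triple G} (h : IsTrio K T) :
    IsTrio K ⟨T.B, T.A, T.C⟩ :=
  ⟨h.2, h.1, h.3, h.5, h.4, h.6, by rw [add_comm T.B]; exact h.7⟩

theorem IsTrio.swapBC {K : AddSubgroup G} {T : Triple G} (h : IsTrio K T) :
    IsTrio K ⟨T.A, T.C, T.B⟩ :=
  ⟨h.1, h.3, h.2, h.4, h.6, h.5, by rw [add_right_comm]; exact h.7⟩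

theorem IsMaximal.swapAB {K : AddSubgroup G} {T : Triple G} (h : IsMaximal K T) :
    IsMaximal K ⟨T.B, T.A, T.C⟩ := by
  intro T' hT' hA hB hC
  rw [← h _ hT'.swapAB hB hA hC]

theorem IsMaximal.swapBC {K : AddSubgroup G} {T : Triple G} (h : IsMaximal K T) :
    IsMaximal K ⟨T.A, T.C, T.B⟩ := by
  intro T' hT' hA hB hC
  rw [← h _ hT'.swapBC hA hC hB]

theorem isTrio_third {A B : Set G} (hA : A.Finite) (hB : B.Finite) :
    IsTrio ⊤ ⟨A, B, third ⊤ A B⟩ := by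
  refine ⟨Set.subset_univ _, Set.subset_univ _, Set.subset_univ _, Or.inl hA, Or.inl hB,
    Or.inr ?_, ?_⟩
  · refine (hA.add hB).neg.subset fun x hx => ?_
    by_contra hcon
    exact hx.2 ⟨hx.1, hcon⟩
  · rintro ⟨s, hs, c, hc, hsc⟩
    refine (mem_third.1 hc).2 ?_
    rwa [← eq_neg_of_add_eq_zero_left hsc]

/-- If `A` were infinite, so would be `C`, which is then cofinite. For a fixed `b` in `B` only
finitely many `a` have `-(a + b)` outside `C`, so 0 would be a sum. -/
theorem IsTrio.finite_of_encard_le {A B C : Set G} (h : IsTrio ⊤ ⟨A, B, C⟩) (hB : B.Nonempty)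
    (hAC : A.encard ≤ C.encard) : A.Finite := by
  by_contra hA
  have hC : ¬ C.Finite := fun hC => hA (Set.encard_lt_top_iff.1
    (hAC.trans_lt (Set.encard_lt_top_iff.2 hC)))
  have hC' : ((⊤ : AddSubgroup G) \ C : Set G).Finite := h.6.resolve_left hC
  obtain ⟨b, hb⟩ := hB
  have hfin : {a : G | -(a + b) ∉ C}.Finite :=
    Set.Finite.preimage (f := fun a : G => -(a + b)) (fun x _ y _ hxy =>
      add_right_cancel (neg_injective hxy)) (hC'.subset fun x hx => ⟨AddSubgroup.mem_top x, hx⟩ :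
        Cᶜ.Finite)
  obtain ⟨a, ha, haC⟩ := (Set.Infinite.sdiff hA hfin).nonempty
  refine h.7 ⟨a + b, ⟨a, ha, b, hb, rfl⟩, -(a + b), not_not.1 haC, add_neg_cancel _⟩

/-- Maximality is tested on three enlargements: `C` replaced by the full complement of `-(A + B)`,
and one element added to `A` or to `B`. -/
theorem IsMaximal.exists_config [DecidableEq G] {A B C : Set G} (hmax : IsMaximal ⊤ ⟨A, B, C⟩)
    (ht : IsTrio ⊤ ⟨A, B, C⟩) (hA : A.Nonempty) (hB : B.Nonempty) (hC : C.Nonempty)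
    (hAC : A.encard ≤ C.encard) (hBC : B.encard ≤ C.encard)
    (hlt : (((⊤ : AddSubgroup G) : Set G) \ C).encard < A.encard + B.encard) :
    ∃ A' B' : Finset G, Config ⟨A, B, C⟩ A' B' := by
  have hAf := ht.finite_of_encard_le hB hAC
  have hBf := ht.swapAB.finite_of_encard_le hA hBC
  lift A to Finset G using hAf
  lift B to Finset G using hBf
  have hsub : C ⊆ third ⊤ (A : Set G) B := fun c hc => mem_third.2 ⟨AddSubgroup.mem_top c,
    fun hmem => ht.7 ⟨-c, hmem, c, hc, neg_add_cancel c⟩⟩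
  have hCe : third ⊤ (A : Set G) B = C := congrArg Triple.C
    (hmax _ (isTrio_third A.finite_toSet B.finite_toSet) subset_rfl subset_rfl hsub)
  subst hCe
  refine ⟨A, B, Relation.ReflTransGen.refl, hA, hB, ?_, ?_, ?_, ?_⟩
  · obtain ⟨c, hc⟩ := hC
    exact ⟨-c, mem_third_coe.1 hc⟩
  · have e : ((⊤ : AddSubgroup G) : Set G) \ third ⊤ (A : Set G) B = -(A + B : Finset G) := by
      ext x
      rw [Set.mem_sdiff, mem_third_coe, not_not, Set.mem_neg, mem_coe]
      exact and_iff_right (AddSubgroup.mem_top x)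
    rw [e, ← coe_neg, Set.encard_coe_eq_coe_finsetCard, Set.encard_coe_eq_coe_finsetCard,
      Set.encard_coe_eq_coe_finsetCard, card_neg] at hlt
    exact_mod_cast hlt
  · intro x hx
    have hT : IsTrio ⊤ ⟨(insert x A : Finset G), (B : Set G), third ⊤ (A : Set G) B⟩ := by
      refine ⟨Set.subset_univ _, ht.2, ht.3, Or.inl (finite_toSet _), ht.5, ht.6, ?_⟩
      rintro ⟨s, ⟨y, hy, b, hb, rfl⟩, c, hc, hsc⟩
      rw [← eq_neg_iff_add_eq_zero] at hsc
      refine mem_third_coe.1 hc ?_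
      rw [← hsc]
      rcases mem_insert.1 (mem_coe.1 hy) with rfl | hy
      · exact hx b hb
      · exact mem_add.2 ⟨y, hy, b, hb, rfl⟩
    have := congrArg Triple.A (hmax _ hT (coe_subset.2 (subset_insert _ _)) subset_rfl subset_rfl)
    have h2 : x ∈ ((insert x A : Finset G) : Set G) := mem_insert_self _ _
    exact this.subset h2
  · intro x hx
    have hT : IsTrio ⊤ ⟨(A : Set G), (insert x B : Finset G), third ⊤ (A : Set G) B⟩ := by
      refine ⟨ht.1, Set.subset_univ _, ht.3, ht.4, Or.inl (finite_toSet _), ht.6, ?_⟩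
      rintro ⟨s, ⟨a, ha, y, hy, rfl⟩, c, hc, hsc⟩
      rw [← eq_neg_iff_add_eq_zero] at hsc
      refine mem_third_coe.1 hc ?_
      rw [← hsc]
      rcases mem_insert.1 (mem_coe.1 hy) with rfl | hy
      · exact hx a ha
      · exact mem_add.2 ⟨a, ha, y, hy, rfl⟩
    have := congrArg Triple.B (hmax _ hT subset_rfl (coe_subset.2 (subset_insert _ _)) subset_rfl)
    have h2 : x ∈ ((insert x B : Finset G) : Set G) := mem_insert_self _ _
    exact this.subset h2

theorem IsCritical.exists_config [DecidableEq G] {T : Triple G} (h : IsCritical ⊤ T)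
    (ht : IsTrio ⊤ T) (hmax : IsMaximal ⊤ T) (hne : IsNontrivial T) :
    ∃ A B : Finset G, Config T A B := by
  obtain ⟨hA, hB, hC⟩ := hne
  rcases h with ⟨h1, h2, h3⟩ | ⟨h1, h2, h3⟩ | ⟨h1, h2, h3⟩
  · obtain ⟨A', B', h⟩ := hmax.swapAB.swapBC.exists_config ht.swapAB.swapBC hB hC hA h1 h2 h3
    exact ⟨A', B', (similar_rotate T.A T.B T.C).trans h.similar, h.maxPair⟩
  · obtain ⟨A', B', h⟩ := hmax.swapBC.exists_config ht.swapBC hA hC hB h1 h2 h3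
    exact ⟨A', B', .head (SimilarStep.swapBC T.A T.B T.C) h.similar, h.maxPair⟩
  · exact hmax.exists_config ht hA hB hC h1 h2 h3

end Initial

/-! ### Transport along injective homomorphisms -/

section Map

variable {G G' : Type*} [AddCommGroup G] [AddCommGroup G'] {f : G' →+ G} {K H : AddSubgroup G'}
  {T T₂ : Triple G'}

theorem image_vadd_set (g : G') (A : Set G') : f '' (g +ᵥ A) = f g +ᵥ f '' A :=
  Set.image_vadd_distrib f g A

theorem SimilarStep.map (h : SimilarStep K T T₂) :
    SimilarStep (K.map f) (T.map f) (T₂.map f) := by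
  cases h with
  | swapAB A B C => exact .swapAB _ _ _
  | swapBC A B C => exact .swapBC _ _ _
  | translate A B C g hg =>
    have := SimilarStep.translate (K := K.map f) (f '' A) (f '' B) (f '' C) (f g) ⟨g, hg, rfl⟩
    rwa [← map_neg, ← image_vadd_set, ← image_vadd_set] at this

theorem Similar.map (h : Similar K T T₂) : Similar (K.map f) (T.map f) (T₂.map f) :=
  Relation.ReflTransGen.lift (Triple.map f) (fun _ _ => SimilarStep.map) _ _ h

theorem image_third (hf : Function.Injective f) (A B : Set G') :
    f '' third K A B = third (K.map f) (f '' A) (f '' B) := by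
  rw [third, third, Set.image_sdiff hf, ← Set.image_add, ← Set.image_neg]
  rfl

theorem map_lt_map (hf : Function.Injective f) (h : H < K) : H.map f < K.map f :=
  (AddSubgroup.map_lt_map_iff_of_injective hf).2 h

theorem IsTrio.map (hf : Function.Injective f) (h : IsTrio K T) :
    IsTrio (K.map f) (T.map f) := by
  have hfin : ∀ S : Set G', (S.Finite ∨ ((K : Set G') \ S).Finite) →
      ((f '' S).Finite ∨ ((K.map f : Set G) \ f '' S).Finite) := fun S hS =>
    hS.imp (fun h => h.image f) fun h => by
      rw [AddSubgroup.coe_map, ← Set.image_sdiff hf]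
      exact h.image f
  refine ⟨Set.image_mono h.1, Set.image_mono h.2, Set.image_mono h.3, hfin _ h.4, hfin _ h.5,
    hfin _ h.6, ?_⟩
  change (0 : G) ∉ f '' T.A + f '' T.B + f '' T.C
  rw [← Set.image_add, ← Set.image_add]
  rintro ⟨x, hx, h0⟩
  rw [(map_eq_zero_iff f hf).1 h0] at hx
  exact h.7 hx

theorem image_stabilizer (hf : Function.Injective f) {B : Set G'} (hB : B.Nonempty) :
    AddAction.stabilizer G (f '' B) = (AddAction.stabilizer G' B).map f := by
  ext g
  rw [AddAction.mem_stabilizer_iff, AddSubgroup.mem_map]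
  constructor
  · intro hg
    obtain ⟨b, hb⟩ := hB
    have hmem : g +ᵥ f b ∈ f '' B := by
      rw [← hg]
      exact Set.vadd_mem_vadd_set (Set.mem_image_of_mem f hb)
    obtain ⟨b', hb', he⟩ := hmem
    have hg' : f (b' - b) = g := by
      rw [map_sub, he, vadd_eq_add, add_sub_cancel_right]
    refine ⟨b' - b, ?_, hg'⟩
    rw [AddAction.mem_stabilizer_iff]
    apply hf.image_injective
    rw [image_vadd_set, hg', hg]
  · rintro ⟨x, hx, rfl⟩
    rw [← image_vadd_set, AddAction.mem_stabilizer_iff.1 hx]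

theorem IsPureBeat.map (hf : Function.Injective f) (h : IsPureBeat K H T) :
    IsPureBeat (K.map f) (H.map f) (T.map f) := by
  obtain ⟨hlt, hfin, T', hs, hA, hB, hC, hne⟩ := h
  -- The stabilizer of the empty set is the whole group, which would not be transported correctly;
  -- properness of `H` excludes it.
  have hBne : T'.B.Nonempty := by
    rw [Set.nonempty_iff_ne_empty]
    intro he
    have : H = ⊤ := by
      rw [← hB, he, eq_top_iff]
      exact fun g _ => Set.vadd_set_empty
    exact not_top_lt (this ▸ hlt)
  refine ⟨map_lt_map hf hlt, hfin.image f, T'.map f, hs.map, ?_, ?_, ?_, hne.image f⟩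
  · exact congrArg (f '' ·) hA
  · exact (image_stabilizer hf hBne).trans (congrArg (AddSubgroup.map f) hB)
  · exact (congrArg (f '' ·) hC).trans (image_third hf _ _)

theorem HasClosure.map {A : Set G'} (h : HasClosure A H) :
    HasClosure (f '' A) (H.map f) := by
  obtain ⟨⟨a, ha⟩, hAH, -, hle⟩ := h
  refine ⟨⟨_, Set.mem_image_of_mem f ha⟩, Set.image_mono hAH,
    ⟨0, by rw [zero_vadd]; exact Set.image_mono hAH⟩, ?_⟩
  rintro L ⟨g, hg⟩
  have hmem : ∀ x ∈ A, -g + f x ∈ L := fun x hx => by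
    have := hg (Set.mem_image_of_mem f hx)
    rwa [Set.mem_vadd_set_iff_neg_vadd_mem] at this
  rw [AddSubgroup.map_le_iff_le_comap]
  refine hle ⟨a, fun x hx => ?_⟩
  rw [Set.mem_vadd_set_iff_neg_vadd_mem]
  change f (-a + x) ∈ L
  have := L.sub_mem (hmem x hx) (hmem a ha)
  rwa [add_sub_add_left_eq_sub, ← map_sub, ← neg_add_eq_sub] at this

theorem IsStable.map {B : Set G'} (h : IsStable H B) : IsStable (H.map f) (f '' B) := by
  rw [IsStable, AddSubgroup.coe_map, ← Set.image_add, h]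

theorem IsImpureBeat.map (hf : Function.Injective f) (h : IsImpureBeat K H T T₂) :
    IsImpureBeat (K.map f) (H.map f) (T.map f) (T₂.map f) := by
  obtain ⟨hlt, T', hs, hA, hB, hC, hBH, hCH, rfl⟩ := h
  have hi : ∀ S : Set G', f '' S ∩ (H.map f : Set G) = f '' (S ∩ H) := fun S =>
    (Set.image_inter hf).symm
  have hd : ∀ S : Set G', f '' S \ (H.map f : Set G) = f '' (S \ H) := fun S =>
    (Set.image_sdiff hf _ _).symm
  refine ⟨map_lt_map hf hlt, T'.map f, hs.map, hA.map, ?_, ?_, ?_, ?_, ?_⟩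
  · change IsStable _ (f '' T'.B \ _)
    rw [hd]
    exact hB.map
  · change f '' T'.C \ _ = third _ (f '' T'.A) (f '' T'.B) \ _
    rw [← image_third hf, hd, hd, hC]
  · change (f '' T'.B ∩ _).Nonempty
    rw [hi]
    exact hBH.image f
  · change (f '' T'.C ∩ _).Nonempty
    rw [hi]
    exact hCH.image f
  · exact Triple.ext rfl (hi _).symm (hi _).symm

theorem GeneratesQuotient.map {r : G'} (h : GeneratesQuotient K H r) :
    GeneratesQuotient (K.map f) (H.map f) (f r) :=
  ⟨⟨r, h.1, rfl⟩, by rw [← AddMonoidHom.map_zmultiples, ← AddSubgroup.map_sup, h.2]⟩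

theorem image_cosetSequence (r a : G') (k : ℕ) :
    f '' cosetSequence H r a k = cosetSequence (H.map f) (f r) (f a) k := by
  simp only [cosetSequence, Set.image_iUnion₂, image_vadd_set, map_add, map_nsmul,
    AddSubgroup.coe_map]

theorem IsPureChord.map (hf : Function.Injective f) (h : IsPureChord K H T) :
    IsPureChord (K.map f) (H.map f) (T.map f) := by
  obtain ⟨hlt, hfin, r, hr, T', hs, ⟨a, ha, k, hk, hA⟩, ⟨b, hb, l, hl, hB⟩, hC, hne⟩ := h
  refine ⟨map_lt_map hf hlt, hfin.image f, f r, hr.map, T'.map f, hs.map,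
    ⟨f a, ⟨a, ha, rfl⟩, k, hk, ?_⟩, ⟨f b, ⟨b, hb, rfl⟩, l, hl, ?_⟩, ?_, ?_⟩
  · exact (congrArg (f '' ·) hA).trans (image_cosetSequence _ _ _)
  · exact (congrArg (f '' ·) hB).trans (image_cosetSequence _ _ _)
  · exact (congrArg (f '' ·) hC).trans (image_third hf _ _)
  · rintro ⟨g, ⟨g', hg', rfl⟩, hg⟩
    refine hne ⟨g', hg', (Set.image_subset_image_iff hf).1 ?_⟩
    rw [image_vadd_set]
    exact hg

theorem IsImpureChord.map (hf : Function.Injective f) (h : IsImpureChord K H T T₂) :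
    IsImpureChord (K.map f) (H.map f) (T.map f) (T₂.map f) := by
  obtain ⟨hlt, hfin, r, hr, T', hs, ⟨k, hk, hA⟩, ⟨l, hl, hB⟩, hC, hCn, hAH, hBH, hCH, rfl⟩ := h
  have hi : ∀ S : Set G', f '' S ∩ (H.map f : Set G) = f '' (S ∩ H) := fun S =>
    (Set.image_inter hf).symm
  have hd : ∀ S : Set G', f '' S \ (H.map f : Set G) = f '' (S \ H) := fun S =>
    (Set.image_sdiff hf _ _).symm
  have hu : ∀ S : Set G', (H.map f : Set G) ∪ f '' S = f '' ((H : Set G') ∪ S) := fun S =>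
    (Set.image_union f _ _).symm
  refine ⟨map_lt_map hf hlt, hfin.image f, f r, hr.map, T'.map f, hs.map, ⟨k, hk, ?_⟩,
    ⟨l, hl, ?_⟩, ?_, ?_, ?_, ?_, ?_, ?_⟩
  · change _ ∪ f '' T'.A = _
    rw [hu, hA, image_cosetSequence, map_zero]
  · change _ ∪ f '' T'.B = _
    rw [hu, hB, image_cosetSequence, map_zero]
  · change f '' T'.C \ _ = third _ (f '' T'.A) (f '' T'.B) \ _
    rw [← image_third hf, hd, hd, hC]
  · change (f '' T'.C \ _).Nonempty
    rw [hd]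
    exact hCn.image f
  · change (f '' T'.A ∩ _).Nonempty
    rw [hi]
    exact hAH.image f
  · change (f '' T'.B ∩ _).Nonempty
    rw [hi]
    exact hBH.image f
  · change (f '' T'.C ∩ _).Nonempty
    rw [hi]
    exact hCH.image f
  · exact Triple.ext (hi _).symm (hi _).symm (hi _).symm

end Map

/-! ### Iterating the step -/

section Chain

/-- A chain of continuations which starts at a trio of the group and ends in a pure beat or a
pure chord. -/
inductive HasChain {G : Type*} [AddCommGroup G] : AddSubgroup G → Triple G → Prop
  | pure {K H : AddSubgroup G} {T : Triple G} (ht : IsTrio K T)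
      (h : IsPureBeat K H T ∨ IsPureChord K H T) : HasChain K T
  | cons {K H : AddSubgroup G} {T T₂ : Triple G} (ht : IsTrio K T)
      (h : IsImpureBeat K H T T₂ ∨ IsImpureChord K H T T₂) (hc : HasChain H T₂) : HasChain K T

theorem HasChain.map {G G' : Type*} [AddCommGroup G] [AddCommGroup G'] {f : G' →+ G}
    (hf : Function.Injective f) {K : AddSubgroup G'} {T : Triple G'} (h : HasChain K T) :
    HasChain (K.map f) (T.map f) := by
  induction h with
  | pure ht h => exact .pure (ht.map hf) (h.imp (fun h => h.map hf) fun h => h.map hf)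
  | cons ht h _ ih => exact .cons (ht.map hf) (h.imp (fun h => h.map hf) fun h => h.map hf) ih

universe u

/-- The continuation is handled as a trio of the group `H` itself, and its chain is carried back
along the inclusion; so the induction can range over all groups. -/
theorem HasChain.cons_subtype {G : Type u} [AddCommGroup G] {H : AddSubgroup G} {T : Triple G}
    {T₂ : Triple H} (ht : IsTrio ⊤ T) (h : IsImpureBeat ⊤ H T (T₂.map Subtype.val) ∨
      IsImpureChord ⊤ H T (T₂.map Subtype.val)) (hc : HasChain ⊤ T₂) : HasChain ⊤ T := by
  have := hc.map (f := H.subtype) Subtype.val_injective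
  rw [← AddMonoidHom.range_eq_map, AddSubgroup.range_subtype] at this
  exact .cons ht h this

theorem hasChain_of_finite (n : ℕ) : ∀ (G : Type u) [AddCommGroup G] [DecidableEq G] [Finite G]
    (T : Triple G) (A B : Finset G), Nat.card G ≤ n → IsTrio ⊤ T → Config T A B →
      HasChain ⊤ T := by
  induction n with
  | zero =>
    intro G _ _ _ T A B hn
    exact absurd hn (Nat.not_le.2 Nat.card_pos)
  | succ n ih =>
    intro G _ _ _ T A B hn ht h
    rcases h.isBeatOrChord_pairSize with ⟨H, hH⟩ | ⟨H, A₂, B₂, hm, -, hH⟩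
    · exact .pure ht hH
    · have hlt : H < ⊤ := hH.elim And.left And.left
      have hcard : Nat.card H < Nat.card G := by
        rw [← AddSubgroup.card_top (G := G)]
        exact Set.ncard_lt_ncard hlt
      exact .cons_subtype ht hH (ih H _ A₂ B₂ (by omega)
        (isTrio_third A₂.finite_toSet B₂.finite_toSet) ⟨.refl, hm⟩)

/-- `pairSize` decreases until a continuation lies in a finite group; from there
`hasChain_of_finite` takes over, with the group order as its measure. -/
theorem Config.hasChain (n : ℕ) : ∀ (G : Type u) [AddCommGroup G] [DecidableEq G]
    (T : Triple G) (A B : Finset G), pairSize A B ≤ n → IsTrio ⊤ T → Config T A B →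
      HasChain ⊤ T := by
  induction n with
  | zero =>
    intro G _ _ T A B hn _ h
    have := h.maxPair.nonempty_left.card_pos
    rw [pairSize] at hn
    omega
  | succ n ih =>
    intro G _ _ T A B hn ht h
    rcases h.isBeatOrChord_pairSize with ⟨H, hH⟩ | ⟨H, A₂, B₂, hm, hfin, hH⟩
    · exact .pure ht hH
    · refine .cons_subtype ht hH ?_
      have ht₂ := isTrio_third A₂.finite_toSet B₂.finite_toSet
      rcases hfin with hfin | hlt
      · exact hasChain_of_finite _ H _ A₂ B₂ le_rfl ht₂ ⟨.refl, hm⟩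
      · exact ih H _ A₂ B₂ (by omega) ht₂ ⟨.refl, hm⟩

theorem HasChain.exists_seq {G : Type*} [AddCommGroup G] {K : AddSubgroup G} {T : Triple G}
    (h : HasChain K T) : ∃ (m : ℕ) (S : ℕ → AddSubgroup G) (U : ℕ → Triple G),
      1 ≤ m ∧ S 1 = K ∧ U 1 = T ∧
      (∀ i, 1 ≤ i → i ≤ m → IsTrio (S i) (U i)) ∧
      (∀ i, 1 ≤ i → i < m →
        S (i + 1) < S i ∧
        (IsImpureBeat (S i) (S (i + 1)) (U i) (U (i + 1)) ∨
          IsImpureChord (S i) (S (i + 1)) (U i) (U (i + 1)))) ∧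
      ∃ H : AddSubgroup G, IsPureBeat (S m) H (U m) ∨ IsPureChord (S m) H (U m) := by
  induction h with
  | @pure K H T ht h =>
    exact ⟨1, fun _ => K, fun _ => T, le_rfl, rfl, rfl, fun _ _ _ => ht,
      fun i h1 h2 => absurd h2 (Nat.not_lt.2 h1), H, h⟩
  | @cons K H T T₂ ht h _ ih =>
    obtain ⟨m, S, U, hm, rfl, rfl, htr, hst, hend⟩ := ih
    have hpos : ∀ i, 1 ≤ i → ∃ j, i = j + 1 := fun i hi => ⟨i - 1, by omega⟩
    -- Indices start at 1, so the old sequence is shifted by one; the value at 0 is arbitrary.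
    refine ⟨m + 1, fun i => if i ≤ 1 then K else S (i - 1), fun i => if i ≤ 1 then T else U (i - 1),
      by omega, rfl, rfl, ?_, ?_, ?_⟩
    · intro i h1 h2
      by_cases hi : i ≤ 1
      · simpa only [if_pos hi] using ht
      · simpa only [if_neg hi] using htr (i - 1) (by omega) (by omega)
    · intro i h1 h2
      have hi1 : ¬ i + 1 ≤ 1 := by omega
      by_cases hi : i ≤ 1
      · obtain rfl : i = 1 := by omega
        simp only [if_pos hi, if_neg hi1, Nat.add_sub_cancel]
        exact ⟨h.elim And.left And.left, h⟩
      · simp only [if_neg hi, if_neg hi1, Nat.add_sub_cancel]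
        have := hst (i - 1) (by omega) (by omega)
        rwa [Nat.sub_add_cancel h1] at this
    · have hm1 : ¬ m + 1 ≤ 1 := by omega
      simpa only [if_neg hm1, Nat.add_sub_cancel] using hend

end Chain

end Kemperman
theorem mainTheorem1 {G : Type*} [AddCommGroup G] (T : Kemperman.Triple G)
    (htrio : Kemperman.IsTrio ⊤ T) (hmax : Kemperman.IsMaximal ⊤ T)
    (hnontrivial : Kemperman.IsNontrivial T) (hcrit : Kemperman.IsCritical ⊤ T) :
    ∃ (m : ℕ) (S : ℕ → AddSubgroup G) (U : ℕ → Kemperman.Triple G),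
      1 ≤ m ∧ S 1 = ⊤ ∧ U 1 = T ∧
      (∀ i, 1 ≤ i → i ≤ m → Kemperman.IsTrio (S i) (U i)) ∧
      (∀ i, 1 ≤ i → i < m →
        S (i + 1) < S i ∧
        (Kemperman.IsImpureBeat (S i) (S (i + 1)) (U i) (U (i + 1)) ∨
          Kemperman.IsImpureChord (S i) (S (i + 1)) (U i) (U (i + 1)))) ∧
      ∃ H : AddSubgroup G,
        Kemperman.IsPureBeat (S m) H (U m) ∨ Kemperman.IsPureChord (S m) H (U m) := by
  classical
  obtain ⟨A, B, h⟩ := hcrit.exists_config htrio hmax hnontrivial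
  exact (Kemperman.Config.hasChain _ G T A B le_rfl htrio h).exists_seq
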